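/- **Definitions.** A *normal pseudomanifold* of dimension $d\ge -1$ is a finite simplicial complex such that: for $d=-1$ its only face is $\emptyset$; for $d=0$ it consists of two points; for $d\ge 1$ all its maximal faces (facets) have $d+1$ vertices, the graph on the facets in which $F_1,F_2$ are adjacent when $\#(F_1\setminus F_2)=\#(F_2\setminus F_1)=1$ is connected, and the link of every vertex is a normal pseudomanifold of dimension $d-1$. The standard sphere $S^d_{d+2}$ consists of all proper subsets of a set of size $d+2$. A *subdivision* of a normal pseudomanifold $K$ is a normal pseudomanifold $K'$ together with a homeomorphism $|K'|\to|K|$ of geometric carriers that is linear on each simplex of $K'$. A normal pseudomanifold is a *combinatorial $d$-sphere* if it is $d$-dimensional and it and $S^d_{d+2}$ have isomorphic subdivisions; it is a *combinatorial $d$-manifold* if it is $d$-dimensional and the links of its vertices are combinatorial $(d-1)$-spheres. *Starring* a new vertex $v$ in a nonempty face $\sigma$ of $K$ replaces $K$ by $\{\alpha\in K:\sigma\not\subseteq\alpha\}\cup\{\rho\cup\{v\}:\sigma\not\subseteq\rho,\ \rho\cup\sigma\in K\}$. The join $K*L$ of two complexes has as faces the disjoint unions of a face of $K$ and a face of $L$.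 A *cellular pseudomanifold* $M$ of dimension $d\ge -1$ is a finite lattice, with least element $\mathbf 0$ and greatest element $\mathbf 1$, having a rank function $\rho$ (all maximal chains from $\mathbf 0$ to $x$ have length $\rho(x)$) with $\rho(\mathbf 1)=d+2$, such that for all $x<z$: (a) if $\rho(z)=\rho(x)+2$, there are exactly two $y$ with $x<y<z$; (b) if $\rho(z)>\rho(x)+2$, the graph on the elements $y\in[x,z]$ of rank $\rho(z)-1$, with $\sigma,\gamma$ adjacent when $\rho(\sigma\wedge\gamma)=\rho(z)-2$, is connected. Its barycentric subdivision $B(M)$ is the simplicial complex of all chains in $M\setminus\{\mathbf 0,\mathbf 1\}$. $M$ is a *cellular $d$-sphere* (*cellular $d$-manifold*) if $B(M)$ is a combinatorial $d$-sphere ($d$-manifold). $M$ is a *polytopal sphere* if it is isomorphic to the poset of closed faces (including $\emptyset$ and the polytope itself) of a convex polytope, ordered by inclusion. The join $M*N$ of two cellular pseudomanifolds is the set $\big((M\setminus\{\mathbf 1\})\times(N\setminus\{\mathbf 1\})\big)\cup\{(\mathbf 1,\mathbf 1)\}$ with the componentwise order. **Theorem 2.2.** Let $M$ and $N$ be cellular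 pseudomanifolds of dimensions $m,n\ge 0$. (i) $M*N$ is a cellular pseudomanifold of dimension $m+n+1$, $B(M*N)$ and $B(M)*B(N)$ are normal pseudomanifolds of dimension $m+n+1$, and $B(M*N)$ is a subdivision of $B(M)*B(N)$; moreover, up to isomorphism, $B(M*N)$ is obtained from $B(M)*B(N)$ by finitely many starrings. (ii) If $M$ and $N$ are cellular spheres, then $M*N$ is a cellular sphere. (iii) If $M$ and $N$ are polytopal spheres, then $M*N$ is a polytopal sphere. (iv) If $M*N$ is a cellular manifold, then $M$ and $N$ are cellular spheres, and hence $M*N$ is a cellular sphere. -/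

import Mathlib

/-!
Conventions.  A simplicial complex is Mathlib's `PreAbstractSimplicialComplex V`: a family of
nonempty finite sets ("faces") closed under passing to nonempty subsets.  Its vertices are those
`v : V` for which `{v}` is a face.  Dimensions start at `-1`; all predicates below which refer to a
dimension `d ≥ -1` carry the natural number `k = d + 1` instead.
-/

namespace CellPM

section Complexes

variable {V W : Type*}

/-- The vertex set of a simplicial complex. -/
def vertices (K : PreAbstractSimplicialComplex V) : Set V := {v | {v} ∈ K}

/-- Two complexes are isomorphic if some bijection between their vertex sets identifies their
faces. -/
def IsIsomorphic (K : PreAbstractSimplicialComplex V) (L : PreAbstractSimplicialComplex W) :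
    Prop :=
  ∃ e : vertices K ≃ vertices L, ∀ s : Finset (vertices K),
    s.map (Function.Embedding.subtype _) ∈ K ↔
      (s.map e.toEmbedding).map (Function.Embedding.subtype _) ∈ L

open Classical in
/-- The link of a vertex. -/
def link (K : PreAbstractSimplicialComplex V) (v : V) : PreAbstractSimplicialComplex V where
  faces := {s | s.Nonempty ∧ v ∉ s ∧ insert v s ∈ K}
  isRelLowerSet_faces := by
    rintro s ⟨hs, hv, hK⟩
    refine ⟨hs, fun t hts ht => ⟨ht, fun h => hv (hts h), ?_⟩⟩
    exact (K.isRelLowerSet_faces hK).2 (Finset.insert_subset_insert v hts)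
      (Finset.insert_nonempty v t)

/-- The facets (maximal faces) of a complex. -/
def facets (K : PreAbstractSimplicialComplex V) : Set (Finset V) := {s | Maximal (· ∈ K) s}

open Classical in
/-- The graph on the facets, two of them being adjacent if each has exactly one vertex outside the
other. -/
def facetGraph (K : PreAbstractSimplicialComplex V) : SimpleGraph (facets K) where
  Adj s t := ((s : Finset V) \ t).card = 1 ∧ ((t : Finset V) \ s).card = 1
  symm := ⟨fun _ _ h => ⟨h.2, h.1⟩⟩
  loopless := ⟨fun s h => by simp at h⟩

/-- `IsNormalPseudomanifold k K`: the complex `K` is a normal pseudomanifold of dimension `k - 1`.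
In dimension `-1` the only one has no (nonempty) faces; in dimension `0` it consists of two points;
in dimension `≥ 1` it is finite, pure and strongly connected, and the links of its vertices
are normal pseudomanifolds of one dimension less. -/
def IsNormalPseudomanifold : ℕ → PreAbstractSimplicialComplex V → Prop
  | 0, K => K = ⊥
  | 1, K => (∀ s ∈ K, s.card = 1) ∧ (vertices K).ncard = 2
  | k + 2, K => K.faces.Finite ∧ (∀ s ∈ facets K, s.card = k + 2) ∧ (facetGraph K).Connected ∧
      ∀ v ∈ vertices K, IsNormalPseudomanifold (k + 1) (link K v)

/-- The standard sphere of dimension `k - 1`: all nonempty proper subsets of a set with `k + 1`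
elements. -/
def standardSphere (k : ℕ) : PreAbstractSimplicialComplex (Fin (k + 1)) where
  faces := {s | s.Nonempty ∧ s ≠ Finset.univ}
  isRelLowerSet_faces := by
    rintro s ⟨hs, hu⟩
    refine ⟨hs, fun t hts ht => ⟨ht, ?_⟩⟩
    rintro rfl
    exact hu (Finset.univ_subset_iff.mp hts)

open Classical in
/-- The closed geometric simplex spanned by the unit vectors that belong to the elements
of `s`. -/
def simplex (s : Finset V) : Set (V → ℝ) :=
  convexHull ℝ ((fun v => Pi.single v (1 : ℝ)) '' (s : Set V))

/-- The geometric carrier of a complex, with the topology of the product space `V → ℝ`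
(for a finite complex, this is the Euclidean topology). -/
def carrier (K : PreAbstractSimplicialComplex V) : Set (V → ℝ) := ⋃ s ∈ K, simplex s

/-- `IsSubdivision K' K`: the normal pseudomanifold `K'` admits a homeomorphism of carriers
`|K'| → |K|` which is linear (i.e. affine) on every closed simplex of `K'`. -/
def IsSubdivision (K' : PreAbstractSimplicialComplex W) (K : PreAbstractSimplicialComplex V) :
    Prop :=
  (∃ k, IsNormalPseudomanifold k K') ∧
    ∃ f : carrier K' ≃ₜ carrier K, ∀ s ∈ K', ∃ g : (W → ℝ) →ᵃ[ℝ] (V → ℝ),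
      ∀ x : carrier K', (x : W → ℝ) ∈ simplex s → (f x : V → ℝ) = g x

/-- Two complexes are combinatorially equivalent if they have isomorphic subdivisions.
(A normal pseudomanifold is finite, so up to isomorphism its vertices are natural numbers.) -/
def CombinatoriallyEquivalent (K : PreAbstractSimplicialComplex V)
    (L : PreAbstractSimplicialComplex W) : Prop :=
  ∃ K' L' : PreAbstractSimplicialComplex ℕ,
    IsSubdivision K' K ∧ IsSubdivision L' L ∧ IsIsomorphic K' L'

/-- `IsCombinatorialSphere k K`: `K` is a combinatorial `(k - 1)`-sphere. -/
def IsCombinatorialSphere (k : ℕ) (K : PreAbstractSimplicialComplex V) : Prop :=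
  IsNormalPseudomanifold k K ∧ CombinatoriallyEquivalent K (standardSphere k)

/-- `IsCombinatorialManifold k K`: `K` is a combinatorial `(k - 1)`-manifold, i.e. the link of each
vertex is a combinatorial `(k - 2)`-sphere.  (For `k = 0` there are no vertices.) -/
def IsCombinatorialManifold (k : ℕ) (K : PreAbstractSimplicialComplex V) : Prop :=
  IsNormalPseudomanifold k K ∧ ∀ v ∈ vertices K, IsCombinatorialSphere (k - 1) (link K v)

/-- The join of two complexes: the faces are the nonempty disjoint unions of a (possibly empty)
face of `K` and a (possibly empty) face of `L`. -/
def joinComplex (K : PreAbstractSimplicialComplex V) (L : PreAbstractSimplicialComplex W) :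
    PreAbstractSimplicialComplex (V ⊕ W) where
  faces := {s | s.Nonempty ∧ (s.toLeft = ∅ ∨ s.toLeft ∈ K) ∧ (s.toRight = ∅ ∨ s.toRight ∈ L)}
  isRelLowerSet_faces := by
    rintro s ⟨hs, hK, hL⟩
    refine ⟨hs, fun t hts ht => ⟨ht, ?_, ?_⟩⟩
    · rcases t.toLeft.eq_empty_or_nonempty with h | h
      · exact Or.inl h
      · have hsub : t.toLeft ⊆ s.toLeft := Finset.toLeft_subset_toLeft hts
        rcases hK with h0 | h0
        · exact absurd (h0 ▸ hsub) (by simpa using h.ne_empty)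
        · exact Or.inr ((K.isRelLowerSet_faces h0).2 hsub h)
    · rcases t.toRight.eq_empty_or_nonempty with h | h
      · exact Or.inl h
      · have hsub : t.toRight ⊆ s.toRight := Finset.toRight_subset_toRight hts
        rcases hL with h0 | h0
        · exact absurd (h0 ▸ hsub) (by simpa using h.ne_empty)
        · exact Or.inr ((L.isRelLowerSet_faces h0).2 hsub h)

open Classical in
/-- `IsStarring K K'`: `K'` arises from `K` by starring a new vertex `v` in a face `σ`
(an elementary stellar subdivision).  All faces that contain `σ` are removed, and the faces
`ρ ∪ {v}` are added, for all (possibly empty) `ρ` that do not contain `σ` and for which `ρ ∪ σ` is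
a face. -/
def IsStarring (K K' : PreAbstractSimplicialComplex V) : Prop :=
  ∃ σ ∈ K, ∃ v, v ∉ vertices K ∧ ∀ s : Finset V,
    s ∈ K' ↔ (s ∈ K ∧ ¬ σ ⊆ s) ∨ ∃ ρ : Finset V, s = insert v ρ ∧ ¬ σ ⊆ ρ ∧ ρ ∪ σ ∈ K

/-- Up to isomorphism, `K'` arises from `K` by finitely many starrings. -/
def IsStellarSubdivision (K' : PreAbstractSimplicialComplex W)
    (K : PreAbstractSimplicialComplex V) : Prop :=
  ∃ L L' : PreAbstractSimplicialComplex ℕ,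
    IsIsomorphic L K ∧ Relation.ReflTransGen IsStarring L L' ∧ IsIsomorphic L' K'

end Complexes

section Lattices

variable (X Y : Type*) [Lattice X] [BoundedOrder X] [Lattice Y] [BoundedOrder Y]

variable {X} in
/-- `ρ` is the rank function: every maximal chain `⊥ = x₀ ⋖ x₁ ⋖ ⋯ ⋖ x_r = x` has length
`r = ρ x`. -/
def IsRankFunction (ρ : X → ℕ) : Prop :=
  ∀ c : RelSeries {(a, b) : X × X | a ⋖ b}, c.head = ⊥ → c.length = ρ c.last

variable {X} in
/-- The graph `Λ([x, z])` on the elements of the interval `[x, z]` of rank one less than `z`, two of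
them being adjacent if their meet has rank two less than `z`. -/
def intervalGraph (ρ : X → ℕ) (x z : X) :
    SimpleGraph {y : X // x ≤ y ∧ y ≤ z ∧ ρ y + 1 = ρ z} where
  Adj σ γ := σ ≠ γ ∧ ρ ((σ : X) ⊓ γ) + 2 = ρ z
  symm := ⟨fun _ _ h => ⟨h.1.symm, by rw [inf_comm]; exact h.2⟩⟩
  loopless := ⟨fun _ h => h.1 rfl⟩

/-- `IsCellularPseudomanifold k X`: the lattice `X` is a cellular pseudomanifold of dimension
`k - 1`, i.e. its largest element has rank `k + 1`. -/
def IsCellularPseudomanifold (k : ℕ) : Prop :=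
  Finite X ∧ ∃ ρ : X → ℕ, IsRankFunction ρ ∧ ρ ⊤ = k + 1 ∧
    (∀ x z : X, x < z → ρ z = ρ x + 2 → {y : X | x < y ∧ y < z}.ncard = 2) ∧
    (∀ x z : X, x < z → ρ x + 2 < ρ z → (intervalGraph ρ x z).Connected)

/-- The barycentric subdivision: the complex of nonempty chains of proper faces (elements other
than `⊥` and `⊤`). -/
def barycentric : PreAbstractSimplicialComplex {x : X // x ≠ ⊥ ∧ x ≠ ⊤} where
  faces := {s | s.Nonempty ∧ IsChain (· ≤ ·) (s : Set {x : X // x ≠ ⊥ ∧ x ≠ ⊤})}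
  isRelLowerSet_faces := by
    rintro s ⟨hs, hc⟩
    exact ⟨hs, fun t hts ht => ⟨ht, hc.mono (by exact_mod_cast hts)⟩⟩

/-- `X` is a cellular `(k - 1)`-sphere. -/
def IsCellularSphere (k : ℕ) : Prop :=
  IsCellularPseudomanifold X k ∧ IsCombinatorialSphere k (barycentric X)

/-- `X` is a cellular `(k - 1)`-manifold. -/
def IsCellularManifold (k : ℕ) : Prop :=
  IsCellularPseudomanifold X k ∧ IsCombinatorialManifold k (barycentric X)

/-- A `d`-polytope in `ℝ^d`: the convex hull of finitely many points, with nonempty interior. -/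
def IsPolytope {d : ℕ} (P : Set (Fin d → ℝ)) : Prop :=
  (∃ S : Finset (Fin d → ℝ), P = convexHull ℝ (S : Set (Fin d → ℝ))) ∧ (interior P).Nonempty

/-- `X` is a polytopal `(k - 1)`-sphere: a cellular pseudomanifold isomorphic to the boundary
complex of a polytope `P`, which is the poset of all closed faces of `P` (the empty set, `P`
itself, and the intersections of `P` with its supporting hyperplanes, i.e. the exposed subsets),
ordered by inclusion. -/
def IsPolytopalSphere (k : ℕ) : Prop :=
  IsCellularPseudomanifold X k ∧ ∃ (d : ℕ) (P : Set (Fin d → ℝ)), IsPolytope P ∧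
    Nonempty (X ≃o {F : Set (Fin d → ℝ) // IsExposed ℝ P F})

/-- The join `X ∗ Y` of two bounded lattices: all pairs of elements that are both different from
`⊤`, and the pair `(⊤, ⊤)`, ordered componentwise. -/
def Join : Type _ := {p : X × Y // (p.1 ≠ ⊤ ∧ p.2 ≠ ⊤) ∨ p = ⊤}

instance : PartialOrder (Join X Y) := inferInstanceAs (PartialOrder (Subtype _))

variable {X Y} in
theorem Join.exists_isLUB (a b : Join X Y) :
    ∃ c : Join X Y, a ≤ c ∧ b ≤ c ∧ ∀ d, a ≤ d → b ≤ d → c ≤ d := by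
  by_cases h : (a.1 ⊔ b.1).1 ≠ ⊤ ∧ (a.1 ⊔ b.1).2 ≠ ⊤
  · exact ⟨⟨a.1 ⊔ b.1, Or.inl h⟩, show a.1 ≤ _ from le_sup_left, show b.1 ≤ _ from le_sup_right,
      fun d had hbd => show _ ≤ d.1 from sup_le had hbd⟩
  · refine ⟨⟨⊤, Or.inr rfl⟩, show a.1 ≤ ⊤ from le_top, show b.1 ≤ ⊤ from le_top,
      fun d had hbd => show ⊤ ≤ d.1 from ?_⟩
    have hd : a.1 ⊔ b.1 ≤ d.1 := sup_le had hbd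
    rcases d.2 with h' | h'
    · exact absurd ⟨ne_top_of_le_ne_top h'.1 hd.1, ne_top_of_le_ne_top h'.2 hd.2⟩ h
    · rw [h']

variable {X Y} in
theorem Join.inf_mem (a b : Join X Y) :
    ((a.1 ⊓ b.1).1 ≠ ⊤ ∧ (a.1 ⊓ b.1).2 ≠ ⊤) ∨ a.1 ⊓ b.1 = ⊤ := by
  have hle1 : a.1 ⊓ b.1 ≤ a.1 := inf_le_left
  have hle2 : a.1 ⊓ b.1 ≤ b.1 := inf_le_right
  rcases a.2 with ha | ha
  · exact Or.inl ⟨ne_top_of_le_ne_top ha.1 hle1.1, ne_top_of_le_ne_top ha.2 hle1.2⟩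
  rcases b.2 with hb | hb
  · exact Or.inl ⟨ne_top_of_le_ne_top hb.1 hle2.1, ne_top_of_le_ne_top hb.2 hle2.2⟩
  · exact Or.inr (by rw [ha, hb, inf_top_eq])

noncomputable instance : Lattice (Join X Y) where
  inf a b := ⟨a.1 ⊓ b.1, Join.inf_mem a b⟩
  inf_le_left a b := show a.1 ⊓ b.1 ≤ a.1 from inf_le_left
  inf_le_right a b := show a.1 ⊓ b.1 ≤ b.1 from inf_le_right
  le_inf a b c hab hac := show a.1 ≤ b.1 ⊓ c.1 from le_inf hab hac
  sup a b := (Join.exists_isLUB a b).choose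
  le_sup_left a b := (Join.exists_isLUB a b).choose_spec.1
  le_sup_right a b := (Join.exists_isLUB a b).choose_spec.2.1
  sup_le a b c hac hbc := (Join.exists_isLUB a b).choose_spec.2.2 c hac hbc

instance [Nontrivial X] [Nontrivial Y] : BoundedOrder (Join X Y) where
  top := ⟨⊤, Or.inr rfl⟩
  le_top a := show a.1 ≤ ⊤ from le_top
  bot := ⟨⊥, Or.inl ⟨bot_ne_top, bot_ne_top⟩⟩
  bot_le a := show ⊥ ≤ a.1 from bot_le

end Lattices

end CellPM

namespace CellPM

noncomputable section

open Classical Finset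

variable {V W : Type*} {K L : PreAbstractSimplicialComplex V}

theorem nonempty_of_mem {s : Finset V} (hs : s ∈ K) : s.Nonempty := (K.isRelLowerSet_faces hs).1

theorem mem_of_subset {s t : Finset V} (hs : s ∈ K) (hts : t ⊆ s) (ht : t.Nonempty) : t ∈ K :=
  (K.isRelLowerSet_faces hs).2 hts ht

/-- The possibly empty faces of a complex. -/
def Face (K : PreAbstractSimplicialComplex V) (s : Finset V) : Prop := s = ∅ ∨ s ∈ K

theorem face_empty : Face K ∅ := Or.inl rfl

theorem Face.mem {s : Finset V} (h : Face K s) (hs : s.Nonempty) : s ∈ K :=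
  h.resolve_left hs.ne_empty

theorem mem_iff_face {s : Finset V} : s ∈ K ↔ s.Nonempty ∧ Face K s :=
  ⟨fun h => ⟨nonempty_of_mem h, Or.inr h⟩, fun h => h.2.mem h.1⟩

theorem Face.mono {s t : Finset V} (h : Face K s) (hts : t ⊆ s) : Face K t := by
  rcases t.eq_empty_or_nonempty with rfl | ht
  · exact face_empty
  · exact Or.inr (mem_of_subset (h.mem (ht.mono hts)) hts ht)

theorem eq_of_face_iff (h : ∀ s, Face K s ↔ Face L s) : K = L := by
  apply SetLike.ext
  intro s
  rw [mem_iff_face, mem_iff_face, h]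

theorem face_singleton {v : V} : Face K {v} ↔ v ∈ vertices K :=
  ⟨fun h => h.mem (singleton_nonempty v), fun h => Or.inr h⟩

theorem Face.mem_vertices {s : Finset V} (h : Face K s) {v : V} (hv : v ∈ s) : v ∈ vertices K :=
  face_singleton.1 (h.mono (singleton_subset_iff.2 hv))

theorem face_link {v : V} (hv : v ∈ vertices K) {s : Finset V} :
    Face (link K v) s ↔ v ∉ s ∧ Face K (insert v s) := by
  constructor
  · rintro (rfl | h)
    · exact ⟨by simp, by simpa using face_singleton.2 hv⟩
    · exact ⟨h.2.1, Or.inr h.2.2⟩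
  · rintro ⟨h1, h2⟩
    rcases s.eq_empty_or_nonempty with rfl | hs
    · exact face_empty
    · exact Or.inr ⟨hs, h1, h2.mem (insert_nonempty v s)⟩

/-- The faces with `k` elements that contain `s`. -/
def flags (K : PreAbstractSimplicialComplex V) (k : ℕ) (s : Finset V) : Set (Finset V) :=
  {t | Face K t ∧ s ⊆ t ∧ t.card = k}

/-- Any two faces with `k` elements that contain `s` are connected by a sequence of such faces,
successive ones of which share at least `k - 1` elements. -/
def FlagConnected (K : PreAbstractSimplicialComplex V) (k : ℕ) (s : Finset V) : Prop :=
  ∀ t ∈ flags K k s, ∀ u ∈ flags K k s,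
    Relation.ReflTransGen (fun a b => b ∈ flags K k s ∧ k ≤ (a ∩ b).card + 1) t u

/-- A description of normal pseudomanifolds by the facets containing a given face. -/
structure IsNPM (k : ℕ) (K : PreAbstractSimplicialComplex V) : Prop where
  finite : K.faces.Finite
  card_le : ∀ s, Face K s → s.card ≤ k
  exists_flag : ∀ s, Face K s → (flags K k s).Nonempty
  ridge : ∀ s, Face K s → s.card + 1 = k → (flags K k s).ncard = 2
  connected : ∀ s, Face K s → FlagConnected K k s

theorem FlagConnected.of_map {K : PreAbstractSimplicialComplex V}
    {L : PreAbstractSimplicialComplex W} {k l : ℕ} {s : Finset V} {t : Finset W}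
    (f : Finset V → Finset W) (h : FlagConnected K k s)
    (hf : ∀ a ∈ flags K k s, f a ∈ flags L l t)
    (hsurj : ∀ b ∈ flags L l t, ∃ a ∈ flags K k s, f a = b)
    (hadj : ∀ a ∈ flags K k s, ∀ b ∈ flags K k s, k ≤ (a ∩ b).card + 1 →
      l ≤ (f a ∩ f b).card + 1) : FlagConnected L l t := by
  intro b hb c hc
  obtain ⟨b, hb', rfl⟩ := hsurj b hb
  obtain ⟨c, hc', rfl⟩ := hsurj c hc
  have := h b hb' c hc'
  clear hc hc' hb
  induction this with
  | refl => exact .refl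
  | @tail x y hx hy ih =>
    refine ih.tail ⟨hf _ hy.1, hadj _ ?_ _ hy.1 hy.2⟩
    clear ih
    induction hx with
    | refl => exact hb'
    | tail _ h _ => exact h.1

theorem flags_link {v : V} (hv : v ∈ vertices K) {k : ℕ} {s t : Finset V} :
    t ∈ flags (link K v) k s ↔ v ∉ t ∧ s ⊆ t ∧ insert v t ∈ flags K (k + 1) (insert v s) := by
  simp only [flags, Set.mem_ofPred_eq, face_link hv]
  constructor
  · rintro ⟨⟨h1, h2⟩, h3, h4⟩
    exact ⟨h1, h3, h2, insert_subset_insert v h3, by rw [card_insert_of_notMem h1, h4]⟩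
  · rintro ⟨h1, h3, h2, -, h4⟩
    rw [card_insert_of_notMem h1] at h4
    exact ⟨⟨h1, h2⟩, h3, by omega⟩

theorem flags_link' {v : V} (hv : v ∈ vertices K) {k : ℕ} {s t : Finset V} (hvs : v ∉ s)
    (hvt : v ∈ t) :
    t.erase v ∈ flags (link K v) k s ↔ t ∈ flags K (k + 1) (insert v s) := by
  rw [flags_link hv, insert_erase hvt]
  refine ⟨fun h => h.2.2, fun h => ⟨by simp, fun x hx => ?_, h⟩⟩
  exact mem_erase.2 ⟨fun e => hvs (e ▸ hx), h.2.1 (mem_insert_of_mem hx)⟩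

theorem flags_insert_eq_image {v : V} (hv : v ∈ vertices K) {k : ℕ} {s : Finset V} (hvs : v ∉ s) :
    flags K (k + 1) (insert v s) = insert v '' flags (link K v) k s := by
  ext t
  constructor
  · intro h
    have hvt : v ∈ t := h.2.1 (mem_insert_self v s)
    exact ⟨t.erase v, (flags_link' hv hvs hvt).2 h, insert_erase hvt⟩
  · rintro ⟨t, h, rfl⟩
    exact ((flags_link hv).1 h).2.2

theorem flags_insert_ncard {v : V} (hv : v ∈ vertices K) {k : ℕ} {s : Finset V} (hvs : v ∉ s) :
    (flags K (k + 1) (insert v s)).ncard = (flags (link K v) k s).ncard := by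
  rw [flags_insert_eq_image hv hvs]
  apply Set.InjOn.ncard_image
  intro a ha b hb h
  rw [← erase_insert ((flags_link hv).1 ha).1, ← erase_insert ((flags_link hv).1 hb).1, h]

theorem card_insert_inter_insert {v : V} {a b : Finset V} (ha : v ∉ a) :
    (insert v a ∩ insert v b).card = (a ∩ b).card + 1 := by
  rw [← insert_inter_distrib, card_insert_of_notMem (by simp [ha])]

theorem flagConnected_insert {v : V} (hv : v ∈ vertices K) {k : ℕ} {s : Finset V} (hvs : v ∉ s) :
    FlagConnected K (k + 1) (insert v s) ↔ FlagConnected (link K v) k s := by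
  constructor
  · intro h
    refine h.of_map (fun t => t.erase v) (fun a ha => ?_) (fun b hb => ?_) fun a ha b hb hab => ?_
    · exact (flags_link' hv hvs (ha.2.1 (mem_insert_self v s))).2 ha
    · have := (flags_link hv).1 hb
      exact ⟨insert v b, this.2.2, erase_insert this.1⟩
    · have h1 := insert_erase (ha.2.1 (mem_insert_self v s))
      have h2 := insert_erase (hb.2.1 (mem_insert_self v s))
      rw [← h1, ← h2, card_insert_inter_insert (by simp)] at hab
      show k ≤ (a.erase v ∩ b.erase v).card + 1
      omega
  · intro h
    refine h.of_map (insert v) (fun a ha => ?_) (fun b hb => ?_) fun a ha b hb hab => ?_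
    · exact ((flags_link hv).1 ha).2.2
    · have : v ∈ b := hb.2.1 (mem_insert_self v s)
      exact ⟨b.erase v, (flags_link' hv hvs this).2 hb, insert_erase this⟩
    · rw [card_insert_inter_insert ((flags_link hv).1 ha).1]
      omega

theorem link_finite (h : K.faces.Finite) (v : V) : (link K v).faces.Finite := by
  refine Set.Finite.of_finite_image (f := insert v) (h.subset ?_) ?_
  · rintro _ ⟨s, hs, rfl⟩
    exact hs.2.2
  · intro a ha b hb hab
    rw [← erase_insert ha.2.1, ← erase_insert hb.2.1, hab]

theorem IsNPM.link {k : ℕ} (h : IsNPM (k + 1) K) {v : V} (hv : v ∈ vertices K) :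
    IsNPM k (link K v) where
  finite := link_finite h.finite v
  card_le s hs := by
    obtain ⟨h1, h2⟩ := (face_link hv).1 hs
    have := h.card_le _ h2
    rw [card_insert_of_notMem h1] at this
    omega
  exists_flag s hs := by
    obtain ⟨h1, h2⟩ := (face_link hv).1 hs
    have := h.exists_flag _ h2
    rw [flags_insert_eq_image hv h1] at this
    exact this.of_image
  ridge s hs hk := by
    obtain ⟨h1, h2⟩ := (face_link hv).1 hs
    rw [← flags_insert_ncard hv h1]
    exact h.ridge _ h2 (by rw [card_insert_of_notMem h1, hk])
  connected s hs := by
    obtain ⟨h1, h2⟩ := (face_link hv).1 hs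
    exact (flagConnected_insert hv h1).1 (h.connected _ h2)

theorem flagConnected_iff_facetGraph {k : ℕ} (hk : ∀ s, s ∈ facets K ↔ s ∈ flags K (k + 1) ∅)
    (hne : (facets K).Nonempty) :
    FlagConnected K (k + 1) ∅ ↔ (facetGraph K).Connected := by
  have hcard : ∀ s ∈ facets K, s.card = k + 1 := fun s hs => ((hk s).1 hs).2.2
  have key : ∀ s t : facets K, s ≠ t →
      (k + 1 ≤ ((s : Finset V) ∩ t).card + 1 ↔ (facetGraph K).Adj s t) := by
    intro s t hst
    have h1 := card_sdiff_add_card_inter (s : Finset V) t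
    have h2 := card_sdiff_add_card_inter (t : Finset V) s
    have h3 : ((s : Finset V) \ t).card ≠ 0 := by
      intro h
      rw [card_eq_zero, sdiff_eq_empty_iff_subset] at h
      exact hst (Subtype.ext (eq_of_subset_of_card_le h
        (by rw [hcard _ s.2, hcard _ t.2])))
    rw [hcard _ s.2] at h1
    rw [hcard _ t.2, inter_comm] at h2
    simp only [facetGraph]
    omega
  constructor
  · intro h
    have := hne.to_subtype
    refine ⟨fun s t => ?_⟩
    have := h s ((hk _).1 s.2) t ((hk _).1 t.2)
    obtain ⟨t, ht⟩ := t
    dsimp only at this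
    induction this with
    | refl => exact SimpleGraph.Reachable.refl _
    | @tail x y hx hy ih =>
      have hxf : x ∈ facets K := by
        clear ih
        induction hx with
        | refl => exact s.2
        | tail _ h _ => exact (hk _).2 h.1
      refine (ih hxf).trans ?_
      by_cases e : x = y
      · subst e; exact SimpleGraph.Reachable.refl _
      · exact SimpleGraph.Adj.reachable ((key ⟨x, hxf⟩ ⟨y, ht⟩ (by simpa using e)).1 hy.2)
  · intro h s hs t ht
    have := h.preconnected ⟨s, (hk _).2 hs⟩ ⟨t, (hk _).2 ht⟩
    rw [SimpleGraph.reachable_iff_reflTransGen] at this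
    have := this.lift (fun x : facets K => (x : Finset V))
      (p := fun a b => b ∈ flags K (k + 1) ∅ ∧ k + 1 ≤ (a ∩ b).card + 1)
      (fun a b hab => ⟨(hk _).1 b.2, (key a b hab.ne).2 hab⟩)
    exact this

theorem exists_facet_of_finite (h : K.faces.Finite) {s : Finset V} (hs : s ∈ K) :
    ∃ t ∈ facets K, s ⊆ t := by
  obtain ⟨t, hst, ht⟩ := h.exists_le_maximal hs
  exact ⟨t, ht, hst⟩

theorem isNPM_of_links {k : ℕ} (hfin : K.faces.Finite) (hpure : ∀ s ∈ facets K, s.card = k + 2)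
    (hconn : (facetGraph K).Connected) (hlink : ∀ v ∈ vertices K, IsNPM (k + 1) (link K v)) :
    IsNPM (k + 2) K := by
  have hne : (facets K).Nonempty := by
    obtain ⟨s⟩ := hconn.nonempty
    exact ⟨s, s.2⟩
  have hle : ∀ s, Face K s → s.card ≤ k + 2 := by
    rintro s (rfl | hs)
    · simp
    · obtain ⟨t, ht, hst⟩ := exists_facet_of_finite hfin hs
      rw [← hpure t ht]
      exact card_le_card hst
  have hfac : ∀ s, s ∈ facets K ↔ s ∈ flags K (k + 2) ∅ := by
    intro s
    constructor
    · intro hs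
      exact ⟨Or.inr hs.1, by simp, hpure s hs⟩
    · rintro ⟨h1, -, h2⟩
      refine ⟨h1.mem (card_pos.1 (by omega)), fun t ht hst => ?_⟩
      exact (eq_of_subset_of_card_le hst (by rw [h2]; exact hle t (Or.inr ht))).ge
  have hins : ∀ s : Finset V, Face K s → s = ∅ ∨ ∃ v t, s = insert v t ∧ v ∉ t ∧
      v ∈ vertices K ∧ Face (link K v) t := by
    intro s hs
    rcases s.eq_empty_or_nonempty with rfl | ⟨v, hv⟩
    · exact Or.inl rfl
    · have hvK := hs.mem_vertices hv
      exact Or.inr ⟨v, s.erase v, (insert_erase hv).symm, by simp, hvK,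
        (face_link hvK).2 ⟨by simp, by rwa [insert_erase hv]⟩⟩
  refine ⟨hfin, hle, fun s hs => ?_, fun s hs hk => ?_, fun s hs => ?_⟩
  · rcases hins s hs with rfl | ⟨v, t, rfl, hvt, hv, ht⟩
    · obtain ⟨s, hs⟩ := hne
      exact ⟨s, (hfac s).1 hs⟩
    · rw [flags_insert_eq_image hv hvt]
      exact ((hlink v hv).exists_flag t ht).image _
  · rcases hins s hs with rfl | ⟨v, t, rfl, hvt, hv, ht⟩
    · simp at hk
    · rw [flags_insert_ncard hv hvt]
      refine (hlink v hv).ridge t ht ?_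
      rw [card_insert_of_notMem hvt] at hk
      omega
  · rcases hins s hs with rfl | ⟨v, t, rfl, hvt, hv, ht⟩
    · exact (flagConnected_iff_facetGraph hfac hne).2 hconn
    · exact (flagConnected_insert hv hvt).2 ((hlink v hv).connected t ht)

theorem IsNPM.mem_facets_iff {k : ℕ} (h : IsNPM (k + 1) K) (s : Finset V) :
    s ∈ facets K ↔ s ∈ flags K (k + 1) ∅ := by
  constructor
  · intro hs
    obtain ⟨t, ht1, ht2, ht3⟩ := h.exists_flag s (Or.inr hs.1)
    have htK := ht1.mem (card_pos.1 (by omega))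
    have : s = t := ht2.antisymm (hs.2 htK ht2)
    subst this
    exact ⟨ht1, by simp, ht3⟩
  · rintro ⟨h1, -, h2⟩
    refine ⟨h1.mem (card_pos.1 (by omega)), fun t ht hst => ?_⟩
    exact (eq_of_subset_of_card_le hst (by rw [h2]; exact h.card_le t (Or.inr ht))).ge

theorem isNPM_zero_iff : IsNPM 0 K ↔ K = ⊥ := by
  constructor
  · intro h
    apply SetLike.ext
    intro s
    refine ⟨fun hs => ?_, fun hs => hs.elim⟩
    have := h.card_le s (Or.inr hs)
    have := (nonempty_of_mem hs).card_pos
    omega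
  · rintro rfl
    have hf : ∀ s : Finset V, Face ⊥ s → s = ∅ := fun s hs => hs.resolve_right fun h => h.elim
    refine ⟨?_, fun s hs => by simp [hf s hs], fun s hs => ⟨∅, face_empty, by simp [hf s hs]⟩,
      fun s _ hk => by simp at hk, fun s hs t ht u hu => ?_⟩
    · exact Set.finite_empty
    · rw [hf t ht.1, hf u hu.1]

theorem isNPM_one_iff :
    IsNPM 1 K ↔ (∀ s ∈ K, s.card = 1) ∧ (vertices K).ncard = 2 := by
  have himage : flags K 1 ∅ = (fun v => {v}) '' vertices K := by
    ext t
    constructor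
    · rintro ⟨h1, -, h2⟩
      obtain ⟨v, rfl⟩ := card_eq_one.1 h2
      exact ⟨v, face_singleton.1 h1, rfl⟩
    · rintro ⟨v, hv, rfl⟩
      exact ⟨face_singleton.2 hv, by simp, by simp⟩
  have hcard : (flags K 1 ∅).ncard = (vertices K).ncard := by
    rw [himage]
    exact Set.ncard_image_of_injective _ singleton_injective
  constructor
  · intro h
    refine ⟨fun s hs => ?_, ?_⟩
    · have := h.card_le s (Or.inr hs)
      have := (nonempty_of_mem hs).card_pos
      omega
    · rw [← hcard]
      exact h.ridge ∅ face_empty rfl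
  · rintro ⟨h1, h2⟩
    have hfin : (vertices K).Finite := Set.finite_of_ncard_ne_zero (by omega)
    have hf : ∀ s, Face K s → s = ∅ ∨ ∃ v ∈ vertices K, s = {v} := by
      rintro s (rfl | hs)
      · exact Or.inl rfl
      · obtain ⟨v, rfl⟩ := card_eq_one.1 (h1 s hs)
        exact Or.inr ⟨v, hs, rfl⟩
    have hne : (vertices K).Nonempty := Set.nonempty_of_ncard_ne_zero (by omega)
    refine ⟨(hfin.image (fun v => ({v} : Finset V))).subset ?_, ?_, ?_, ?_, ?_⟩
    · intro s hs
      rcases hf s (Or.inr hs) with rfl | ⟨v, hv, rfl⟩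
      · exact absurd (nonempty_of_mem hs) (by simp)
      · exact ⟨v, hv, rfl⟩
    · rintro s (rfl | hs)
      · simp
      · exact (h1 s hs).le
    · intro s hs
      rcases hf s hs with rfl | ⟨v, hv, rfl⟩
      · rw [himage]; exact hne.image _
      · exact ⟨{v}, face_singleton.2 hv, subset_rfl, by simp⟩
    · intro s hs hk
      have : s = ∅ := card_eq_zero.1 (by omega)
      rw [this, hcard, h2]
    · intro s hs t ht u hu
      exact Relation.ReflTransGen.single ⟨hu, by omega⟩

theorem isNormalPseudomanifold_iff {k : ℕ} :
    IsNormalPseudomanifold k K ↔ IsNPM k K := by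
  induction k using Nat.strong_induction_on generalizing K with
  | _ k ih =>
    match k with
    | 0 => rw [isNPM_zero_iff]; rfl
    | 1 => rw [isNPM_one_iff]; rfl
    | k + 2 =>
      constructor
      · rintro ⟨h1, h2, h3, h4⟩
        exact isNPM_of_links h1 h2 h3 fun v hv => (ih (k + 1) (by omega)).1 (h4 v hv)
      · intro h
        refine ⟨h.finite, fun s hs => ((h.mem_facets_iff s).1 hs).2.2, ?_, fun v hv =>
          (ih (k + 1) (by omega)).2 (h.link hv)⟩
        refine (flagConnected_iff_facetGraph h.mem_facets_iff ?_).1 (h.connected ∅ face_empty)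
        obtain ⟨s, hs⟩ := h.exists_flag ∅ face_empty
        exact ⟨s, (h.mem_facets_iff s).2 hs⟩

theorem vertices_finite (h : K.faces.Finite) : (vertices K).Finite :=
  Set.Finite.of_finite_image (f := fun v => ({v} : Finset V))
    (h.subset (by rintro _ ⟨v, hv, rfl⟩; exact hv)) singleton_injective.injOn

end

end CellPM

namespace CellPM

noncomputable section

open Classical Finset

variable {V W : Type*} {K K' : PreAbstractSimplicialComplex V} {L : PreAbstractSimplicialComplex W}

/-- The function `f` identifies the complexes `K` and `L`. -/
structure IsoVia (f : V → W) (K : PreAbstractSimplicialComplex V)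
    (L : PreAbstractSimplicialComplex W) : Prop where
  injOn : Set.InjOn f (vertices K)
  face_iff : ∀ t, Face L t ↔ ∃ s, Face K s ∧ s.image f = t

theorem Face.subset_vertices {s : Finset V} (h : Face K s) : (s : Set V) ⊆ vertices K :=
  fun _ hv => h.mem_vertices hv

namespace IsoVia

variable {f : V → W}

theorem face_image (h : IsoVia f K L) {s : Finset V} (hs : Face K s) : Face L (s.image f) :=
  (h.face_iff _).2 ⟨s, hs, rfl⟩

theorem image_inj (h : IsoVia f K L) {s t : Finset V} (hs : (s : Set V) ⊆ vertices K)
    (ht : (t : Set V) ⊆ vertices K) (hst : s.image f = t.image f) : s = t := by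
  have := congrArg (fun x : Finset W => (x : Set W)) hst
  simp only [coe_image] at this
  exact_mod_cast (h.injOn.image_eq_image_iff hs ht).1 this

theorem face_image_iff (h : IsoVia f K L) {s : Finset V} (hs : (s : Set V) ⊆ vertices K) :
    Face L (s.image f) ↔ Face K s := by
  refine ⟨fun hf => ?_, h.face_image⟩
  obtain ⟨t, ht, hts⟩ := (h.face_iff _).1 hf
  rwa [← h.image_inj ht.subset_vertices hs hts]

theorem mem_vertices_iff (h : IsoVia f K L) {w : W} :
    w ∈ vertices L ↔ ∃ v ∈ vertices K, f v = w := by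
  rw [← face_singleton]
  constructor
  · intro hw
    obtain ⟨s, hs, hsw⟩ := (h.face_iff _).1 hw
    have : w ∈ s.image f := by simp [hsw]
    obtain ⟨v, hv, rfl⟩ := mem_image.1 this
    exact ⟨v, hs.mem_vertices hv, rfl⟩
  · rintro ⟨v, hv, rfl⟩
    simpa using h.face_image (face_singleton.2 hv)

theorem bijOn (h : IsoVia f K L) : Set.BijOn f (vertices K) (vertices L) :=
  ⟨fun v hv => h.mem_vertices_iff.2 ⟨v, hv, rfl⟩, h.injOn, fun _ hw => h.mem_vertices_iff.1 hw⟩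

theorem isIsomorphic (h : IsoVia f K L) : IsIsomorphic K L := by
  refine ⟨h.bijOn.equiv f, fun s => ?_⟩
  have hs : ((s.map (Function.Embedding.subtype _) : Finset V) : Set V) ⊆ vertices K := by
    intro x hx
    simp only [coe_map, Set.mem_image] at hx
    obtain ⟨y, -, rfl⟩ := hx
    exact y.2
  have e : (s.map (h.bijOn.equiv f).toEmbedding).map (Function.Embedding.subtype _) =
      (s.map (Function.Embedding.subtype _)).image f := by
    ext x
    simp only [mem_map, mem_image, exists_exists_and_eq_and]
    rfl
  rw [e, mem_iff_face, mem_iff_face, h.face_image_iff hs, image_nonempty]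

theorem symm (h : IsoVia f K L) [Nonempty V] :
    IsoVia (Function.invFunOn f (vertices K)) L K := by
  have hinv := h.bijOn.invOn_invFunOn
  have him : ∀ s, Face K s → (s.image f).image (Function.invFunOn f (vertices K)) = s := by
    intro s hs
    rw [image_image]
    conv_rhs => rw [← image_id (s := s)]
    refine image_congr fun v hv => hinv.1 (hs.mem_vertices hv)
  refine ⟨hinv.2.injOn, fun t => ?_⟩
  constructor
  · intro ht
    exact ⟨_, h.face_image ht, him t ht⟩
  · rintro ⟨s, hs, rfl⟩
    obtain ⟨s, hs', rfl⟩ := (h.face_iff _).1 hs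
    rwa [him s hs']

theorem card_image (h : IsoVia f K L) {s : Finset V} (hs : Face K s) :
    (s.image f).card = s.card :=
  card_image_of_injOn (h.injOn.mono hs.subset_vertices)

theorem flags_eq (h : IsoVia f K L) {k : ℕ} {s : Finset V} (hs : Face K s) :
    flags L k (s.image f) = (fun t => t.image f) '' flags K k s := by
  ext u
  constructor
  · rintro ⟨h1, h2, h3⟩
    obtain ⟨t, ht, rfl⟩ := (h.face_iff _).1 h1
    refine ⟨t, ⟨ht, fun v hv => ?_, by rwa [h.card_image ht] at h3⟩, rfl⟩
    obtain ⟨w, hw, hwv⟩ := mem_image.1 (h2 (mem_image_of_mem f hv))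
    rwa [← h.injOn (ht.mem_vertices hw) (hs.mem_vertices hv) hwv]
  · rintro ⟨t, ⟨h1, h2, h3⟩, rfl⟩
    exact ⟨h.face_image h1, image_subset_image h2, by rw [h.card_image h1, h3]⟩

theorem isNPM (h : IsoVia f K L) {k : ℕ} (hK : IsNPM k K) : IsNPM k L where
  finite := by
    refine (hK.finite.image (fun s => s.image f)).subset fun t ht => ?_
    obtain ⟨s, hs, rfl⟩ := (h.face_iff _).1 (Or.inr ht)
    exact ⟨s, hs.mem (image_nonempty.1 (nonempty_of_mem ht)), rfl⟩
  card_le t ht := by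
    obtain ⟨s, hs, rfl⟩ := (h.face_iff _).1 ht
    rw [h.card_image hs]
    exact hK.card_le s hs
  exists_flag t ht := by
    obtain ⟨s, hs, rfl⟩ := (h.face_iff _).1 ht
    rw [h.flags_eq hs]
    exact (hK.exists_flag s hs).image _
  ridge t ht hk := by
    obtain ⟨s, hs, rfl⟩ := (h.face_iff _).1 ht
    rw [h.flags_eq hs, Set.InjOn.ncard_image]
    · rw [h.card_image hs] at hk
      exact hK.ridge s hs hk
    · intro a ha b hb hab
      exact h.image_inj ha.1.subset_vertices hb.1.subset_vertices hab
  connected t ht := by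
    obtain ⟨s, hs, rfl⟩ := (h.face_iff _).1 ht
    refine (hK.connected s hs).of_map (fun t => t.image f) ?_ ?_ ?_
    · intro a ha
      rw [h.flags_eq hs]
      exact ⟨a, ha, rfl⟩
    · intro b hb
      rw [h.flags_eq hs] at hb
      exact hb
    · intro a ha b hb hab
      refine hab.trans (Nat.succ_le_succ ?_)
      have : (a ∩ b).image f ⊆ a.image f ∩ b.image f := image_inter_subset _ _ _
      refine le_trans ?_ (card_le_card this)
      rw [h.card_image (ha.1.mono inter_subset_left)]

end IsoVia

theorem FlagConnected.of_lift {k l : ℕ} {s : Finset V} {t : Finset W}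
    (h : FlagConnected K k s) (φ : Finset W → Finset V)
    (hφ : ∀ b ∈ flags L l t, φ b ∈ flags K k s)
    (hfib : ∀ b ∈ flags L l t, ∀ c ∈ flags L l t, φ b = φ c →
      Relation.ReflTransGen (fun a b => b ∈ flags L l t ∧ l ≤ (a ∩ b).card + 1) b c)
    (hadj : ∀ a ∈ flags K k s, ∀ a' ∈ flags K k s, k ≤ (a ∩ a').card + 1 →
      ∃ b ∈ flags L l t, ∃ b' ∈ flags L l t, φ b = a ∧ φ b' = a' ∧
      Relation.ReflTransGen (fun a b => b ∈ flags L l t ∧ l ≤ (a ∩ b).card + 1) b b') :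
    FlagConnected L l t := by
  intro b hb
  have key : ∀ F, Relation.ReflTransGen (fun a b => b ∈ flags K k s ∧ k ≤ (a ∩ b).card + 1)
      (φ b) F → F ∈ flags K k s ∧ ∀ c ∈ flags L l t, φ c = F →
      Relation.ReflTransGen (fun a b => b ∈ flags L l t ∧ l ≤ (a ∩ b).card + 1) b c := by
    intro F hF
    induction hF with
    | refl => exact ⟨hφ b hb, fun c hc hcb => hfib b hb c hc hcb.symm⟩
    | @tail F G hF hG ih =>
      refine ⟨hG.1, fun c hc hcG => ?_⟩
      obtain ⟨d, hd, e, he, hdF, heG, hde⟩ := hadj F ih.1 G hG.1 hG.2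
      exact ((ih.2 d hd hdF).trans hde).trans (hfib e he c hc (heG.trans hcG.symm))
  intro c hc
  exact (key _ (h _ (hφ b hb) _ (hφ c hc))).2 c hc rfl

section Join

variable {k l : ℕ}

theorem face_joinComplex {s : Finset (V ⊕ W)} :
    Face (joinComplex K L) s ↔ Face K s.toLeft ∧ Face L s.toRight := by
  constructor
  · rintro (rfl | h)
    · exact ⟨Or.inl rfl, Or.inl rfl⟩
    · exact h.2
  · intro h
    rcases s.eq_empty_or_nonempty with rfl | hs
    · exact face_empty
    · exact Or.inr ⟨hs, h⟩

theorem card_inter_sum (a b : Finset (V ⊕ W)) :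
    (a ∩ b).card = (a.toLeft ∩ b.toLeft).card + (a.toRight ∩ b.toRight).card := by
  rw [← card_toLeft_add_card_toRight (u := a ∩ b)]
  congr 2 <;> · ext; simp

theorem subset_sum_iff {s t : Finset (V ⊕ W)} :
    s ⊆ t ↔ s.toLeft ⊆ t.toLeft ∧ s.toRight ⊆ t.toRight := by
  constructor
  · intro h
    exact ⟨toLeft_subset_toLeft h, toRight_subset_toRight h⟩
  · rintro ⟨h1, h2⟩ (x | x) hx
    · simpa using h1 (by simpa using hx)
    · simpa using h2 (by simpa using hx)

theorem mem_flags_joinComplex (hK : IsNPM k K) (hL : IsNPM l L) {s t : Finset (V ⊕ W)} :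
    t ∈ flags (joinComplex K L) (k + l) s ↔
      t.toLeft ∈ flags K k s.toLeft ∧ t.toRight ∈ flags L l s.toRight := by
  simp only [flags, Set.mem_ofPred_eq, face_joinComplex]
  rw [subset_sum_iff, ← card_toLeft_add_card_toRight (u := t)]
  constructor
  · rintro ⟨⟨h1, h2⟩, ⟨h3, h4⟩, h5⟩
    have := hK.card_le _ h1
    have := hL.card_le _ h2
    exact ⟨⟨h1, h3, by omega⟩, ⟨h2, h4, by omega⟩⟩
  · rintro ⟨⟨h1, h2, h3⟩, h4, h5, h6⟩
    exact ⟨⟨h1, h4⟩, ⟨h2, h5⟩, by omega⟩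

theorem flags_joinComplex (hK : IsNPM k K) (hL : IsNPM l L) (s : Finset (V ⊕ W)) :
    flags (joinComplex K L) (k + l) s =
      (fun p : Finset V × Finset W => p.1.disjSum p.2) ''
        (flags K k s.toLeft ×ˢ flags L l s.toRight) := by
  ext t
  rw [mem_flags_joinComplex hK hL]
  constructor
  · rintro ⟨h1, h2⟩
    exact ⟨(t.toLeft, t.toRight), ⟨h1, h2⟩, toLeft_disjSum_toRight⟩
  · rintro ⟨⟨a, b⟩, ⟨h1, h2⟩, rfl⟩
    simpa using ⟨h1, h2⟩

theorem flags_self {s : Finset V} (hs : Face K s) (hk : s.card = k) : flags K k s = {s} := by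
  ext t
  constructor
  · rintro ⟨-, h2, h3⟩
    exact (eq_of_subset_of_card_le h2 (by omega)).symm
  · rintro rfl
    exact ⟨hs, subset_rfl, hk⟩

theorem IsNPM.join (hK : IsNPM k K) (hL : IsNPM l L) : IsNPM (k + l) (joinComplex K L) where
  finite := by
    have h1 : {s | Face K s}.Finite := by
      refine (hK.finite.insert ∅).subset ?_
      rintro s (rfl | h)
      · exact Or.inl rfl
      · exact Or.inr h
    have h2 : {s | Face L s}.Finite := by
      refine (hL.finite.insert ∅).subset ?_
      rintro s (rfl | h)
      · exact Or.inl rfl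
      · exact Or.inr h
    refine ((h1.prod h2).image (fun p : Finset V × Finset W => p.1.disjSum p.2)).subset ?_
    intro s hs
    exact ⟨(s.toLeft, s.toRight), hs.2, toLeft_disjSum_toRight⟩
  card_le s hs := by
    rw [face_joinComplex] at hs
    rw [← card_toLeft_add_card_toRight]
    exact add_le_add (hK.card_le _ hs.1) (hL.card_le _ hs.2)
  exists_flag s hs := by
    rw [face_joinComplex] at hs
    rw [flags_joinComplex hK hL]
    exact ((hK.exists_flag _ hs.1).prod (hL.exists_flag _ hs.2)).image _
  ridge s hs hk := by
    rw [face_joinComplex] at hs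
    rw [flags_joinComplex hK hL, Set.ncard_image_of_injective, Set.ncard_prod]
    · rw [← card_toLeft_add_card_toRight] at hk
      have h1 := hK.card_le _ hs.1
      have h2 := hL.card_le _ hs.2
      by_cases h3 : s.toLeft.card = k
      · rw [flags_self hs.1 h3, hL.ridge _ hs.2 (by omega), Set.ncard_singleton]
      · rw [flags_self hs.2 (k := l) (by omega), hK.ridge _ hs.1 (by omega), Set.ncard_singleton]
    · rintro ⟨a, b⟩ ⟨c, d⟩ h
      have h1 := congrArg toLeft h
      have h2 := congrArg toRight h
      simp only [toLeft_disjSum, toRight_disjSum] at h1 h2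
      rw [h1, h2]
  connected s hs := by
    rw [face_joinComplex] at hs
    intro t ht u hu
    have ht' := (mem_flags_joinComplex hK hL).1 ht
    have hu' := (mem_flags_joinComplex hK hL).1 hu
    have h1 := (hK.connected _ hs.1 _ ht'.1 _ hu'.1).lift
      (fun a => a.disjSum t.toRight)
      (p := fun a b => b ∈ flags (joinComplex K L) (k + l) s ∧ k + l ≤ (a ∩ b).card + 1) (by
        rintro a b ⟨h1, h2⟩
        refine ⟨(mem_flags_joinComplex hK hL).2 (by simpa using ⟨h1, ht'.2⟩), ?_⟩
        rw [card_inter_sum]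
        simp only [toLeft_disjSum, toRight_disjSum, inter_self, ht'.2.2.2]
        omega)
    have h2 := (hL.connected _ hs.2 _ ht'.2 _ hu'.2).lift
      (fun a => u.toLeft.disjSum a)
      (p := fun a b => b ∈ flags (joinComplex K L) (k + l) s ∧ k + l ≤ (a ∩ b).card + 1) (by
        rintro a b ⟨h1, h2⟩
        refine ⟨(mem_flags_joinComplex hK hL).2 (by simpa using ⟨hu'.1, h1⟩), ?_⟩
        rw [card_inter_sum]
        simp only [toLeft_disjSum, toRight_disjSum, inter_self, hu'.1.2.2]
        omega)
    simp only [Function.onFun, toLeft_disjSum_toRight] at h1 h2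
    convert h1.trans h2

end Join

/-- `K'` arises from `K` by starring the new vertex `v` in the face `σ`. -/
structure StarringAt (K K' : PreAbstractSimplicialComplex V) (σ : Finset V) (v : V) : Prop where
  mem : σ ∈ K
  notMem : v ∉ vertices K
  mem_iff : ∀ s : Finset V, s ∈ K' ↔ (s ∈ K ∧ ¬ σ ⊆ s) ∨
    ∃ ρ : Finset V, s = insert v ρ ∧ ¬ σ ⊆ ρ ∧ ρ ∪ σ ∈ K

/-- The smallest face of the original complex that contains a face of the starred one. -/
def unstar (σ : Finset V) (v : V) (s : Finset V) : Finset V :=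
  if v ∈ s then s.erase v ∪ σ else s

namespace StarringAt

variable {σ : Finset V} {v : V}

theorem of_face_iff (hσ : σ ∈ K) (hv : v ∉ vertices K)
    (h : ∀ s, Face K' s ↔ ¬ σ ⊆ s ∧ Face K (unstar σ v s)) : StarringAt K K' σ v := by
  have hvσ : v ∉ σ := fun h => hv (Face.mem_vertices (Or.inr hσ) h)
  have hσ0 := nonempty_of_mem hσ
  refine ⟨hσ, hv, fun s => ?_⟩
  rw [mem_iff_face, h, unstar]
  constructor
  · rintro ⟨h1, h2, h3⟩
    split_ifs at h3 with hvs
    · refine Or.inr ⟨s.erase v, (insert_erase hvs).symm, fun h => h2 (h.trans (erase_subset _ _)),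
        h3.mem (hσ0.mono subset_union_right)⟩
    · exact Or.inl ⟨h3.mem h1, h2⟩
  · rintro (⟨h1, h2⟩ | ⟨ρ, rfl, h2, h3⟩)
    · have : v ∉ s := fun h => hv (Face.mem_vertices (Or.inr h1) h)
      rw [if_neg this]
      exact ⟨nonempty_of_mem h1, h2, Or.inr h1⟩
    · have : v ∉ ρ := fun h => hv (Face.mem_vertices (Or.inr h3) (mem_union_left _ h))
      rw [if_pos (mem_insert_self v ρ), erase_insert this]
      exact ⟨insert_nonempty _ _, fun h => h2 ((subset_insert_iff_of_notMem hvσ).1 h), Or.inr h3⟩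

theorem notMem_face (h : StarringAt K K' σ v) {s : Finset V} (hs : Face K s) : v ∉ s :=
  fun h' => h.notMem (hs.mem_vertices h')

theorem notMem_center (h : StarringAt K K' σ v) : v ∉ σ := h.notMem_face (Or.inr h.mem)

theorem face_iff (h : StarringAt K K' σ v) {s : Finset V} :
    Face K' s ↔ ¬ σ ⊆ s ∧ Face K (unstar σ v s) := by
  have hσ0 := nonempty_of_mem h.mem
  rcases s.eq_empty_or_nonempty with rfl | hs
  · simp [unstar, face_empty, hσ0.ne_empty]
  · have : Face K' s ↔ s ∈ K' := by rw [mem_iff_face]; simp [hs]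
    rw [this, h.mem_iff]
    constructor
    · rintro (⟨h1, h2⟩ | ⟨ρ, rfl, h2, h3⟩)
      · rw [unstar, if_neg (h.notMem_face (Or.inr h1))]
        exact ⟨h2, Or.inr h1⟩
      · have : v ∉ ρ := fun h' => h.notMem_face (Or.inr h3) (mem_union_left _ h')
        rw [unstar, if_pos (mem_insert_self v ρ), erase_insert this]
        exact ⟨fun h' => h2 ((subset_insert_iff_of_notMem h.notMem_center).1 h'), Or.inr h3⟩
    · rintro ⟨h2, h3⟩
      rw [unstar] at h3
      split_ifs at h3 with hvs
      · exact Or.inr ⟨s.erase v, (insert_erase hvs).symm,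
          fun h => h2 (h.trans (erase_subset _ _)), h3.mem (hσ0.mono subset_union_right)⟩
      · exact Or.inl ⟨h3.mem hs, h2⟩

theorem isStarring (h : StarringAt K K' σ v) : IsStarring K K' := ⟨σ, h.mem, v, h.notMem, h.mem_iff⟩

theorem erase_subset_unstar {s : Finset V} : s.erase v ⊆ unstar σ v s := by
  rw [unstar]
  split_ifs
  · exact subset_union_left
  · exact erase_subset _ _

theorem center_subset_unstar {s : Finset V} (hs : v ∈ s) : σ ⊆ unstar σ v s := by
  rw [unstar, if_pos hs]
  exact subset_union_right

theorem unstar_mono {s t : Finset V} (hst : s ⊆ t) : unstar σ v s ⊆ unstar σ v t := by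
  by_cases hs : v ∈ s
  · rw [unstar, unstar, if_pos hs, if_pos (hst hs)]
    exact union_subset_union (erase_subset_erase _ hst) subset_rfl
  · rw [unstar, if_neg hs]
    exact (subset_erase.2 ⟨hst, hs⟩).trans erase_subset_unstar

variable {k : ℕ} {s t : Finset V}

theorem card_unstar (h : StarringAt K K' σ v) (hK : IsNPM k K) (ht : Face K' t)
    (hk : t.card = k) : (unstar σ v t).card = k := by
  obtain ⟨h1, h2⟩ := h.face_iff.1 ht
  refine le_antisymm (hK.card_le _ h2) ?_
  by_cases hv : v ∈ t
  · have hlt : t.erase v ⊂ unstar σ v t := by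
      refine ⟨erase_subset_unstar, fun h' => h1 ?_⟩
      exact ((center_subset_unstar hv).trans h').trans (erase_subset _ _)
    have := card_lt_card hlt
    rw [card_erase_of_mem hv] at this
    omega
  · rw [unstar, if_neg hv, hk]

theorem unstar_mem_flags (h : StarringAt K K' σ v) (hK : IsNPM k K) (ht : t ∈ flags K' k s) :
    unstar σ v t ∈ flags K k (unstar σ v s) :=
  ⟨(h.face_iff.1 ht.1).2, unstar_mono ht.2.1, h.card_unstar hK ht.1 ht.2.2⟩

theorem exists_mem_center (h : StarringAt K K' σ v) (hs : Face K' s) : ∃ w ∈ σ, w ∉ s :=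
  not_subset.1 (h.face_iff.1 hs).1

theorem unstar_insert_erase (h : StarringAt K K' σ v) {F : Finset V} (hF : Face K F)
    {w : V} (hw : w ∈ σ) (hσ : σ ⊆ F) : unstar σ v (insert v (F.erase w)) = F := by
  have hvF := h.notMem_face hF
  rw [unstar, if_pos (mem_insert_self _ _), erase_insert (fun h' => hvF (erase_subset _ _ h'))]
  refine (union_subset (erase_subset _ _) hσ).antisymm fun x hx => ?_
  by_cases e : x = w
  · exact mem_union_right _ (e ▸ hw)
  · exact mem_union_left _ (mem_erase.2 ⟨e, hx⟩)

theorem lift_mem_flags (h : StarringAt K K' σ v) {F : Finset V}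
    (hF : F ∈ flags K k (unstar σ v s)) {w : V} (hw : w ∈ σ) (hws : w ∉ s) (hσ : σ ⊆ F) :
    insert v (F.erase w) ∈ flags K' k s := by
  have hvF := h.notMem_face hF.1
  have hvw : w ≠ v := fun e => h.notMem_center (e ▸ hw)
  refine ⟨h.face_iff.2 ⟨fun h' => ?_, by rw [h.unstar_insert_erase hF.1 hw hσ]; exact hF.1⟩, ?_, ?_⟩
  · have := h' hw
    simp [hvw] at this
  · intro x hx
    by_cases e : x = v
    · simp [e]
    · exact mem_insert_of_mem (mem_erase.2 ⟨fun e' => hws (e' ▸ hx),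
        hF.2.1 (erase_subset_unstar (mem_erase.2 ⟨e, hx⟩))⟩)
  · rw [card_insert_of_notMem (fun h' => hvF (erase_subset _ _ h')), card_erase_add_one (hσ hw),
      hF.2.2]

theorem mem_flags_of_not_subset (h : StarringAt K K' σ v) {F : Finset V}
    (hF : F ∈ flags K k (unstar σ v s)) (hσ : ¬ σ ⊆ F) : F ∈ flags K' k s := by
  have hvF := h.notMem_face hF.1
  have hvs : v ∉ s := fun h' => hσ ((center_subset_unstar h').trans hF.2.1)
  refine ⟨h.face_iff.2 ⟨hσ, by rw [unstar, if_neg hvF]; exact hF.1⟩, ?_, hF.2.2⟩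
  have := hF.2.1
  rwa [unstar, if_neg hvs] at this

theorem eq_insert_erase (h : StarringAt K K' σ v) (hK : IsNPM k K) (ht : t ∈ flags K' k s)
    (hv : v ∈ t) : ∃ w ∈ σ, w ∉ s ∧ t = insert v ((unstar σ v t).erase w) := by
  obtain ⟨w, hw, hwt⟩ := h.exists_mem_center ht.1
  refine ⟨w, hw, fun h' => hwt (ht.2.1 h'), ?_⟩
  have hF := h.unstar_mem_flags hK ht
  refine eq_of_subset_of_card_le ?_ ?_
  · intro x hx
    by_cases e : x = v
    · simp [e]
    · exact mem_insert_of_mem (mem_erase.2 ⟨fun e' => hwt (e' ▸ hx),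
        erase_subset_unstar (mem_erase.2 ⟨e, hx⟩)⟩)
  · rw [card_insert_of_notMem (fun h' => h.notMem_face hF.1 (erase_subset _ _ h')),
      card_erase_add_one (center_subset_unstar hv hw), hF.2.2, ht.2.2]

theorem mem_iff_center_subset (h : StarringAt K K' σ v) (ht : Face K' t) :
    v ∈ t ↔ σ ⊆ unstar σ v t := by
  refine ⟨center_subset_unstar, fun h' => ?_⟩
  by_contra hv
  rw [unstar, if_neg hv] at h'
  exact (h.face_iff.1 ht).1 h'

theorem unstar_eq_self (h : StarringAt K K' σ v) (ht : Face K' t) (hσ : ¬ σ ⊆ unstar σ v t) :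
    unstar σ v t = t := by
  rw [← h.mem_iff_center_subset ht] at hσ
  rw [unstar, if_neg hσ]

theorem unstar_injOn (h : StarringAt K K' σ v) (hK : IsNPM k K) (hs : s.card + 1 = k)
    (hcard : (unstar σ v s).card + 1 = k) :
    Set.InjOn (unstar σ v) (flags K' k s) := by
  intro a ha b hb hab
  by_cases hσ : σ ⊆ unstar σ v a
  · have hva := (h.mem_iff_center_subset ha.1).2 hσ
    have hvb := (h.mem_iff_center_subset hb.1).2 (hab ▸ hσ)
    by_cases hvs : v ∈ s
    · obtain ⟨w, hw, hws, hwa⟩ := h.eq_insert_erase hK ha hva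
      obtain ⟨x, hx, hxs, hxb⟩ := h.eq_insert_erase hK hb hvb
      have : w = x := by
        by_contra hne
        have hsub : insert w (insert x (s.erase v)) ⊆ unstar σ v s := by
          rw [unstar, if_pos hvs]
          intro y hy
          simp only [mem_insert] at hy
          rcases hy with rfl | rfl | hy
          · exact mem_union_right _ hw
          · exact mem_union_right _ hx
          · exact mem_union_left _ hy
        have := card_le_card hsub
        rw [card_insert_of_notMem (by simp [hne, hws]), card_insert_of_notMem (by simp [hxs]),
          card_erase_add_one hvs] at this
        omega
      rw [hwa, hxb, hab, this]
    · have hins : ∀ c ∈ flags K' k s, v ∈ c → c = insert v s := by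
        intro c hc hvc
        refine (eq_of_subset_of_card_le (insert_subset hvc hc.2.1) ?_).symm
        rw [card_insert_of_notMem hvs, hc.2.2, hs]
      rw [hins a ha hva, hins b hb hvb]
  · rw [← h.unstar_eq_self ha.1 hσ, hab, h.unstar_eq_self hb.1 (hab ▸ hσ)]

theorem unstar_surjOn (h : StarringAt K K' σ v) (hs : Face K' s) {F : Finset V}
    (hF : F ∈ flags K k (unstar σ v s)) : ∃ t ∈ flags K' k s, unstar σ v t = F := by
  by_cases hσ : σ ⊆ F
  · obtain ⟨w, hw, hws⟩ := h.exists_mem_center hs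
    exact ⟨_, h.lift_mem_flags hF hw hws hσ, h.unstar_insert_erase hF.1 hw hσ⟩
  · exact ⟨F, h.mem_flags_of_not_subset hF hσ, by rw [unstar, if_neg (h.notMem_face hF.1)]⟩

theorem isNPM (h : StarringAt K K' σ v) (hK : IsNPM k K) : IsNPM k K' where
  finite := by
    have hfin := vertices_finite hK.finite
    refine ((hfin.insert v).toFinset.powerset.finite_toSet).subset fun s hs => ?_
    simp only [coe_powerset, Set.mem_preimage, Set.mem_powerset_iff, Set.Finite.coe_toFinset]
    intro x hx
    by_cases e : x = v
    · exact Or.inl e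
    · exact Or.inr ((h.face_iff.1 (Or.inr hs)).2.mem_vertices
        (erase_subset_unstar (mem_erase.2 ⟨e, hx⟩)))
  card_le s hs := by
    obtain ⟨h1, h2⟩ := h.face_iff.1 hs
    have := hK.card_le _ h2
    by_cases hv : v ∈ s
    · have hlt : s.erase v ⊂ unstar σ v s := by
        refine ⟨erase_subset_unstar, fun h' => h1 ?_⟩
        exact ((center_subset_unstar hv).trans h').trans (erase_subset _ _)
      have := card_lt_card hlt
      rw [card_erase_of_mem hv] at this
      omega
    · rwa [unstar, if_neg hv] at this
  exists_flag s hs := by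
    obtain ⟨F, hF⟩ := hK.exists_flag _ (h.face_iff.1 hs).2
    obtain ⟨t, ht, -⟩ := h.unstar_surjOn hs hF
    exact ⟨t, ht⟩
  ridge s hs hk := by
    have hs' := (h.face_iff.1 hs).2
    by_cases hcard : (unstar σ v s).card + 1 = k
    · rw [← hK.ridge _ hs' hcard, ← (h.unstar_injOn hK hk hcard).ncard_image]
      congr 1
      ext F
      constructor
      · rintro ⟨t, ht, rfl⟩
        exact h.unstar_mem_flags hK ht
      · exact h.unstar_surjOn hs
    · have hvs : v ∈ s := by
        by_contra hv
        rw [unstar, if_neg hv] at hcard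
        exact hcard hk
      have hle := hK.card_le _ hs'
      obtain ⟨x, hx, hxs⟩ := h.exists_mem_center hs
      have hsub : insert x (s.erase v) ⊆ unstar σ v s :=
        insert_subset (center_subset_unstar hvs hx) erase_subset_unstar
      have hle2 := card_le_card hsub
      rw [card_insert_of_notMem (by simp [hxs]), card_erase_add_one hvs] at hle2
      have hk' : (unstar σ v s).card = k := by omega
      have hFl : unstar σ v s ∈ flags K k (unstar σ v s) := ⟨hs', subset_rfl, hk'⟩
      have himg : flags K' k s =
          (fun w => insert v ((unstar σ v s).erase w)) '' ((σ \ s : Finset V) : Set V) := by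
        ext t
        constructor
        · intro ht
          have h3 := h.unstar_mem_flags hK ht
          rw [flags_self hs' hk'] at h3
          obtain ⟨w, hw, hws, hwt⟩ := h.eq_insert_erase hK ht (ht.2.1 hvs)
          refine ⟨w, by simp [hw, hws], ?_⟩
          rw [Set.mem_singleton_iff] at h3
          rw [← h3]
          exact hwt.symm
        · rintro ⟨w, hw, rfl⟩
          simp only [coe_sdiff, Set.mem_sdiff, mem_coe] at hw
          exact h.lift_mem_flags hFl hw.1 hw.2 (center_subset_unstar hvs)
      rw [himg, Set.InjOn.ncard_image, Set.ncard_coe_finset]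
      · have h4 : (unstar σ v s) = s.erase v ∪ (σ \ s) := by
          rw [unstar, if_pos hvs]
          ext y
          have : y ∈ σ → y ≠ v := fun h1 h2 => h.notMem_center (h2 ▸ h1)
          simp only [mem_union, mem_erase, mem_sdiff]
          tauto
        have h5 : Disjoint (s.erase v) (σ \ s) :=
          disjoint_sdiff.mono_left (erase_subset _ _)
        have := card_union_of_disjoint h5
        rw [← h4, hk', card_erase_of_mem hvs] at this
        have : 0 < s.card := card_pos.2 ⟨v, hvs⟩
        omega
      · intro a ha b hb hab
        simp only [coe_sdiff, Set.mem_sdiff, mem_coe] at ha hb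
        by_contra hne
        have h6 : a ∈ insert v ((unstar σ v s).erase b) :=
          mem_insert_of_mem (mem_erase.2 ⟨hne, center_subset_unstar hvs ha.1⟩)
        have hab' : insert v ((unstar σ v s).erase a) = insert v ((unstar σ v s).erase b) := hab
        rw [← hab'] at h6
        have hav : a ≠ v := fun e => h.notMem_center (e ▸ ha.1)
        simp [hav] at h6
  connected s hs := by
    have hs' := (h.face_iff.1 hs).2
    refine (hK.connected _ hs').of_lift (unstar σ v) (fun b hb => h.unstar_mem_flags hK hb) ?_ ?_
    · intro b hb c hc hbc
      refine Relation.ReflTransGen.single ⟨hc, ?_⟩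
      by_cases hσ : σ ⊆ unstar σ v b
      · have hvb := (h.mem_iff_center_subset hb.1).2 hσ
        have hvc := (h.mem_iff_center_subset hc.1).2 (hbc ▸ hσ)
        have h1 : b.erase v ∪ c.erase v ⊆ unstar σ v b :=
          union_subset erase_subset_unstar (hbc ▸ erase_subset_unstar)
        have h2 := card_le_card h1
        have h3 := card_union_add_card_inter (b.erase v) (c.erase v)
        have h4 := (h.unstar_mem_flags hK hb).2.2
        rw [card_erase_of_mem hvb, card_erase_of_mem hvc, hb.2.2, hc.2.2] at h3
        have h5 : insert v (b.erase v ∩ c.erase v) ⊆ b ∩ c :=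
          insert_subset (mem_inter.2 ⟨hvb, hvc⟩)
            (inter_subset_inter (erase_subset _ _) (erase_subset _ _))
        have h6 := card_le_card h5
        rw [card_insert_of_notMem (by simp)] at h6
        omega
      · rw [← h.unstar_eq_self hb.1 hσ, hbc, h.unstar_eq_self hc.1 (hbc ▸ hσ), inter_self,
          hc.2.2]
        omega
    · have main : ∀ F ∈ flags K k (unstar σ v s), ∀ G ∈ flags K k (unstar σ v s),
          k ≤ (F ∩ G).card + 1 → σ ⊆ F → ∃ b ∈ flags K' k s, ∃ b' ∈ flags K' k s,
          unstar σ v b = F ∧ unstar σ v b' = G ∧ k ≤ (b ∩ b').card + 1 := by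
        intro F hF G hG hFG hσF
        by_cases hσG : σ ⊆ G
        · obtain ⟨w, hw, hws⟩ := h.exists_mem_center hs
          refine ⟨_, h.lift_mem_flags hF hw hws hσF, _, h.lift_mem_flags hG hw hws hσG,
            h.unstar_insert_erase hF.1 hw hσF, h.unstar_insert_erase hG.1 hw hσG, ?_⟩
          have h1 : insert v ((F ∩ G).erase w) ⊆
              insert v (F.erase w) ∩ insert v (G.erase w) := by
            rw [← insert_inter_distrib]
            refine insert_subset_insert _ fun y hy => ?_
            simp only [mem_erase, mem_inter] at hy ⊢
            tauto
          have h2 := card_le_card h1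
          rw [card_insert_of_notMem (fun h' => h.notMem_face hF.1
              (inter_subset_left (erase_subset _ _ h'))),
            card_erase_add_one (mem_inter.2 ⟨hσF hw, hσG hw⟩)] at h2
          omega
        · obtain ⟨w, hw, hwG⟩ := not_subset.1 hσG
          have hG' := h.mem_flags_of_not_subset hG hσG
          have hsub : F ∩ G ⊆ F.erase w := fun y hy => mem_erase.2
            ⟨fun e => hwG (e ▸ inter_subset_right hy), inter_subset_left hy⟩
          have hle := card_le_card hsub
          have hc := card_erase_add_one (hσF hw)
          have heq : F ∩ G = F.erase w := eq_of_subset_of_card_le hsub (by rw [hF.2.2] at hc; omega)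
          refine ⟨_, h.lift_mem_flags hF hw (fun h' => hwG (hG'.2.1 h')) hσF, G, hG',
            h.unstar_insert_erase hF.1 hw hσF, by rw [unstar, if_neg (h.notMem_face hG.1)], ?_⟩
          refine hFG.trans (Nat.succ_le_succ (card_le_card ?_))
          rw [← heq]
          exact subset_inter (subset_insert _ _) inter_subset_right
      intro F hF G hG hFG
      by_cases hσF : σ ⊆ F
      · obtain ⟨b, hb, b', hb', h1, h2, h3⟩ := main F hF G hG hFG hσF
        exact ⟨b, hb, b', hb', h1, h2, .single ⟨hb', h3⟩⟩
      by_cases hσG : σ ⊆ G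
      · obtain ⟨b, hb, b', hb', h1, h2, h3⟩ := main G hG F hF (by rwa [inter_comm]) hσG
        exact ⟨b', hb', b, hb, h2, h1, .single ⟨hb, by rwa [inter_comm]⟩⟩
      exact ⟨F, h.mem_flags_of_not_subset hF hσF, G, h.mem_flags_of_not_subset hG hσG,
        by rw [unstar, if_neg (h.notMem_face hF.1)], by rw [unstar, if_neg (h.notMem_face hG.1)],
        .single ⟨h.mem_flags_of_not_subset hG hσG, hFG⟩⟩

end StarringAt

end

end CellPM

namespace CellPM

noncomputable section

open Classical Finset

variable {V W U : Type*} {K K' : PreAbstractSimplicialComplex V} {L : PreAbstractSimplicialComplex W}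

/-- The union of the simplicial cones spanned by the unit vectors of the faces. -/
def cone (K : PreAbstractSimplicialComplex V) : Set (V →₀ ℝ) := {x | 0 ≤ x ∧ Face K x.support}

theorem mem_cone_of_subset {x : V →₀ ℝ} {s : Finset V} (hx : 0 ≤ x) (hs : Face K s)
    (hxs : x.support ⊆ s) : x ∈ cone K := ⟨hx, hs.mono hxs⟩

theorem zero_mem_cone : (0 : V →₀ ℝ) ∈ cone K := ⟨le_rfl, by simpa using face_empty⟩

theorem smul_mem_cone {x : V →₀ ℝ} (hx : x ∈ cone K) {c : ℝ} (hc : 0 ≤ c) : c • x ∈ cone K :=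
  ⟨smul_nonneg hc hx.1, hx.2.mono Finsupp.support_smul⟩

theorem single_mem_cone {v : V} (hv : v ∈ vertices K) {c : ℝ} (hc : 0 ≤ c) :
    Finsupp.single v c ∈ cone K :=
  mem_cone_of_subset (Finsupp.single_nonneg.2 hc) (face_singleton.2 hv) Finsupp.support_single_subset

theorem support_subset_of_le {x y : V →₀ ℝ} (hx : 0 ≤ x) (hxy : x ≤ y) : x.support ⊆ y.support := by
  intro v hv
  rw [Finsupp.mem_support_iff] at hv ⊢
  exact (((hx v).lt_of_ne' hv).trans_le (hxy v)).ne'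

theorem mem_cone_of_le {x y : V →₀ ℝ} (hy : y ∈ cone K) (hx : 0 ≤ x) (hxy : x ≤ y) : x ∈ cone K :=
  mem_cone_of_subset hx hy.2 (support_subset_of_le hx hxy)

theorem smul_single_le {x : V →₀ ℝ} (hx : 0 ≤ x) (v : V) : x v • Finsupp.single v (1 : ℝ) ≤ x := by
  intro w
  by_cases h : v = w
  · subst h; simp
  · simpa [Finsupp.single_eq_of_ne' h] using hx w

theorem sum_single_eq (x : V →₀ ℝ) {s : Finset V} (hs : x.support ⊆ s) :
    x = ∑ v ∈ s, x v • Finsupp.single v (1 : ℝ) := by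
  conv_lhs => rw [← Finsupp.sum_single x]
  rw [Finsupp.sum_of_support_subset _ hs _ (by simp)]
  simp

theorem map_eq_sum {E : Type*} [AddCommGroup E] [Module ℝ E] (F : (V →₀ ℝ) →ₗ[ℝ] E) (x : V →₀ ℝ)
    {s : Finset V} (hs : x.support ⊆ s) : F x = ∑ v ∈ s, x v • F (Finsupp.single v 1) := by
  conv_lhs => rw [sum_single_eq x hs]
  simp only [map_sum, map_smul]

theorem smul_map_single_le {F : (W →₀ ℝ) →ₗ[ℝ] (V →₀ ℝ)} (hF : Set.MapsTo F (cone L) (cone K))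
    {x : W →₀ ℝ} (hx : x ∈ cone L) (w : W) : x w • F (Finsupp.single w 1) ≤ F x := by
  have h1 : x - x w • Finsupp.single w (1 : ℝ) ∈ cone L :=
    mem_cone_of_le hx (sub_nonneg.2 (smul_single_le hx.1 w))
      (sub_le_self _ (smul_nonneg (hx.1 w) (Finsupp.single_nonneg.2 zero_le_one)))
  have h2 := (hF h1).1
  rw [map_sub, map_smul] at h2
  exact sub_nonneg.1 h2

theorem support_map_single_subset {F : (W →₀ ℝ) →ₗ[ℝ] (V →₀ ℝ)}
    (hF : Set.MapsTo F (cone L) (cone K)) {x : W →₀ ℝ} (hx : x ∈ cone L) {w : W}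
    (hw : w ∈ x.support) : (F (Finsupp.single w 1)).support ⊆ (F x).support := by
  have hpos : 0 < x w := (hx.1 w).lt_of_ne' (Finsupp.mem_support_iff.1 hw)
  rw [← Finsupp.support_smul_eq hpos.ne' (g := F (Finsupp.single w 1))]
  refine support_subset_of_le (smul_nonneg hpos.le (hF ?_).1) (smul_map_single_le hF hx w)
  exact single_mem_cone (hx.2.mem_vertices hw) zero_le_one

/-- The vector all of whose coordinates in `s` are `1`. -/
def indicatorVec (s : Finset V) : V →₀ ℝ := ∑ v ∈ s, Finsupp.single v 1

theorem indicatorVec_apply (s : Finset V) (v : V) :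
    indicatorVec s v = if v ∈ s then 1 else 0 := by
  simp [indicatorVec, Finsupp.finsetSum_apply, Finsupp.single_apply]

theorem support_indicatorVec (s : Finset V) : (indicatorVec s).support = s := by
  ext v
  simp [indicatorVec_apply]

theorem indicatorVec_nonneg (s : Finset V) : 0 ≤ indicatorVec s := by
  intro v
  rw [indicatorVec_apply]
  split_ifs <;> simp

theorem indicatorVec_mem_cone {s : Finset V} (hs : Face K s) : indicatorVec s ∈ cone K :=
  ⟨indicatorVec_nonneg s, by rwa [support_indicatorVec]⟩

section Vertex

variable {F : (W →₀ ℝ) →ₗ[ℝ] (V →₀ ℝ)} (hF : Set.BijOn F (cone L) (cone K))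
include hF

theorem map_single_ne_zero {w : W} (hw : w ∈ vertices L) : F (Finsupp.single w 1) ≠ 0 := by
  intro h
  have := hF.injOn (single_mem_cone hw zero_le_one) zero_mem_cone (by rw [h, map_zero])
  simp at this

theorem exists_vertex_over {v : V} (hv : v ∈ vertices K) :
    ∃ w ∈ vertices L, ∃ c : ℝ, 0 < c ∧ F (Finsupp.single w 1) = Finsupp.single v c := by
  obtain ⟨x, hx, hxv⟩ := hF.surjOn (single_mem_cone hv zero_le_one)
  have hx0 : x ≠ 0 := by
    rintro rfl
    simp at hxv
    exact one_ne_zero (Finsupp.single_eq_zero.1 hxv.symm)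
  obtain ⟨w, hw⟩ := Finsupp.support_nonempty_iff.2 hx0
  have hwL := hx.2.mem_vertices hw
  have hsub := support_map_single_subset hF.mapsTo hx hw
  rw [hxv] at hsub
  have hsub' := hsub.trans Finsupp.support_single_subset
  obtain ⟨c, hc⟩ := Finsupp.support_subset_singleton'.1 hsub'
  refine ⟨w, hwL, c, ?_, hc⟩
  have h1 := (hF.mapsTo (single_mem_cone hwL zero_le_one)).1 v
  rw [hc] at h1
  simp only [Finsupp.coe_zero, Pi.zero_apply, Finsupp.single_eq_same] at h1
  refine h1.lt_of_ne' fun e => map_single_ne_zero hF hwL ?_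
  rw [hc, e, Finsupp.single_zero]

end Vertex

theorem bijOn_comp {M : PreAbstractSimplicialComplex U} {F : (W →₀ ℝ) →ₗ[ℝ] (V →₀ ℝ)}
    {G : (U →₀ ℝ) →ₗ[ℝ] (W →₀ ℝ)} (hF : Set.BijOn F (cone L) (cone K))
    (hG : Set.BijOn G (cone M) (cone L)) : Set.BijOn (F ∘ₗ G) (cone M) (cone K) := by
  rw [LinearMap.coe_comp]
  exact hF.comp hG

/-- The linear map of cones induced by starring, `p` being the position of the new vertex. -/
def starMap (p : V →₀ ℝ) (v : V) : (V →₀ ℝ) →ₗ[ℝ] (V →₀ ℝ) :=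
  LinearMap.id + (Finsupp.lapply v).smulRight (p - Finsupp.single v 1)

theorem starMap_apply (p : V →₀ ℝ) (v : V) (x : V →₀ ℝ) :
    starMap p v x = x + x v • (p - Finsupp.single v 1) := rfl

theorem starMap_apply_of_ne {p : V →₀ ℝ} {v : V} {x : V →₀ ℝ} {w : V} (hw : w ≠ v) :
    starMap p v x w = x w + x v * p w := by
  simp [starMap_apply, Finsupp.single_eq_of_ne hw]

theorem starMap_bijOn {p : V →₀ ℝ} {v : V} (hp : 0 ≤ p) (hp0 : p.support.Nonempty)
    (hvp : v ∉ p.support) (hv : v ∉ vertices K)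
    (h : ∀ s, Face K' s ↔ ¬ p.support ⊆ s ∧ Face K (unstar p.support v s)) :
    Set.BijOn (starMap p v) (cone K') (cone K) := by
  have hpv : p v = 0 := Finsupp.notMem_support_iff.1 hvp
  have hppos : ∀ w ∈ p.support, 0 < p w := fun w hw =>
    (hp w).lt_of_ne' (Finsupp.mem_support_iff.1 hw)
  have hne : ∀ w ∈ p.support, w ≠ v := fun w hw e => hvp (e ▸ hw)
  have hself : ∀ x, starMap p v x v = 0 := by
    intro x
    simp [starMap_apply, hpv]
  have hlam : ∀ x ∈ cone K', p.support.inf' hp0 (fun w => starMap p v x w / p w) = x v := by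
    intro x hx
    obtain ⟨w, hw, hwx⟩ := not_subset.1 ((h _).1 hx.2).1
    have hdiv : ∀ w ∈ p.support, starMap p v x w / p w = x w / p w + x v := by
      intro w hw
      rw [starMap_apply_of_ne (hne w hw), add_div, mul_div_assoc, div_self (hppos w hw).ne', mul_one]
    apply le_antisymm
    · refine (inf'_le _ hw).trans ?_
      rw [hdiv w hw, Finsupp.notMem_support_iff.1 hwx]
      simp
    · refine le_inf' _ _ fun y hy => ?_
      rw [hdiv y hy]
      have : 0 ≤ x y / p y := div_nonneg (hx.1 y) (hppos y hy).le
      linarith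
  refine ⟨fun x hx => ⟨?_, ?_⟩, fun x hx y hy hxy => ?_, fun y hy => ?_⟩
  · intro w
    by_cases hw : w = v
    · subst hw; rw [hself]; rfl
    · rw [starMap_apply_of_ne hw]
      exact add_nonneg (hx.1 w) (mul_nonneg (hx.1 v) (hp w))
  · refine ((h _).1 hx.2).2.mono fun w hw => ?_
    rw [Finsupp.mem_support_iff] at hw
    have hwv : w ≠ v := fun e => hw (e ▸ hself x)
    rw [starMap_apply_of_ne hwv] at hw
    by_cases hxw : x w = 0
    · rw [hxw, zero_add] at hw
      exact StarringAt.center_subset_unstar (Finsupp.mem_support_iff.2 (left_ne_zero_of_mul hw))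
        (Finsupp.mem_support_iff.2 (right_ne_zero_of_mul hw))
    · exact StarringAt.erase_subset_unstar (mem_erase.2 ⟨hwv, Finsupp.mem_support_iff.2 hxw⟩)
  · have hxy' : starMap p v x = starMap p v y := hxy
    have hv' : x v = y v := by rw [← hlam x hx, ← hlam y hy, hxy']
    rw [starMap_apply, starMap_apply, hv'] at hxy'
    exact add_right_cancel hxy'
  · have hyv : y v = 0 := by
      by_contra h'
      exact hv (hy.2.mem_vertices (Finsupp.mem_support_iff.2 h'))
    set l := p.support.inf' hp0 (fun w => y w / p w) with hl
    have hl0 : 0 ≤ l := le_inf' _ _ fun w hw => div_nonneg (hy.1 w) (hp w)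
    have hle : ∀ w ∈ p.support, l * p w ≤ y w := fun w hw =>
      (le_div_iff₀ (hppos w hw)).1 (inf'_le _ hw)
    have hxw : ∀ w, w ≠ v → (y - l • p + l • Finsupp.single v (1 : ℝ)) w = y w - l * p w := by
      intro w hw
      simp [Finsupp.single_eq_of_ne hw]
    have hxv : (y - l • p + l • Finsupp.single v (1 : ℝ)) v = l := by
      simp [hyv, hpv]
    have hx0 : 0 ≤ y - l • p + l • Finsupp.single v (1 : ℝ) := by
      intro w
      by_cases hw : w = v
      · subst hw; rw [hxv]; exact hl0
      · rw [hxw w hw]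
        by_cases hwp : w ∈ p.support
        · exact sub_nonneg.2 (hle w hwp)
        · rw [Finsupp.notMem_support_iff.1 hwp]
          simpa using hy.1 w
    refine ⟨y - l • p + l • Finsupp.single v (1 : ℝ), ⟨hx0, (h _).2 ⟨?_, ?_⟩⟩, ?_⟩
    · obtain ⟨w, hw, hwl⟩ := exists_mem_eq_inf' hp0 (fun w => y w / p w)
      intro hsub
      have := hsub hw
      rw [Finsupp.mem_support_iff, hxw w (hne w hw)] at this
      apply this
      rw [hl, hwl, div_mul_cancel₀ _ (hppos w hw).ne', sub_self]
    · refine hy.2.mono ?_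
      have hsub : ∀ w, w ≠ v → w ∈ (y - l • p + l • Finsupp.single v (1 : ℝ)).support →
          w ∈ y.support := by
        intro w hw hws
        rw [Finsupp.mem_support_iff] at hws ⊢
        intro hyw
        have h1 := hx0 w
        have h2 := mul_nonneg hl0 (hp w)
        rw [hxw w hw] at hws h1
        rw [hyw] at hws h1
        simp only [Finsupp.coe_zero, Pi.zero_apply] at h1 h2
        exact hws (by linarith)
      rw [unstar]
      split_ifs with hvs
      · refine union_subset (fun w hw => ?_) fun w hw => ?_
        · rw [mem_erase] at hw
          exact hsub w hw.1 hw.2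
        · rw [Finsupp.mem_support_iff, hxv] at hvs
          have := hle w hw
          have := mul_pos (hl0.lt_of_ne' hvs) (hppos w hw)
          exact Finsupp.mem_support_iff.2 (by linarith)
      · intro w hw
        exact hsub w (fun e => hvs (e ▸ hw)) hw
    · rw [starMap_apply, hxv, smul_sub]
      abel

theorem StarringAt.bijOn {σ : Finset V} {v : V} (h : StarringAt K K' σ v) {p : V →₀ ℝ}
    (hp : 0 ≤ p) (hpσ : p.support = σ) : Set.BijOn (starMap p v) (cone K') (cone K) := by
  subst hpσ
  exact starMap_bijOn hp (nonempty_of_mem h.mem) h.notMem_center h.notMem fun s => h.face_iff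

theorem IsoVia.bijOn_cone {f : V → W} (h : IsoVia f K L) :
    Set.BijOn (Finsupp.lmapDomain ℝ ℝ f) (cone K) (cone L) := by
  have hsupp : ∀ x ∈ cone K, (Finsupp.mapDomain f x).support = x.support.image f := fun x hx =>
    Finsupp.mapDomain_support_of_injOn x (h.injOn.mono hx.2.subset_vertices)
  have hval : ∀ x ∈ cone K, ∀ v ∈ vertices K, Finsupp.mapDomain f x (f v) = x v := fun x hx v hv =>
    Finsupp.mapDomain_apply' (vertices K) x hx.2.subset_vertices h.injOn hv
  refine ⟨fun x hx => ⟨?_, ?_⟩, ?_, fun y hy => ?_⟩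
  · intro w
    simp only [Finsupp.lmapDomain_apply]
    by_cases hw : w ∈ (Finsupp.mapDomain f x).support
    · rw [hsupp x hx] at hw
      obtain ⟨v, hv, rfl⟩ := mem_image.1 hw
      rw [hval x hx v (hx.2.mem_vertices hv)]
      exact hx.1 v
    · rw [Finsupp.notMem_support_iff.1 hw]
      rfl
  · simp only [Finsupp.lmapDomain_apply]
    rw [hsupp x hx]
    exact h.face_image hx.2
  · intro x hx y hy hxy
    exact Finsupp.mapDomain_injOn _ h.injOn hx.2.subset_vertices hy.2.subset_vertices hxy
  · obtain ⟨s, hs, hsy⟩ := (h.face_iff _).1 hy.2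
    set x : V →₀ ℝ := ∑ v ∈ s, Finsupp.single v (y (f v)) with hxdef
    have hx : ∀ v, x v = if v ∈ s then y (f v) else 0 := by
      intro v
      simp [hxdef, Finsupp.finsetSum_apply, Finsupp.single_apply]
    have hxs : x.support ⊆ s := by
      intro v hv
      rw [Finsupp.mem_support_iff, hx] at hv
      by_contra h'
      simp [h'] at hv
    have hxc : x ∈ cone K := by
      refine mem_cone_of_subset (fun v => ?_) hs hxs
      rw [hx]
      split_ifs
      · exact hy.1 _
      · rfl
    refine ⟨x, hxc, ?_⟩
    simp only [Finsupp.lmapDomain_apply]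
    ext w
    by_cases hw : w ∈ y.support
    · rw [← hsy] at hw
      obtain ⟨v, hv, rfl⟩ := mem_image.1 hw
      rw [hval x hxc v (hs.mem_vertices hv), hx, if_pos hv]
    · rw [Finsupp.notMem_support_iff.1 hw, ← Finsupp.notMem_support_iff, hsupp x hxc]
      rw [← hsy] at hw
      exact fun h' => hw (image_subset_image hxs h')

section Join

variable {V' W' : Type*} {M : PreAbstractSimplicialComplex V'} {N : PreAbstractSimplicialComplex W'}

theorem mem_cone_joinComplex {x : V ⊕ W →₀ ℝ} :
    x ∈ cone (joinComplex K L) ↔ (Finsupp.sumFinsuppLEquivProdFinsupp ℝ x).1 ∈ cone K ∧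
      (Finsupp.sumFinsuppLEquivProdFinsupp ℝ x).2 ∈ cone L := by
  have h1 : (Finsupp.sumFinsuppLEquivProdFinsupp ℝ x).1.support = x.support.toLeft := by
    ext v; simp
  have h2 : (Finsupp.sumFinsuppLEquivProdFinsupp ℝ x).2.support = x.support.toRight := by
    ext v; simp
  simp only [cone, Set.mem_ofPred_eq, face_joinComplex, h1, h2]
  have h3 : 0 ≤ x ↔ 0 ≤ (Finsupp.sumFinsuppLEquivProdFinsupp ℝ x).1 ∧
      0 ≤ (Finsupp.sumFinsuppLEquivProdFinsupp ℝ x).2 := by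
    constructor
    · intro h
      exact ⟨fun v => by simpa using h (Sum.inl v), fun v => by simpa using h (Sum.inr v)⟩
    · rintro ⟨h, h'⟩ (v | v)
      · simpa using h v
      · simpa using h' v
  rw [h3]
  tauto

theorem exists_bijOn_join {F : (V →₀ ℝ) →ₗ[ℝ] (V' →₀ ℝ)} {G : (W →₀ ℝ) →ₗ[ℝ] (W' →₀ ℝ)}
    (hF : Set.BijOn F (cone K) (cone M)) (hG : Set.BijOn G (cone L) (cone N)) :
    ∃ H : (V ⊕ W →₀ ℝ) →ₗ[ℝ] (V' ⊕ W' →₀ ℝ),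
      Set.BijOn H (cone (joinComplex K L)) (cone (joinComplex M N)) := by
  let e := Finsupp.sumFinsuppLEquivProdFinsupp (M := ℝ) (α := V) (β := W) ℝ
  let e' := Finsupp.sumFinsuppLEquivProdFinsupp (M := ℝ) (α := V') (β := W') ℝ
  refine ⟨e'.symm.toLinearMap ∘ₗ F.prodMap G ∘ₗ e.toLinearMap, fun x hx => ?_, ?_, fun y hy => ?_⟩
  · rw [mem_cone_joinComplex] at hx ⊢
    simp only [LinearMap.coe_comp, LinearEquiv.coe_coe, Function.comp_apply]
    show (e' (e'.symm _)).1 ∈ _ ∧ (e' (e'.symm _)).2 ∈ _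
    rw [LinearEquiv.apply_symm_apply]
    exact ⟨hF.mapsTo hx.1, hG.mapsTo hx.2⟩
  · intro x hx y hy hxy
    rw [mem_cone_joinComplex] at hx hy
    have h := e'.symm.injective hxy
    have h1 := hF.injOn hx.1 hy.1 (congrArg Prod.fst h)
    have h2 := hG.injOn hx.2 hy.2 (congrArg Prod.snd h)
    exact e.injective (Prod.ext h1 h2)
  · rw [mem_cone_joinComplex] at hy
    obtain ⟨a, ha, hay⟩ := hF.surjOn hy.1
    obtain ⟨b, hb, hby⟩ := hG.surjOn hy.2
    refine ⟨e.symm (a, b), ?_, ?_⟩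
    · rw [mem_cone_joinComplex]
      show (e (e.symm _)).1 ∈ _ ∧ (e (e.symm _)).2 ∈ _
      rw [LinearEquiv.apply_symm_apply]
      exact ⟨ha, hb⟩
    · simp only [LinearMap.coe_comp, LinearEquiv.coe_coe, Function.comp_apply,
        LinearEquiv.apply_symm_apply]
      rw [LinearEquiv.symm_apply_eq]
      exact Prod.ext hay hby

end Join

/-- The projection killing the coordinate `v`. -/
def killCoord (v : V) : (V →₀ ℝ) →ₗ[ℝ] (V →₀ ℝ) :=
  LinearMap.id - (Finsupp.lapply v).smulRight (Finsupp.single v 1)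

theorem killCoord_apply (v : V) (x : V →₀ ℝ) :
    killCoord v x = x - x v • Finsupp.single v (1 : ℝ) := rfl

theorem killCoord_self (v : V) (x : V →₀ ℝ) : killCoord v x v = 0 := by simp [killCoord_apply]

theorem killCoord_of_ne {v w : V} (h : w ≠ v) (x : V →₀ ℝ) : killCoord v x w = x w := by
  simp [killCoord_apply, Finsupp.single_eq_of_ne h]

theorem killCoord_of_notMem {v : V} {x : V →₀ ℝ} (h : v ∉ x.support) : killCoord v x = x := by
  rw [killCoord_apply, Finsupp.notMem_support_iff.1 h]
  simp

theorem killCoord_add_single (v : V) (x : V →₀ ℝ) (t : ℝ) :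
    killCoord v (x + Finsupp.single v t) = killCoord v x := by
  ext w
  by_cases h : w = v
  · subst h; rw [killCoord_self, killCoord_self]
  · rw [killCoord_of_ne h, killCoord_of_ne h, Finsupp.add_apply, Finsupp.single_eq_of_ne h, add_zero]

theorem support_killCoord_subset (v : V) (x : V →₀ ℝ) : (killCoord v x).support ⊆ x.support := by
  intro w hw
  have h : w ≠ v := by
    rintro rfl
    exact Finsupp.mem_support_iff.1 hw (killCoord_self _ _)
  rwa [Finsupp.mem_support_iff, killCoord_of_ne h, ← Finsupp.mem_support_iff] at hw

theorem killCoord_mem_cone_link {v : V} (hv : v ∈ vertices K) {x : V →₀ ℝ} (hx : 0 ≤ x)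
    {s : Finset V} (hs : Face K s) (hxs : x.support ⊆ s) (hvs : v ∈ s) :
    killCoord v x ∈ cone (link K v) := by
  refine ⟨fun w => ?_, (face_link hv).2 ⟨?_, hs.mono ?_⟩⟩
  · by_cases h : w = v
    · subst h; rw [killCoord_self]; rfl
    · rw [killCoord_of_ne h]; exact hx w
  · rw [Finsupp.notMem_support_iff]; exact killCoord_self v x
  · exact insert_subset hvs ((support_killCoord_subset v x).trans hxs)

theorem add_single_mem_cone {v : V} (hv : v ∈ vertices K) {x : V →₀ ℝ} (hx : x ∈ cone (link K v))
    {t : ℝ} (ht : 0 ≤ t) : x + Finsupp.single v t ∈ cone K := by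
  refine mem_cone_of_subset (add_nonneg hx.1 (Finsupp.single_nonneg.2 ht))
    ((face_link hv).1 hx.2).2 ?_
  refine Finsupp.support_add.trans (union_subset (subset_insert _ _) ?_)
  exact Finsupp.support_single_subset.trans (by simp)

theorem smul_single_one (v : V) (t : ℝ) : t • Finsupp.single v (1 : ℝ) = Finsupp.single v t := by
  simp

/-- In a simplicial cone, the directions of the rays contained in it belong to it. -/
theorem mem_of_affine_ray {F : (W →₀ ℝ) →ₗ[ℝ] (V →₀ ℝ)} (hF : Set.BijOn F (cone L) (cone K))
    {w : W} (hw : w ∈ vertices L) {u : V →₀ ℝ} {z : ℕ → W →₀ ℝ} (hz : ∀ t, z t ∈ cone L)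
    (hFz : ∀ t : ℕ, F (z t) = u + (t : ℝ) • F (Finsupp.single w 1)) {s : Finset W}
    (hs : Face L s) (hinf : {t | (z t).support ⊆ s}.Infinite) : w ∈ s := by
  have hinj : ∀ x y : W →₀ ℝ, x.support ⊆ s → y.support ⊆ s → F x = F y → x = y := by
    intro x y hx hy hxy
    let c : W →₀ ℝ := (∑ a ∈ s, (|x a| + |y a|)) • indicatorVec s
    have hc : ∀ a ∈ s, |x a| ≤ c a ∧ |y a| ≤ c a := by
      intro a ha
      have h1 := single_le_sum (f := fun a => |x a| + |y a|) (fun i _ => by positivity) ha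
      have h2 : c a = ∑ a ∈ s, (|x a| + |y a|) := by
        simp [c, indicatorVec_apply, ha]
      rw [h2]
      have h3 := abs_nonneg (x a)
      have h4 := abs_nonneg (y a)
      constructor <;> linarith
    have hcs : c.support ⊆ s := Finsupp.support_smul.trans (support_indicatorVec s).subset
    have hxc : ∀ x : W →₀ ℝ, x.support ⊆ s → (∀ a ∈ s, |x a| ≤ c a) → x + c ∈ cone L := by
      intro x hx h
      refine mem_cone_of_subset (fun a => ?_) hs (Finsupp.support_add.trans (union_subset hx hcs))
      by_cases ha : a ∈ s
      · have h1 := h a ha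
        have h2 := neg_abs_le (x a)
        simp only [Finsupp.coe_zero, Pi.zero_apply, Finsupp.coe_add, Pi.add_apply]
        linarith
      · rw [Finsupp.add_apply, Finsupp.notMem_support_iff.1 fun h => ha (hx h),
          Finsupp.notMem_support_iff.1 fun h => ha (hcs h), add_zero]
        rfl
    have := hF.injOn (hxc x hx fun a ha => (hc a ha).1) (hxc y hy fun a ha => (hc a ha).2)
      (by rw [map_add, map_add, hxy])
    exact add_right_cancel this
  obtain ⟨t₀, ht₀⟩ := hinf.nonempty
  obtain ⟨t₁, ht₁, ht⟩ := hinf.exists_gt t₀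
  have hpos : (0 : ℝ) < t₁ - t₀ := sub_pos.2 (Nat.cast_lt.2 ht)
  set d : W →₀ ℝ := ((t₁ : ℝ) - t₀)⁻¹ • (z t₁ - z t₀) with hd
  have hds : d.support ⊆ s :=
    Finsupp.support_smul.trans (Finsupp.support_sub.trans (union_subset ht₁ ht₀))
  have hFd : F d = F (Finsupp.single w 1) := by
    rw [hd, map_smul, map_sub, hFz, hFz, add_sub_add_left_eq_sub, ← sub_smul, smul_smul,
      inv_mul_cancel₀ hpos.ne', one_smul]
  have hzt : ∀ t : ℕ, (z t).support ⊆ s → z t = z t₀ + ((t : ℝ) - t₀) • d := by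
    intro t hts
    refine hinj _ _ hts (Finsupp.support_add.trans
      (union_subset ht₀ (Finsupp.support_smul.trans hds))) ?_
    rw [map_add, map_smul, hFd, hFz, hFz]
    module
  have hd0 : 0 ≤ d := by
    intro a
    by_contra hneg
    simp only [Finsupp.coe_zero, Pi.zero_apply, not_le] at hneg
    obtain ⟨n, hn⟩ := exists_nat_gt (t₀ + z t₀ a / (-d a))
    obtain ⟨t, hts, hnt⟩ := hinf.exists_gt n
    have h1 := (hz t).1 a
    rw [hzt t hts] at h1
    simp only [Finsupp.coe_zero, Pi.zero_apply, Finsupp.coe_add, Pi.add_apply, Finsupp.coe_smul,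
      Pi.smul_apply, smul_eq_mul] at h1
    have h2 : (n : ℝ) < t := Nat.cast_lt.2 hnt
    have h3 : z t₀ a / (-d a) < t - t₀ := by linarith
    rw [div_lt_iff₀ (by linarith)] at h3
    linarith
  have := hF.injOn (mem_cone_of_subset hd0 hs hds) (single_mem_cone hw zero_le_one) hFd
  rw [this] at hds
  exact hds (by simp)

theorem link_bijOn {F : (W →₀ ℝ) →ₗ[ℝ] (V →₀ ℝ)} (hF : Set.BijOn F (cone L) (cone K))
    (hfin : L.faces.Finite) {w : W} (hw : w ∈ vertices L) {v : V} (hv : v ∈ vertices K) {c : ℝ}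
    (hc : 0 < c) (hFw : F (Finsupp.single w 1) = Finsupp.single v c) :
    Set.BijOn (killCoord v ∘ₗ F) (cone (link L w)) (cone (link K v)) := by
  have hFt : ∀ t : ℝ, F (Finsupp.single w t) = Finsupp.single v (t * c) := by
    intro t
    rw [← smul_single_one, map_smul, hFw, Finsupp.smul_single, smul_eq_mul]
  have hle : ∀ x ∈ cone (link L w), x ∈ cone L := fun x hx => by
    simpa using add_single_mem_cone hw hx le_rfl
  have hnot : ∀ x ∈ cone (link L w), w ∉ x.support := fun x hx => ((face_link hw).1 hx.2).1
  refine ⟨fun x hx => ?_, fun x hx y hy hxy => ?_, fun u hu => ?_⟩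
  · have h1 := hF.mapsTo (add_single_mem_cone hw hx zero_le_one)
    rw [map_add, hFt, one_mul] at h1
    simp only [LinearMap.coe_comp, Function.comp_apply]
    have h0 := (hF.mapsTo (hle x hx)).1
    rw [← killCoord_add_single v (F x) c]
    refine killCoord_mem_cone_link hv h1.1 h1.2 subset_rfl ?_
    rw [Finsupp.mem_support_iff]
    have := h0 v
    simp only [Finsupp.coe_zero, Pi.zero_apply] at this
    simp only [Finsupp.coe_add, Pi.add_apply, Finsupp.single_eq_same]
    linarith
  · simp only [LinearMap.coe_comp, Function.comp_apply, killCoord_apply, smul_single_one] at hxy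
    have h1 : F (x + Finsupp.single w (F y v / c)) = F (y + Finsupp.single w (F x v / c)) := by
      rw [map_add, map_add, hFt, hFt, div_mul_cancel₀ _ hc.ne', div_mul_cancel₀ _ hc.ne']
      have := sub_eq_sub_iff_add_eq_add.1 hxy
      exact this
    have h2 := hF.injOn (add_single_mem_cone hw hx (div_nonneg ((hF.mapsTo (hle y hy)).1 v) hc.le))
      (add_single_mem_cone hw hy (div_nonneg ((hF.mapsTo (hle x hx)).1 v) hc.le)) h1
    have h3 := congrArg (killCoord w) h2
    rwa [killCoord_add_single, killCoord_add_single, killCoord_of_notMem (hnot x hx),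
      killCoord_of_notMem (hnot y hy)] at h3
  · have hut : ∀ t : ℕ, ∃ z ∈ cone L, F z = u + (t : ℝ) • F (Finsupp.single w 1) := by
      intro t
      have h1 := add_single_mem_cone hv hu (mul_nonneg (Nat.cast_nonneg t) hc.le)
      obtain ⟨z, hz, hzu⟩ := hF.surjOn h1
      exact ⟨z, hz, by rw [hzu, hFw, Finsupp.smul_single, smul_eq_mul]⟩
    choose z hz hFz using hut
    have hmem : ∀ t, (z t).support ∈ insert ∅ L.faces := fun t => (hz t).2
    have : Finite (insert ∅ L.faces : Set (Finset W)) := (hfin.insert ∅).to_subtype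
    obtain ⟨s, hs⟩ := Finite.exists_infinite_fiber
      (fun t => (⟨(z t).support, hmem t⟩ : (insert ∅ L.faces : Set (Finset W))))
    have hs' : {t | (z t).support ⊆ (s : Finset W)}.Infinite := by
      refine Set.Infinite.mono ?_ (Set.infinite_coe_iff.1 hs)
      intro t ht
      have : (z t).support = s := congrArg Subtype.val ht
      exact this.subset
    have hws := mem_of_affine_ray hF hw hz hFz s.2 hs'
    obtain ⟨t, ht⟩ := hs'.nonempty
    refine ⟨killCoord w (z t), killCoord_mem_cone_link hw (hz t).1 s.2 ht hws, ?_⟩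
    simp only [LinearMap.coe_comp, Function.comp_apply]
    rw [killCoord_apply w, smul_single_one, map_sub, hFz, hFw, hFt, Finsupp.smul_single,
      smul_eq_mul, add_sub_assoc, ← Finsupp.single_sub, killCoord_add_single]
    exact killCoord_of_notMem ((face_link hv).1 hu.2).1

end

end CellPM

namespace CellPM

noncomputable section

open Classical Finset

variable {V W U : Type*} {K K' : PreAbstractSimplicialComplex V} {L : PreAbstractSimplicialComplex W}

/-- The sum of the coordinates. -/
def coordSum (V : Type*) : (V →₀ ℝ) →ₗ[ℝ] ℝ := Finsupp.linearCombination ℝ (fun _ => (1 : ℝ))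

theorem coordSum_eq (x : V →₀ ℝ) {s : Finset V} (hs : x.support ⊆ s) :
    coordSum V x = ∑ v ∈ s, x v := by
  rw [coordSum, Finsupp.linearCombination_apply, Finsupp.sum_of_support_subset _ hs _ (by simp)]
  simp

theorem coordSum_single (v : V) (c : ℝ) : coordSum V (Finsupp.single v c) = c := by
  simp [coordSum]

theorem coordSum_pos {x : V →₀ ℝ} (hx : 0 ≤ x) (h0 : x ≠ 0) : 0 < coordSum V x := by
  rw [coordSum_eq x subset_rfl]
  exact sum_pos (fun v hv => (hx v).lt_of_ne' (Finsupp.mem_support_iff.1 hv))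
    (Finsupp.support_nonempty_iff.2 h0)

/-- The points of the cone whose coordinates sum up to `1`. -/
def slice (K : PreAbstractSimplicialComplex V) : Set (V →₀ ℝ) := {x ∈ cone K | coordSum V x = 1}

theorem mem_simplex {s : Finset V} {x : V → ℝ} :
    x ∈ simplex s ↔ ∃ y : V →₀ ℝ, 0 ≤ y ∧ y.support ⊆ s ∧ coordSum V y = 1 ∧ ⇑y = x := by
  have hcoe : ∀ v : V, ⇑(Finsupp.single v (1 : ℝ)) = Pi.single v 1 := fun v =>
    Finsupp.single_eq_pi_single v 1
  constructor
  · intro hx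
    have hconv : Convex ℝ {x : V → ℝ | ∃ y : V →₀ ℝ, 0 ≤ y ∧ y.support ⊆ s ∧
        coordSum V y = 1 ∧ ⇑y = x} := by
      rintro _ ⟨y, hy, hys, hy1, rfl⟩ _ ⟨z, hz, hzs, hz1, rfl⟩ a b ha hb hab
      refine ⟨a • y + b • z, add_nonneg (smul_nonneg ha hy) (smul_nonneg hb hz), ?_, ?_, ?_⟩
      · exact Finsupp.support_add.trans (union_subset (Finsupp.support_smul.trans hys)
          (Finsupp.support_smul.trans hzs))
      · rw [map_add, map_smul, map_smul, hy1, hz1]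
        simpa using hab
      · rw [Finsupp.coe_add, Finsupp.coe_smul, Finsupp.coe_smul]
    refine convexHull_min ?_ hconv hx
    rintro _ ⟨v, hv, rfl⟩
    exact ⟨Finsupp.single v 1, Finsupp.single_nonneg.2 zero_le_one,
      Finsupp.support_single_subset.trans (singleton_subset_iff.2 hv), coordSum_single v 1, hcoe v⟩
  · rintro ⟨y, hy, hys, hy1, rfl⟩
    have : ⇑y = ∑ v ∈ s, y v • (Pi.single v (1 : ℝ) : V → ℝ) := by
      conv_lhs => rw [sum_single_eq y hys]
      rw [Finsupp.coe_finsetSum]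
      exact sum_congr rfl fun v _ => by rw [Finsupp.coe_smul, hcoe]
    rw [this]
    refine (convex_convexHull ℝ _).sum_mem (fun v _ => hy v) ?_ fun v hv => ?_
    · rw [← coordSum_eq y hys, hy1]
    · exact subset_convexHull ℝ _ ⟨v, hv, rfl⟩

theorem mem_carrier {x : V → ℝ} : x ∈ carrier K ↔ ∃ y ∈ slice K, ⇑y = x := by
  simp only [carrier, Set.mem_iUnion, exists_prop, mem_simplex]
  constructor
  · rintro ⟨s, hs, y, hy, hys, hy1, rfl⟩
    exact ⟨y, ⟨mem_cone_of_subset hy (Or.inr hs) hys, hy1⟩, rfl⟩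
  · rintro ⟨y, ⟨hy, hy1⟩, rfl⟩
    refine ⟨y.support, hy.2.mem ?_, y, hy.1, subset_rfl, hy1, rfl⟩
    rw [Finsupp.support_nonempty_iff]
    rintro rfl
    simp at hy1

theorem inv_smul_mem_slice {x : V →₀ ℝ} (hx : x ∈ cone K) (h0 : x ≠ 0) :
    (coordSum V x)⁻¹ • x ∈ slice K := by
  have := coordSum_pos hx.1 h0
  refine ⟨smul_mem_cone hx (inv_nonneg.2 this.le), ?_⟩
  rw [map_smul, smul_eq_mul, inv_mul_cancel₀ this.ne']

theorem bijOn_cone_of_slice {F : (W →₀ ℝ) →ₗ[ℝ] (V →₀ ℝ)}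
    (hF : Set.BijOn F (slice L) (slice K)) : Set.BijOn F (cone L) (cone K) := by
  have hmap : ∀ x ∈ cone L, F x ∈ cone K ∧ coordSum V (F x) = coordSum W x := by
    intro x hx
    by_cases h0 : x = 0
    · subst h0; simpa using zero_mem_cone
    · have hpos := coordSum_pos hx.1 h0
      have h1 := hF.mapsTo (inv_smul_mem_slice hx h0)
      rw [map_smul] at h1
      constructor
      · have := smul_mem_cone h1.1 hpos.le
        rwa [smul_smul, mul_inv_cancel₀ hpos.ne', one_smul] at this
      · have := h1.2
        rw [map_smul, smul_eq_mul, inv_mul_eq_one₀ hpos.ne'] at this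
        exact this.symm
  refine ⟨fun x hx => (hmap x hx).1, fun x hx y hy hxy => ?_, fun y hy => ?_⟩
  · have hs : coordSum W x = coordSum W y := by rw [← (hmap x hx).2, ← (hmap y hy).2, hxy]
    by_cases hx0 : x = 0
    · by_contra hne
      have := coordSum_pos hy.1 (fun e => hne (hx0.trans e.symm))
      rw [← hs, hx0, map_zero] at this
      exact this.ne rfl
    · have hy0 : y ≠ 0 := by
        rintro rfl
        have := coordSum_pos hx.1 hx0
        rw [hs, map_zero] at this
        exact this.ne rfl
      have h1 := inv_smul_mem_slice hx hx0
      have h2 := inv_smul_mem_slice hy hy0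
      rw [← hs] at h2
      have h3 := hF.injOn h1 h2 (by rw [map_smul, map_smul, hxy])
      exact smul_right_injective _ (inv_ne_zero (coordSum_pos hx.1 hx0).ne') h3
  · by_cases h0 : y = 0
    · exact ⟨0, zero_mem_cone, by rw [h0, map_zero]⟩
    · obtain ⟨x, hx, hxy⟩ := hF.surjOn (inv_smul_mem_slice hy h0)
      refine ⟨coordSum V y • x, smul_mem_cone hx.1 (coordSum_pos hy.1 h0).le, ?_⟩
      rw [map_smul, hxy, smul_smul, mul_inv_cancel₀ (coordSum_pos hy.1 h0).ne', one_smul]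

theorem bijOn_slice_of_cone {F : (W →₀ ℝ) →ₗ[ℝ] (V →₀ ℝ)} (hF : Set.BijOn F (cone L) (cone K))
    (hsum : ∀ x ∈ cone L, coordSum V (F x) = coordSum W x) : Set.BijOn F (slice L) (slice K) := by
  refine ⟨fun x hx => ⟨hF.mapsTo hx.1, by rw [hsum x hx.1, hx.2]⟩,
    hF.injOn.mono fun x hx => hx.1, fun y hy => ?_⟩
  obtain ⟨x, hx, rfl⟩ := hF.surjOn hy.1
  exact ⟨x, ⟨hx, by rw [← hsum x hx, hy.2]⟩, rfl⟩

/-- The diagonal linear map with coefficients `c`. -/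
def diagMap (c : V → ℝ) : (V →₀ ℝ) →ₗ[ℝ] (V →₀ ℝ) :=
  Finsupp.linearCombination ℝ fun v => Finsupp.single v (c v)

theorem diagMap_single (c : V → ℝ) (v : V) (a : ℝ) :
    diagMap c (Finsupp.single v a) = Finsupp.single v (a * c v) := by
  simp [diagMap]

theorem diagMap_apply (c : V → ℝ) (x : V →₀ ℝ) (v : V) : diagMap c x v = x v * c v := by
  induction x using Finsupp.induction_linear with
  | zero => simp
  | add f g hf hg => rw [map_add, Finsupp.add_apply, hf, hg, Finsupp.add_apply, add_mul]
  | single w a =>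
    rw [diagMap_single, Finsupp.single_apply, Finsupp.single_apply]
    split_ifs with h
    · rw [h]
    · rw [zero_mul]

theorem diagMap_mem_cone {c : V → ℝ} (hc : ∀ v, 0 < c v) {x : V →₀ ℝ} (hx : x ∈ cone K) :
    diagMap c x ∈ cone K := by
  refine mem_cone_of_subset (fun v => ?_) hx.2 fun v hv => ?_
  · rw [diagMap_apply]
    exact mul_nonneg (hx.1 v) (hc v).le
  · rw [Finsupp.mem_support_iff, diagMap_apply] at hv
    exact Finsupp.mem_support_iff.2 (left_ne_zero_of_mul hv)

theorem diagMap_bijOn {c : V → ℝ} (hc : ∀ v, 0 < c v) :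
    Set.BijOn (diagMap c) (cone K) (cone K) := by
  refine ⟨fun x hx => diagMap_mem_cone hc hx, fun x _ y _ hxy => ?_, fun y hy => ?_⟩
  · ext v
    have := DFunLike.congr_fun hxy v
    rw [diagMap_apply, diagMap_apply] at this
    exact mul_right_cancel₀ (hc v).ne' this
  · refine ⟨diagMap (fun v => (c v)⁻¹) y, diagMap_mem_cone (fun v => inv_pos.2 (hc v)) hy, ?_⟩
    ext v
    rw [diagMap_apply, diagMap_apply, inv_mul_cancel_right₀ (hc v).ne']

theorem exists_bijOn_slice {F : (W →₀ ℝ) →ₗ[ℝ] (V →₀ ℝ)} (hF : Set.BijOn F (cone L) (cone K)) :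
    ∃ G : (W →₀ ℝ) →ₗ[ℝ] (V →₀ ℝ), Set.BijOn G (slice L) (slice K) := by
  have hpos : ∀ w ∈ vertices L, 0 < coordSum V (F (Finsupp.single w 1)) := fun w hw =>
    coordSum_pos (hF.mapsTo (single_mem_cone hw zero_le_one)).1 (map_single_ne_zero hF hw)
  let c : W → ℝ := fun w => if w ∈ vertices L then (coordSum V (F (Finsupp.single w 1)))⁻¹ else 1
  have hc : ∀ w, 0 < c w := by
    intro w
    simp only [c]
    split_ifs with h
    · exact inv_pos.2 (hpos w h)
    · exact one_pos
  refine ⟨F ∘ₗ diagMap c, bijOn_slice_of_cone (bijOn_comp hF (diagMap_bijOn hc)) fun x hx => ?_⟩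
  have h1 := map_eq_sum (coordSum V ∘ₗ F ∘ₗ diagMap c) x subset_rfl
  rw [LinearMap.comp_apply] at h1
  rw [h1, coordSum_eq x subset_rfl]
  refine sum_congr rfl fun w hw => ?_
  have hwL := hx.2.mem_vertices hw
  rw [LinearMap.comp_apply, LinearMap.comp_apply, diagMap_single, one_mul, ← smul_single_one,
    map_smul, map_smul]
  simp only [c, if_pos hwL]
  rw [smul_eq_mul, smul_eq_mul, inv_mul_cancel₀ (hpos w hwL).ne', mul_one]

theorem carrier_isCompact (h : K.faces.Finite) : IsCompact (carrier K) :=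
  h.isCompact_biUnion fun s _ => (s.finite_toSet.image _).isCompact_convexHull ℝ

theorem isSubdivision_of_bijOn {k : ℕ} (hL : IsNPM k L) {F : (W →₀ ℝ) →ₗ[ℝ] (V →₀ ℝ)}
    (hF : Set.BijOn F (cone L) (cone K)) : IsSubdivision L K := by
  refine ⟨⟨k, isNormalPseudomanifold_iff.2 hL⟩, ?_⟩
  obtain ⟨G, hG⟩ := exists_bijOn_slice hF
  have hfin := vertices_finite hL.finite
  let g : (W → ℝ) →ₗ[ℝ] (V → ℝ) := ∑ w ∈ hfin.toFinset,
    (LinearMap.proj w).smulRight (⇑(G (Finsupp.single w 1)))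
  have hgdef : ∀ x : W → ℝ, g x = ∑ w ∈ hfin.toFinset, x w • ⇑(G (Finsupp.single w 1)) := by
    intro x
    simp [g]
  have hg : ∀ y ∈ slice L, g ⇑y = ⇑(G y) := by
    intro y hy
    have hsub : y.support ⊆ hfin.toFinset := fun w hw => by
      simpa using hy.1.2.mem_vertices hw
    rw [map_eq_sum G y hsub, hgdef, Finsupp.coe_finsetSum]
    rfl
  have hbij : Set.BijOn g (carrier L) (carrier K) := by
    refine ⟨fun x hx => ?_, fun x hx x' hx' h => ?_, fun z hz => ?_⟩
    · obtain ⟨y, hy, rfl⟩ := mem_carrier.1 hx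
      exact mem_carrier.2 ⟨G y, hG.mapsTo hy, (hg y hy).symm⟩
    · obtain ⟨y, hy, rfl⟩ := mem_carrier.1 hx
      obtain ⟨y', hy', rfl⟩ := mem_carrier.1 hx'
      rw [hg y hy, hg y' hy'] at h
      rw [hG.injOn hy hy' (DFunLike.coe_injective h)]
    · obtain ⟨y, hy, rfl⟩ := mem_carrier.1 hz
      obtain ⟨x, hx, rfl⟩ := hG.surjOn hy
      exact ⟨x, mem_carrier.2 ⟨x, hx, rfl⟩, hg x hx⟩
  have hcont : Continuous g := by
    have : ⇑g = fun x : W → ℝ => ∑ w ∈ hfin.toFinset, x w • ⇑(G (Finsupp.single w 1)) :=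
      funext hgdef
    rw [this]
    fun_prop
  have hcomp : CompactSpace (carrier L) := isCompact_iff_compactSpace.1 (carrier_isCompact hL.finite)
  have hcont' : Continuous (hbij.equiv g) :=
    (hcont.comp continuous_subtype_val).subtype_mk _
  exact ⟨hcont'.homeoOfEquivCompactToT2, fun s _ => ⟨g.toAffineMap, fun x _ => rfl⟩⟩

theorem exists_bijOn_of_isSubdivision (h : IsSubdivision L K) :
    (∃ k, IsNPM k L) ∧ ∃ F : (W →₀ ℝ) →ₗ[ℝ] (V →₀ ℝ), Set.BijOn F (cone L) (cone K) := by
  obtain ⟨⟨k, hk⟩, f, hf⟩ := h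
  refine ⟨⟨k, isNormalPseudomanifold_iff.1 hk⟩, ?_⟩
  have hφ : ∀ w ∈ vertices L, ∃ z ∈ slice K, ∃ h : ⇑(Finsupp.single w (1 : ℝ)) ∈ carrier L,
      ⇑z = (f ⟨_, h⟩ : V → ℝ) := by
    intro w hw
    have h : ⇑(Finsupp.single w (1 : ℝ)) ∈ carrier L :=
      mem_carrier.2 ⟨_, ⟨single_mem_cone hw zero_le_one, coordSum_single w 1⟩, rfl⟩
    obtain ⟨z, hz, hzf⟩ := mem_carrier.1 (f ⟨_, h⟩).2
    exact ⟨z, hz, h, hzf⟩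
  choose! φ hφK hφL hφ using hφ
  let F : (W →₀ ℝ) →ₗ[ℝ] (V →₀ ℝ) := Finsupp.linearCombination ℝ φ
  have hF1 : ∀ w, F (Finsupp.single w 1) = φ w := fun w => by simp [F]
  have hF : ∀ (y : W →₀ ℝ) (hy : y ∈ slice L),
      ⇑(F y) = (f ⟨⇑y, mem_carrier.2 ⟨y, hy, rfl⟩⟩ : V → ℝ) := by
    intro y hy
    have hs : y.support ∈ L := by
      refine hy.1.2.mem ?_
      rw [Finsupp.support_nonempty_iff]
      rintro rfl
      have := hy.2
      simp at this
    obtain ⟨g, hg⟩ := hf _ hs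
    rw [hg ⟨⇑y, _⟩ (mem_simplex.2 ⟨y, hy.1.1, subset_rfl, hy.2, rfl⟩)]
    have hgd : ∀ x, g x = g.linear x + g 0 := fun x => congrFun (AffineMap.decomp g) x
    have hw : ∀ w ∈ y.support, ⇑(φ w) = g.linear ⇑(Finsupp.single w (1 : ℝ)) + g 0 := by
      intro w hw
      have hwL := hy.1.2.mem_vertices hw
      rw [hφ w hwL, hg _ (mem_simplex.2 ⟨Finsupp.single w 1, Finsupp.single_nonneg.2 zero_le_one,
        Finsupp.support_single_subset.trans (singleton_subset_iff.2 hw), coordSum_single w 1, rfl⟩),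
        hgd]
    have h1 : ∑ w ∈ y.support, y w = 1 := by rw [← coordSum_eq y subset_rfl, hy.2]
    rw [hgd, map_eq_sum F y subset_rfl, Finsupp.coe_finsetSum]
    have h2 : g.linear ⇑y = ∑ w ∈ y.support, y w • g.linear ⇑(Finsupp.single w (1 : ℝ)) :=
      map_eq_sum (g.linear ∘ₗ Finsupp.lcoeFun) y subset_rfl
    show _ = g.linear ⇑y + g 0
    have h3 : g 0 = ∑ w ∈ y.support, y w • g 0 := by rw [← sum_smul, h1, one_smul]
    rw [h2, h3, ← sum_add_distrib]
    refine sum_congr rfl fun w hws => ?_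
    rw [Finsupp.coe_smul, hF1, hw w hws, smul_add]
  refine ⟨F, bijOn_cone_of_slice ⟨fun y hy => ?_, fun y hy y' hy' h => ?_, fun z hz => ?_⟩⟩
  · obtain ⟨z, hz, hzf⟩ := mem_carrier.1 (f ⟨⇑y, mem_carrier.2 ⟨y, hy, rfl⟩⟩).2
    rw [← hF y hy] at hzf
    rwa [← DFunLike.coe_injective hzf]
  · have h1 := congrArg DFunLike.coe h
    rw [hF y hy, hF y' hy'] at h1
    have h2 := f.injective (Subtype.ext h1)
    exact DFunLike.coe_injective (congrArg Subtype.val h2)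
  · obtain ⟨⟨x, hx⟩, hxz⟩ := f.surjective ⟨⇑z, mem_carrier.2 ⟨z, hz, rfl⟩⟩
    obtain ⟨y, hy, rfl⟩ := mem_carrier.1 hx
    refine ⟨y, hy, DFunLike.coe_injective ?_⟩
    rw [hF y hy, hxz]

theorem exists_isoVia_of_isIsomorphic [Nonempty W] (h : IsIsomorphic K L) :
    ∃ f : V → W, IsoVia f K L := by
  obtain ⟨e, he⟩ := h
  let f : V → W := fun v => if hv : v ∈ vertices K then e ⟨v, hv⟩ else Classical.arbitrary W
  have hfe : ∀ v : vertices K, f v = e v := fun v => by simp [f, v.2]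
  have hinj : Set.InjOn f (vertices K) := by
    intro a ha b hb hab
    rw [hfe ⟨a, ha⟩, hfe ⟨b, hb⟩] at hab
    exact congrArg Subtype.val (e.injective (Subtype.ext hab))
  have himg : ∀ s : Finset (vertices K),
      (s.map e.toEmbedding).map (Function.Embedding.subtype _) =
        (s.map (Function.Embedding.subtype _)).image f := by
    intro s
    ext x
    simp only [mem_map, mem_image, exists_exists_and_eq_and, Function.Embedding.subtype_apply, hfe]
    rfl
  refine ⟨f, hinj, fun t => ?_⟩
  have hface : ∀ s : Finset (vertices K), Face K (s.map (Function.Embedding.subtype _)) ↔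
      Face L ((s.map (Function.Embedding.subtype _)).image f) := by
    intro s
    rw [← himg]
    exact or_congr (by simp) (he s)
  constructor
  · intro ht
    let t' : Finset (vertices L) := t.subtype (· ∈ vertices L)
    have ht' : t'.map (Function.Embedding.subtype _) = t :=
      subtype_map_of_mem fun x hx => ht.mem_vertices hx
    let s : Finset (vertices K) := t'.map e.symm.toEmbedding
    have hst : (s.map (Function.Embedding.subtype _)).image f = t := by
      rw [← himg, ← ht']
      congr 1
      ext x
      simp [s]
    exact ⟨_, (hface s).2 (by rwa [hst]), hst⟩
  · rintro ⟨s, hs, rfl⟩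
    have hs' : (s.subtype (· ∈ vertices K)).map (Function.Embedding.subtype _) = s :=
      subtype_map_of_mem fun x hx => hs.mem_vertices hx
    rw [← hs', ← hface, hs']
    exact hs

theorem isIsomorphic_refl : IsIsomorphic K K := by
  refine IsoVia.isIsomorphic (f := id) ⟨Function.injective_id.injOn, fun t => ?_⟩
  simp

theorem combinatoriallyEquivalent_iff :
    CombinatoriallyEquivalent K L ↔ ∃ (J : PreAbstractSimplicialComplex ℕ) (k : ℕ)
      (F : (ℕ →₀ ℝ) →ₗ[ℝ] (V →₀ ℝ)) (G : (ℕ →₀ ℝ) →ₗ[ℝ] (W →₀ ℝ)), IsNPM k J ∧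
        Set.BijOn F (cone J) (cone K) ∧ Set.BijOn G (cone J) (cone L) := by
  constructor
  · rintro ⟨J, J', h1, h2, h3⟩
    obtain ⟨⟨k, hk⟩, F, hF⟩ := exists_bijOn_of_isSubdivision h1
    obtain ⟨-, G, hG⟩ := exists_bijOn_of_isSubdivision h2
    obtain ⟨f, hf⟩ := exists_isoVia_of_isIsomorphic h3
    exact ⟨J, k, F, _, hk, hF, bijOn_comp hG hf.bijOn_cone⟩
  · rintro ⟨J, k, F, G, hk, hF, hG⟩
    exact ⟨J, J, isSubdivision_of_bijOn hk hF, isSubdivision_of_bijOn hk hG, isIsomorphic_refl⟩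

end

end CellPM

namespace CellPM

noncomputable section

open Classical Finset

variable {V W U : Type*} {K K' : PreAbstractSimplicialComplex V} {L : PreAbstractSimplicialComplex W}

theorem IsStarring.exists_starringAt (h : IsStarring K K') : ∃ σ v, StarringAt K K' σ v := by
  obtain ⟨σ, hσ, v, hv, hs⟩ := h
  exact ⟨σ, v, hσ, hv, hs⟩

theorem exists_starringAt {σ : Finset V} (hσ : σ ∈ K) {v : V} (hv : v ∉ vertices K) :
    ∃ K', StarringAt K K' σ v := by
  have hface : ∀ s t : Finset V, ¬ σ ⊆ s ∧ Face K (unstar σ v s) → t ⊆ s →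
      ¬ σ ⊆ t ∧ Face K (unstar σ v t) := fun s t h hts =>
    ⟨fun h' => h.1 (h'.trans hts), h.2.mono (StarringAt.unstar_mono hts)⟩
  refine ⟨⟨{s | s.Nonempty ∧ ¬ σ ⊆ s ∧ Face K (unstar σ v s)}, ?_⟩, .of_face_iff hσ hv fun s => ?_⟩
  · rintro s ⟨hs, h⟩
    exact ⟨hs, fun t hts ht => ⟨ht, hface s t h hts⟩⟩
  · constructor
    · rintro (rfl | h)
      · refine ⟨fun h => (nonempty_of_mem hσ).ne_empty (subset_empty.1 h), ?_⟩
        simpa [unstar] using face_empty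
      · exact h.2
    · intro h
      rcases s.eq_empty_or_nonempty with rfl | hs
      · exact face_empty
      · exact Or.inr ⟨hs, h⟩

theorem starMap_single_self (p : V →₀ ℝ) (v : V) : starMap p v (Finsupp.single v 1) = p := by
  simp [starMap_apply]

theorem starMap_single_of_ne (p : V →₀ ℝ) {v w : V} (h : w ≠ v) :
    starMap p v (Finsupp.single w 1) = Finsupp.single w 1 := by
  simp [starMap_apply, Finsupp.single_eq_of_ne' h]

/-- The functional `h` does not change sign on the simplices of `K`. -/
def SignConstant (h : (V →₀ ℝ) →ₗ[ℝ] ℝ) (K : PreAbstractSimplicialComplex V) : Prop :=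
  ∀ s, Face K s → (∀ v ∈ s, 0 ≤ h (Finsupp.single v 1)) ∨ ∀ v ∈ s, h (Finsupp.single v 1) ≤ 0

theorem exists_signConstant [Infinite V] {k : ℕ} (hK : IsNPM k K) (h : (V →₀ ℝ) →ₗ[ℝ] ℝ) :
    ∃ (K' : PreAbstractSimplicialComplex V) (F : (V →₀ ℝ) →ₗ[ℝ] (V →₀ ℝ)), IsNPM k K' ∧
      Set.BijOn F (cone K') (cone K) ∧ SignConstant (h ∘ₗ F) K' := by
  let bad : PreAbstractSimplicialComplex V → ((V →₀ ℝ) →ₗ[ℝ] ℝ) → Set (V × V) := fun K h =>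
    {p | h (Finsupp.single p.1 1) < 0 ∧ 0 < h (Finsupp.single p.2 1) ∧ Face K {p.1, p.2}}
  have hfin : ∀ K h, IsNPM k K → (bad K h).Finite := by
    intro K h hK
    have hv := vertices_finite hK.finite
    refine (hv.prod hv).subset ?_
    rintro ⟨a, b⟩ ⟨-, -, hab⟩
    exact ⟨hab.mem_vertices (by simp), hab.mem_vertices (by simp)⟩
  induction hn : (bad K h).ncard using Nat.strong_induction_on generalizing K h with
  | _ n ih =>
    by_cases hbad : (bad K h) = ∅
    · refine ⟨K, LinearMap.id, hK, Set.bijOn_id _, fun s hs => ?_⟩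
      by_contra hcon
      push Not at hcon
      obtain ⟨⟨a, ha, hha⟩, b, hb, hhb⟩ := hcon
      have : (a, b) ∈ bad K h := by
        refine ⟨hha, hhb, hs.mono ?_⟩
        intro x hx
        rcases mem_insert.1 hx with rfl | hx
        · exact ha
        · rwa [mem_singleton.1 hx]
      rw [hbad] at this
      exact this
    · obtain ⟨⟨a, b⟩, ha, hb, hab⟩ := Set.nonempty_iff_ne_empty.2 hbad
      dsimp only at ha hb hab
      have hne : a ≠ b := by
        rintro rfl
        exact lt_asymm ha hb
      obtain ⟨v, hv⟩ := (vertices_finite hK.finite).infinite_compl.nonempty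
      obtain ⟨K₁, hK₁⟩ := exists_starringAt (hab.mem (insert_nonempty _ _)) hv
      set p : V →₀ ℝ := Finsupp.single a (h (Finsupp.single b 1)) +
        Finsupp.single b (-h (Finsupp.single a 1)) with hp
      have hp0 : 0 ≤ p := add_nonneg (Finsupp.single_nonneg.2 hb.le)
        (Finsupp.single_nonneg.2 (by linarith))
      have hps : p.support = {a, b} := by
        ext x
        simp only [hp, Finsupp.mem_support_iff, Finsupp.add_apply, Finsupp.single_apply, mem_insert,
          mem_singleton]
        by_cases hxa : a = x
        · subst hxa
          simp [hne.symm, hb.ne']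
        · by_cases hxb : b = x
          · subst hxb
            simp [hne, ha.ne]
          · simp [hxa, hxb, Ne.symm hxa, Ne.symm hxb]
      have hhp : h p = 0 := by
        rw [hp, map_add, ← smul_single_one a (h (Finsupp.single b 1)),
          ← smul_single_one b (-h (Finsupp.single a 1)), map_smul, map_smul]
        simp only [smul_eq_mul]
        ring
      have hsub : bad K₁ (h ∘ₗ starMap p v) ⊆ bad K h \ {(a, b)} := by
        rintro ⟨c, d⟩ ⟨hc, hd, hcd⟩
        have hne : ∀ x, h (starMap p v (Finsupp.single x 1)) ≠ 0 → x ≠ v := by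
          rintro x hx rfl
          rw [starMap_single_self] at hx
          exact hx hhp
        have hcv := hne c hc.ne
        have hdv := hne d hd.ne'
        dsimp only [LinearMap.comp_apply] at hc hd
        rw [starMap_single_of_ne p hcv] at hc
        rw [starMap_single_of_ne p hdv] at hd
        have hcd' := hK₁.face_iff.1 hcd
        rw [unstar, if_neg (by simp [hcv.symm, hdv.symm])] at hcd'
        refine ⟨⟨hc, hd, hcd'.2⟩, ?_⟩
        rintro ⟨rfl, rfl⟩
        exact hcd'.1 subset_rfl
      have hlt : (bad K₁ (h ∘ₗ starMap p v)).ncard < n := by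
        rw [← hn]
        refine Set.ncard_lt_ncard ?_ (hfin K h hK)
        refine ⟨hsub.trans Set.sdiff_subset, fun h' => ?_⟩
        exact (hsub (h' (show (a, b) ∈ bad K h from ⟨ha, hb, hab⟩))).2 rfl
      obtain ⟨K', F, h1, h2, h3⟩ := ih _ hlt (hK₁.isNPM hK) _ rfl
      exact ⟨K', starMap p v ∘ₗ F, h1, bijOn_comp (hK₁.bijOn hp0 hps) h2, h3⟩

theorem SignConstant.comp {h : (V →₀ ℝ) →ₗ[ℝ] ℝ} (hh : SignConstant h K)
    {F : (W →₀ ℝ) →ₗ[ℝ] (V →₀ ℝ)} (hF : Set.MapsTo F (cone L) (cone K)) :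
    SignConstant (h ∘ₗ F) L := by
  intro s hs
  have hx := indicatorVec_mem_cone hs
  have hsub : ∀ w ∈ s, (F (Finsupp.single w 1)).support ⊆ (F (indicatorVec s)).support :=
    fun w hw => support_map_single_subset hF hx (by rwa [support_indicatorVec])
  have hpos : ∀ w ∈ s, 0 ≤ F (Finsupp.single w 1) := fun w hw =>
    (hF (single_mem_cone (hs.mem_vertices hw) zero_le_one)).1
  refine (hh _ (hF hx).2).imp (fun h1 w hw => ?_) fun h1 w hw => ?_
  · rw [LinearMap.comp_apply, map_eq_sum h _ (hsub w hw)]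
    exact sum_nonneg fun v hv => smul_nonneg (hpos w hw v) (h1 v hv)
  · rw [LinearMap.comp_apply, map_eq_sum h _ (hsub w hw)]
    exact sum_nonpos fun v hv => smul_nonpos_of_nonneg_of_nonpos (hpos w hw v) (h1 v hv)

theorem exists_signConstant_list [Infinite V] {k : ℕ} (hK : IsNPM k K)
    (l : List ((V →₀ ℝ) →ₗ[ℝ] ℝ)) :
    ∃ (K' : PreAbstractSimplicialComplex V) (F : (V →₀ ℝ) →ₗ[ℝ] (V →₀ ℝ)), IsNPM k K' ∧
      Set.BijOn F (cone K') (cone K) ∧ ∀ h ∈ l, SignConstant (h ∘ₗ F) K' := by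
  induction l with
  | nil => exact ⟨K, LinearMap.id, hK, Set.bijOn_id _, by simp⟩
  | cons h l ih =>
    obtain ⟨K₁, F₁, h1, h2, h3⟩ := ih
    obtain ⟨K₂, F₂, h4, h5, h6⟩ := exists_signConstant h1 (h ∘ₗ F₁)
    refine ⟨K₂, F₁ ∘ₗ F₂, h4, bijOn_comp h2 h5, ?_⟩
    intro g hg
    rcases List.mem_cons.1 hg with rfl | hg
    · exact h6
    · exact (h3 g hg).comp h5.mapsTo

/-- A subdivision and a starring of the same complex have a common subdivision. -/
theorem StarringAt.exists_common_subdivision [Infinite W] {k : ℕ} (hL : IsNPM k L)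
    {F : (W →₀ ℝ) →ₗ[ℝ] (V →₀ ℝ)} (hF : Set.BijOn F (cone L) (cone K)) {σ : Finset V} {v : V}
    (hK : StarringAt K K' σ v) {p : V →₀ ℝ} (hp : 0 ≤ p) (hpσ : p.support = σ) :
    ∃ (L' : PreAbstractSimplicialComplex W) (Φ : (W →₀ ℝ) →ₗ[ℝ] (W →₀ ℝ))
      (E : (W →₀ ℝ) →ₗ[ℝ] (V →₀ ℝ)), IsNPM k L' ∧ Set.BijOn Φ (cone L') (cone L) ∧
      Set.BijOn E (cone L') (cone K') ∧ ∀ x ∈ cone L', starMap p v (E x) = F (Φ x) := by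
  have hG := hK.bijOn hp hpσ
  have hppos : ∀ w ∈ σ, 0 < p w := fun w hw =>
    (hp w).lt_of_ne' (Finsupp.mem_support_iff.1 (hpσ ▸ hw))
  have hne : ∀ w ∈ σ, w ≠ v := fun w hw e => hK.notMem_center (e ▸ hw)
  let hfun : V × V → ((W →₀ ℝ) →ₗ[ℝ] ℝ) := fun q =>
    (p q.2 • Finsupp.lapply q.1 - p q.1 • Finsupp.lapply q.2) ∘ₗ F
  have hfun_apply : ∀ a b z, hfun (a, b) z = p b * F z a - p a * F z b := fun a b z => rfl
  obtain ⟨L', Φ, h1, h2, h3⟩ := exists_signConstant_list hL ((σ ×ˢ σ).toList.map hfun)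
  have hsign : ∀ a ∈ σ, ∀ b ∈ σ, SignConstant (hfun (a, b) ∘ₗ Φ) L' := fun a ha b hb =>
    h3 _ (List.mem_map.2 ⟨(a, b), by simp [ha, hb], rfl⟩)
  have hFΦ := bijOn_comp hF h2
  have hg : ∀ w ∈ vertices L', ∃ g ∈ cone K', starMap p v g = F (Φ (Finsupp.single w 1)) :=
    fun w hw => hG.surjOn (hFΦ.mapsTo (single_mem_cone hw zero_le_one))
  choose! g hgK hg using hg
  let E : (W →₀ ℝ) →ₗ[ℝ] (V →₀ ℝ) := Finsupp.linearCombination ℝ g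
  have hE1 : ∀ w, E (Finsupp.single w 1) = g w := fun w => by simp [E]
  have hEsum : ∀ x : W →₀ ℝ, E x = ∑ w ∈ x.support, x w • g w := by
    intro x
    rw [map_eq_sum E x subset_rfl]
    exact sum_congr rfl fun w _ => by rw [hE1]
  have hcomm : ∀ x ∈ cone L', starMap p v (E x) = F (Φ x) := by
    intro x hx
    have := map_eq_sum (F ∘ₗ Φ) x subset_rfl
    rw [LinearMap.comp_apply] at this
    rw [this, hEsum, map_sum]
    refine sum_congr rfl fun w hw => ?_
    rw [map_smul, hg w (hx.2.mem_vertices hw), LinearMap.comp_apply]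
  have hmaps : Set.MapsTo E (cone L') (cone K') := by
    intro x hx
    have hE0 : 0 ≤ E x := by
      rw [hEsum]
      exact sum_nonneg fun w hw => smul_nonneg (hx.1 w) (hgK w (hx.2.mem_vertices hw)).1
    refine ⟨hE0, hK.face_iff.2 ⟨?_, ?_⟩⟩
    · obtain ⟨w₀, hw₀, hmin⟩ := exists_min_image σ (fun w => F (Φ x) w / p w)
        (nonempty_of_mem hK.mem)
      have hle : ∀ a ∈ x.support, ∀ w ∈ σ, hfun (w₀, w) (Φ (Finsupp.single a 1)) ≤ 0 := by
        intro a ha w hw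
        have hx0 : hfun (w₀, w) (Φ x) ≤ 0 := by
          rw [hfun_apply]
          have := hmin w hw
          rw [div_le_div_iff₀ (hppos _ hw₀) (hppos _ hw)] at this
          linarith
        rcases hsign w₀ hw₀ w hw _ hx.2 with h4 | h4
        · have h5 := map_eq_sum (hfun (w₀, w) ∘ₗ Φ) x subset_rfl
          rw [LinearMap.comp_apply] at h5
          rw [h5] at hx0
          have h6 : ∀ b ∈ x.support, 0 ≤ x b • (hfun (w₀, w) ∘ₗ Φ) (Finsupp.single b 1) :=
            fun b hb => smul_nonneg (hx.1 b) (h4 b hb)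
          have h7 := (sum_eq_zero_iff_of_nonneg h6).1 (le_antisymm hx0 (sum_nonneg h6)) a ha
          rw [smul_eq_mul] at h7
          exact ((mul_eq_zero.1 h7).resolve_left (Finsupp.mem_support_iff.1 ha)).le
        · exact h4 a ha
      intro hsub
      have hw₀E := hsub hw₀
      rw [Finsupp.mem_support_iff, hEsum, Finsupp.finsetSum_apply] at hw₀E
      apply hw₀E
      refine sum_eq_zero fun a ha => ?_
      have haL := hx.2.mem_vertices ha
      obtain ⟨w, hw, hwg⟩ := not_subset.1 (hK.face_iff.1 (hgK a haL).2).1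
      have h8 := hle a ha w hw
      rw [hfun_apply, ← hg a haL, starMap_apply_of_ne (hne w hw), starMap_apply_of_ne (hne _ hw₀),
        Finsupp.notMem_support_iff.1 hwg] at h8
      have h9 : 0 ≤ g a w₀ := (hgK a haL).1 w₀
      have h10 : p w * g a w₀ ≤ 0 := by linarith
      have h11 : g a w₀ ≤ 0 := nonpos_of_mul_nonpos_right h10 (hppos w hw)
      rw [Finsupp.smul_apply, le_antisymm h11 h9, smul_zero]
    · have hq := (hFΦ.mapsTo hx).2
      rw [LinearMap.comp_apply, ← hcomm x hx] at hq
      refine hq.mono ?_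
      have hnn : ∀ u, 0 ≤ E x u := fun u => hE0 u
      have herase : ∀ u, u ≠ v → u ∈ (E x).support → u ∈ (starMap p v (E x)).support := by
        intro u hu hux
        rw [Finsupp.mem_support_iff] at hux ⊢
        rw [starMap_apply_of_ne hu]
        have := (hnn u).lt_of_ne' hux
        have : 0 ≤ E x v * p u := mul_nonneg (hnn v) (hp u)
        linarith
      rw [unstar]
      split_ifs with hv
      · refine union_subset (fun u hu => ?_) fun u hu => ?_
        · rw [mem_erase] at hu
          exact herase u hu.1 hu.2
        · rw [Finsupp.mem_support_iff, starMap_apply_of_ne (hne u hu)]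
          have h1 := mul_pos ((hnn v).lt_of_ne' (Finsupp.mem_support_iff.1 hv)) (hppos u hu)
          have h2 := hnn u
          linarith
      · intro u hu
        exact herase u (fun e => hv (e ▸ hu)) hu
  refine ⟨L', Φ, E, h1, h2, ⟨hmaps, fun x hx y hy hxy => ?_, fun y hy => ?_⟩, hcomm⟩
  · refine hFΦ.injOn hx hy ?_
    rw [LinearMap.comp_apply, LinearMap.comp_apply, ← hcomm x hx, ← hcomm y hy, hxy]
  · obtain ⟨x, hx, hxy⟩ := hFΦ.surjOn (hG.mapsTo hy)
    refine ⟨x, hx, hG.injOn (hmaps hx) hy ?_⟩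
    rw [hcomm x hx]
    exact hxy

theorem exists_common_subdivision_of_reflTransGen [Infinite W] {k : ℕ} (hL : IsNPM k L)
    {F : (W →₀ ℝ) →ₗ[ℝ] (V →₀ ℝ)} (hF : Set.BijOn F (cone L) (cone K))
    (h : Relation.ReflTransGen IsStarring K K') :
    ∃ (L' : PreAbstractSimplicialComplex W) (Φ : (W →₀ ℝ) →ₗ[ℝ] (W →₀ ℝ))
      (E : (W →₀ ℝ) →ₗ[ℝ] (V →₀ ℝ)), IsNPM k L' ∧ Set.BijOn Φ (cone L') (cone L) ∧
      Set.BijOn E (cone L') (cone K') := by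
  induction h with
  | refl => exact ⟨L, LinearMap.id, F, hL, Set.bijOn_id _, hF⟩
  | tail _ h ih =>
    obtain ⟨L₁, Φ₁, E₁, h1, h2, h3⟩ := ih
    obtain ⟨σ, v, hσ⟩ := h.exists_starringAt
    obtain ⟨L₂, Φ₂, E₂, h4, h5, h6, -⟩ := hσ.exists_common_subdivision h1 h3
      (indicatorVec_nonneg σ) (support_indicatorVec σ)
    exact ⟨L₂, Φ₁ ∘ₗ Φ₂, E₂, h4, bijOn_comp h2 h5, h6⟩

theorem exists_bijOn_of_reflTransGen (h : Relation.ReflTransGen IsStarring K K') :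
    ∃ F : (V →₀ ℝ) →ₗ[ℝ] (V →₀ ℝ), Set.BijOn F (cone K') (cone K) := by
  induction h with
  | refl => exact ⟨LinearMap.id, Set.bijOn_id _⟩
  | tail _ h ih =>
    obtain ⟨F, hF⟩ := ih
    obtain ⟨σ, v, hσ⟩ := h.exists_starringAt
    exact ⟨_, bijOn_comp hF (hσ.bijOn (indicatorVec_nonneg σ) (support_indicatorVec σ))⟩

end

end CellPM

namespace CellPM

noncomputable section

open Classical Finset

variable {V W U : Type*} {K K' : PreAbstractSimplicialComplex V} {L : PreAbstractSimplicialComplex W}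

/-- The boundary complex of the simplex with vertex set `T`. -/
def simplexBoundary (T : Finset V) : PreAbstractSimplicialComplex V where
  faces := {s | s.Nonempty ∧ s ⊂ T}
  isRelLowerSet_faces := by
    rintro s ⟨hs, hsT⟩
    exact ⟨hs, fun t hts ht => ⟨ht, lt_of_le_of_lt hts hsT⟩⟩

theorem face_simplexBoundary {T : Finset V} (hT : T.Nonempty) {s : Finset V} :
    Face (simplexBoundary T) s ↔ s ⊂ T := by
  constructor
  · rintro (rfl | h)
    · exact empty_ssubset.2 hT
    · exact h.2
  · intro h
    rcases s.eq_empty_or_nonempty with rfl | hs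
    · exact face_empty
    · exact Or.inr ⟨hs, h⟩

theorem face_standardSphere {k : ℕ} {s : Finset (Fin (k + 1))} :
    Face (standardSphere k) s ↔ s ≠ univ := by
  constructor
  · rintro (rfl | h)
    · exact univ_nonempty.ne_empty.symm
    · exact h.2
  · intro h
    rcases s.eq_empty_or_nonempty with rfl | hs
    · exact face_empty
    · exact Or.inr ⟨hs, h⟩

theorem exists_isoVia_simplexBoundary {k : ℕ} {T : Finset V} (hT : T.card = k + 1) :
    ∃ f : Fin (k + 1) → V, IsoVia f (standardSphere k) (simplexBoundary T) := by
  let e : Fin (k + 1) ≃ T := (T.equivFinOfCardEq hT).symm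
  have hinj : Function.Injective fun i => (e i : V) := Subtype.val_injective.comp e.injective
  have hsurj : ∀ x ∈ T, ∃ i, (e i : V) = x := fun x hx => ⟨e.symm ⟨x, hx⟩, by simp⟩
  have himg : (univ : Finset (Fin (k + 1))).image (fun i => (e i : V)) = T := by
    ext x
    simp only [mem_image, mem_univ, true_and]
    exact ⟨fun ⟨i, hi⟩ => hi ▸ (e i).2, hsurj x⟩
  refine ⟨fun i => e i, hinj.injOn, fun t => ?_⟩
  rw [face_simplexBoundary (card_pos.1 (by omega))]
  constructor
  · intro ht
    refine ⟨univ.filter fun i => (e i : V) ∈ t, face_standardSphere.2 fun h => ?_, ?_⟩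
    · obtain ⟨x, hx, hxt⟩ := not_subset.1 ht.2
      obtain ⟨i, rfl⟩ := hsurj x hx
      have : i ∈ univ.filter fun i => (e i : V) ∈ t := by rw [h]; simp
      exact hxt (by simpa using this)
    · ext x
      simp only [mem_image, mem_filter, mem_univ, true_and]
      constructor
      · rintro ⟨i, hi, rfl⟩
        exact hi
      · intro hx
        obtain ⟨i, rfl⟩ := hsurj x (ht.1 hx)
        exact ⟨i, hx, rfl⟩
  · rintro ⟨s, hs, rfl⟩
    rw [face_standardSphere] at hs
    exact ((image_ssubset_image hinj).2 (ssubset_univ_iff.2 hs)).trans_eq himg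

/-- The join of the boundaries of two simplices subdivides a standard sphere. -/
theorem exists_bijOn_standardSphere {k : ℕ} {T σ τ : Finset V} (hσ : σ.Nonempty) (hτ : τ.Nonempty)
    (hdisj : Disjoint σ τ) (hT : ∀ x, x ∈ T ↔ x ∈ σ ∨ x ∈ τ) (hcard : T.card = k + 2)
    (hK : ∀ s, Face K s ↔ s ⊆ T ∧ ¬ σ ⊆ s ∧ ¬ τ ⊆ s) :
    ∃ F : (V →₀ ℝ) →ₗ[ℝ] (Fin (k + 1) →₀ ℝ),
      Set.BijOn F (cone K) (cone (standardSphere k)) := by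
  obtain rfl : T = σ ∪ τ := by
    ext x
    rw [hT, mem_union]
  obtain ⟨b, hb⟩ := hτ
  have hbσ : b ∉ σ := fun h => (disjoint_left.1 hdisj h hb)
  set T := (σ ∪ τ).erase b with hT
  have hσT : σ ⊆ T := fun x hx => mem_erase.2 ⟨fun e => hbσ (e ▸ hx), mem_union_left _ hx⟩
  have hTne : T.Nonempty := hσ.mono hσT
  have hTcard : T.card = k + 1 := by
    rw [hT, card_erase_of_mem (mem_union_right _ hb), hcard]
    omega
  obtain ⟨f, hf⟩ := exists_isoVia_simplexBoundary hTcard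
  have h2 := hf.symm.bijOn_cone
  refine ⟨_, bijOn_comp h2 (starMap_bijOn (p := indicatorVec σ) (v := b) (indicatorVec_nonneg σ)
    ?_ ?_ ?_ fun s => ?_)⟩
  · rwa [support_indicatorVec]
  · rwa [support_indicatorVec]
  · intro h
    have := (face_simplexBoundary hTne).1 (face_singleton.2 h)
    have := this.1 (mem_singleton_self b)
    simp [hT] at this
  · rw [support_indicatorVec, face_simplexBoundary hTne, hK]
    by_cases hbs : b ∈ s
    · rw [unstar, if_pos hbs]
      constructor
      · rintro ⟨h3, h4, h5⟩
        refine ⟨h4, union_subset (erase_subset_erase _ h3) hσT, fun h6 => h5 fun x hx => ?_⟩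
        by_cases hxb : x = b
        · exact hxb ▸ hbs
        · have := h6 (mem_erase.2 ⟨hxb, mem_union_right _ hx⟩)
          rcases mem_union.1 this with h | h
          · exact (mem_erase.1 h).2
          · exact absurd hx (disjoint_left.1 hdisj h)
      · rintro ⟨h4, h5⟩
        refine ⟨fun x hx => ?_, h4, fun h6 => h5.2 fun x hx => ?_⟩
        · by_cases hxb : x = b
          · exact hxb ▸ mem_union_right _ hb
          · exact (mem_erase.1 (h5.1 (mem_union_left _ (mem_erase.2 ⟨hxb, hx⟩)))).2
        · rw [hT, mem_erase, mem_union] at hx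
          rcases hx.2 with h | h
          · exact mem_union_right _ h
          · exact mem_union_left _ (mem_erase.2 ⟨hx.1, h6 h⟩)
    · rw [unstar, if_neg hbs]
      constructor
      · rintro ⟨h3, h4, h5⟩
        exact ⟨h4, fun x hx => mem_erase.2 ⟨fun e => hbs (e ▸ hx), h3 hx⟩,
          fun h => h4 (hσT.trans h)⟩
      · rintro ⟨h4, h5⟩
        exact ⟨h5.1.trans (erase_subset _ _), h4, fun h => hbs (h hb)⟩

theorem StarringAt.mem_vertices {σ : Finset V} {v : V} (h : StarringAt K K' σ v) :
    v ∈ vertices K' := by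
  rw [← face_singleton, h.face_iff]
  refine ⟨fun hsub => ?_, ?_⟩
  · obtain ⟨x, hx⟩ := nonempty_of_mem h.mem
    have := hsub hx
    rw [mem_singleton] at this
    exact h.notMem_center (this ▸ hx)
  · rw [unstar, if_pos (mem_singleton_self _)]
    have : Face K σ := Or.inr h.mem
    simpa using this

theorem StarringAt.exists_bijOn_link {k : ℕ} {T σ : Finset V} {v : V} (hT : T.card = k + 2)
    (h : StarringAt (simplexBoundary T) K σ v) :
    ∃ F : (V →₀ ℝ) →ₗ[ℝ] (Fin (k + 1) →₀ ℝ),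
      Set.BijOn F (cone (link K v)) (cone (standardSphere k)) := by
  have hTne : T.Nonempty := card_pos.1 (by omega)
  have hσT : σ ⊂ T := (face_simplexBoundary hTne).1 (Or.inr h.mem)
  have hvT : v ∉ T := by
    intro hv
    refine h.notMem (face_singleton.1 ((face_simplexBoundary hTne).2 ?_))
    refine ssubset_of_subset_of_ne (singleton_subset_iff.2 hv) ?_
    rintro rfl
    simp at hT
  have hunion : σ ∪ (T \ σ) = T := union_sdiff_of_subset hσT.1
  refine exists_bijOn_standardSphere (nonempty_of_mem h.mem) (sdiff_nonempty.2 hσT.2)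
    disjoint_sdiff (T := T) (fun x => by rw [← mem_union, hunion]) hT fun s => ?_
  rw [face_link h.mem_vertices, h.face_iff, unstar, if_pos (mem_insert_self _ _),
    subset_insert_iff_of_notMem h.notMem_center, face_simplexBoundary hTne]
  constructor
  · rintro ⟨h5, h6, h7⟩
    rw [erase_insert h5] at h7
    refine ⟨subset_union_left.trans h7.1, h6, fun h8 => h7.2 ?_⟩
    rw [← hunion, union_comm]
    exact union_subset_union h8 subset_rfl
  · rintro ⟨h5, h6, h7⟩
    have h8 : v ∉ s := fun h => hvT (h5 h)
    rw [erase_insert h8]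
    refine ⟨h8, h6, union_subset h5 hσT.1, fun h9 => h7 fun x hx => ?_⟩
    rw [mem_sdiff] at hx
    exact (mem_union.1 (h9 hx.1)).resolve_right hx.2

theorem isCombinatorialSphere_iff {k : ℕ} :
    IsCombinatorialSphere k K ↔ IsNPM k K ∧ ∃ (J : PreAbstractSimplicialComplex ℕ) (j : ℕ)
      (F : (ℕ →₀ ℝ) →ₗ[ℝ] (V →₀ ℝ)) (G : (ℕ →₀ ℝ) →ₗ[ℝ] (Fin (k + 1) →₀ ℝ)), IsNPM j J ∧
        Set.BijOn F (cone J) (cone K) ∧ Set.BijOn G (cone J) (cone (standardSphere k)) := by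
  rw [IsCombinatorialSphere, isNormalPseudomanifold_iff, combinatoriallyEquivalent_iff]

theorem IsoVia.isCombinatorialSphere {f : V → W} (h : IsoVia f K L) {k : ℕ}
    (hK : IsCombinatorialSphere k K) : IsCombinatorialSphere k L := by
  rw [isCombinatorialSphere_iff] at hK ⊢
  obtain ⟨h1, J, j, F, G, hJ, hF, hG⟩ := hK
  exact ⟨h.isNPM h1, J, j, _, G, hJ, bijOn_comp h.bijOn_cone hF, hG⟩

theorem IsNPM.exists_link {k : ℕ} (h : IsNPM k K) {v : V} (hv : v ∈ vertices K) :
    ∃ j, IsNPM j (CellPM.link K v) := by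
  have := h.card_le _ (face_singleton.2 hv)
  rw [card_singleton] at this
  obtain ⟨j, rfl⟩ : ∃ j, k = j + 1 := ⟨k - 1, by omega⟩
  exact ⟨j, h.link hv⟩

theorem IsCombinatorialSphere.link {k : ℕ} (hK : IsCombinatorialSphere (k + 1) K) {v : V}
    (hv : v ∈ vertices K) : IsCombinatorialSphere k (link K v) := by
  rw [isCombinatorialSphere_iff] at hK ⊢
  obtain ⟨h1, J, j, F, G₀, hJ, hF, hG₀⟩ := hK
  refine ⟨h1.link hv, ?_⟩
  set T := range (k + 2) with hT
  have hTne : T.Nonempty := ⟨0, by simp [hT]⟩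
  obtain ⟨f, hf⟩ := exists_isoVia_simplexBoundary (T := T) (k := k + 1) (by simp [hT])
  have hG := bijOn_comp hf.bijOn_cone hG₀
  set G := Finsupp.lmapDomain ℝ ℝ f ∘ₗ G₀
  obtain ⟨w, hw, c, hc, hFw⟩ := exists_vertex_over hF hv
  set p := G (Finsupp.single w 1) with hp
  have hpc : p ∈ cone (simplexBoundary T) := hG.mapsTo (single_mem_cone hw zero_le_one)
  have hσne : p.support.Nonempty := Finsupp.support_nonempty_iff.2 (map_single_ne_zero hG hw)
  have hσ := hpc.2.mem hσne
  have hσT := (face_simplexBoundary hTne).1 hpc.2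
  have huT : k + 2 ∉ T := by simp [hT]
  have hu : k + 2 ∉ vertices (simplexBoundary T) := fun h =>
    huT (((face_simplexBoundary hTne).1 (face_singleton.2 h)).1 (mem_singleton_self _))
  obtain ⟨S, hS⟩ := exists_starringAt hσ hu
  have huS := hS.mem_vertices
  obtain ⟨J', Φ, E, hJ', hΦ, hE, hcomm⟩ := hS.exists_common_subdivision hJ hG hpc.1 rfl
  obtain ⟨w', hw', c', hc', hΦw⟩ := exists_vertex_over hΦ hw
  have hEw : E (Finsupp.single w' 1) = Finsupp.single (k + 2) c' := by
    refine (hS.bijOn hpc.1 rfl).injOn (hE.mapsTo (single_mem_cone hw' zero_le_one))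
      (single_mem_cone huS hc'.le) ?_
    rw [hcomm _ (single_mem_cone hw' zero_le_one), hΦw, ← smul_single_one (k + 2),
      ← smul_single_one w, map_smul, map_smul, starMap_single_self]
  have hFw' : (F ∘ₗ Φ) (Finsupp.single w' 1) = Finsupp.single v (c' * c) := by
    rw [LinearMap.comp_apply, hΦw, ← smul_single_one, map_smul, hFw, Finsupp.smul_single,
      smul_eq_mul]
  have h3 := link_bijOn (bijOn_comp hF hΦ) hJ'.finite hw' hv (mul_pos hc' hc) hFw'
  have h4 := link_bijOn hE hJ'.finite hw' huS hc' hEw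
  obtain ⟨j', hj'⟩ := hJ'.exists_link hw'
  obtain ⟨H, hH⟩ := hS.exists_bijOn_link (k := k) (by simp [hT])
  exact ⟨_, j', _, _, hj', h3, bijOn_comp hH h4⟩

theorem isoVia_map {f : V → W} (hf : Set.InjOn f (vertices K)) : IsoVia f K (K.map f) := by
  refine ⟨hf, fun t => ?_⟩
  constructor
  · rintro (rfl | ⟨s, hs, rfl⟩)
    · exact ⟨∅, face_empty, by simp⟩
    · exact ⟨s, Or.inr hs, rfl⟩
  · rintro ⟨s, rfl | hs, rfl⟩
    · exact Or.inl (by simp)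
    · exact Or.inr ⟨s, hs, rfl⟩

theorem exists_subdivision_join {m n : ℕ} (hK : IsCombinatorialSphere (m + 1) K)
    (hL : IsCombinatorialSphere (n + 1) L) :
    ∃ (J : PreAbstractSimplicialComplex ℕ) (j : ℕ) (F : (ℕ →₀ ℝ) →ₗ[ℝ] (V ⊕ W →₀ ℝ))
      (G : (ℕ →₀ ℝ) →ₗ[ℝ] (Fin (m + n + 2 + 1) →₀ ℝ)), IsNPM j J ∧
      Set.BijOn F (cone J) (cone (joinComplex K L)) ∧
      Set.BijOn G (cone J) (cone (standardSphere (m + n + 2))) := by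
  rw [isCombinatorialSphere_iff] at hK hL
  obtain ⟨-, J₁, j₁, F₁, G₁, hJ₁, hF₁, hG₁⟩ := hK
  obtain ⟨-, J₂, j₂, F₂, G₂, hJ₂, hF₂, hG₂⟩ := hL
  obtain ⟨F, hF⟩ := exists_bijOn_join hF₁ hF₂
  obtain ⟨G, hG⟩ := exists_bijOn_join hG₁ hG₂
  obtain ⟨f, hf⟩ := exists_injective_nat (ℕ ⊕ ℕ)
  have hJ := isoVia_map (K := joinComplex J₁ J₂) hf.injOn
  have hsymm := hJ.symm.bijOn_cone
  have hl : ∀ s : Finset (Fin (m + 1 + 1) ⊕ Fin (n + 1 + 1)),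
      (univ.map Function.Embedding.inl ⊆ s ↔ s.toLeft = univ) ∧
      (univ.map Function.Embedding.inr ⊆ s ↔ s.toRight = univ) := by
    intro s
    rw [map_inl_subset_iff_subset_toLeft, map_inr_subset_iff_subset_toRight, univ_subset_iff,
      univ_subset_iff]
    exact ⟨Iff.rfl, Iff.rfl⟩
  obtain ⟨H, hH⟩ := exists_bijOn_standardSphere (k := m + n + 2)
    (K := joinComplex (standardSphere (m + 1)) (standardSphere (n + 1)))
    (σ := univ.map Function.Embedding.inl) (τ := univ.map Function.Embedding.inr)
    (T := univ) (by simp) (by simp) (disjoint_map_inl_map_inr _ _) (by simp)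
    (by simp; omega) fun s => by
      rw [face_joinComplex, face_standardSphere, face_standardSphere, (hl s).1, (hl s).2]
      simp
  exact ⟨_, _, _, _, hJ.isNPM (hJ₁.join hJ₂), bijOn_comp hF hsymm,
    bijOn_comp hH (bijOn_comp hG hsymm)⟩

theorem IsStellarSubdivision.exists_bijOn [Nonempty V] (h : IsStellarSubdivision L K) :
    ∃ F : (W →₀ ℝ) →ₗ[ℝ] (V →₀ ℝ), Set.BijOn F (cone L) (cone K) := by
  obtain ⟨L₀, L₁, h1, h2, h3⟩ := h
  obtain ⟨F, hF⟩ := exists_bijOn_of_reflTransGen h2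
  obtain ⟨f, hf⟩ := exists_isoVia_of_isIsomorphic h1
  by_cases hW : Nonempty W
  · obtain ⟨g, hg⟩ := exists_isoVia_of_isIsomorphic h3
    exact ⟨_, bijOn_comp hf.bijOn_cone (bijOn_comp hF hg.symm.bijOn_cone)⟩
  · rw [not_nonempty_iff] at hW
    have h0 : ∀ (x : W →₀ ℝ), x = 0 := fun x => Subsingleton.elim _ _
    have hv : vertices L₁ = ∅ := by
      obtain ⟨e, -⟩ := h3
      by_contra hne
      obtain ⟨x, hx⟩ := Set.nonempty_iff_ne_empty.2 hne
      exact hW.elim (e ⟨x, hx⟩ : W)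
    have h4 : cone L₁ = {0} := by
      refine Set.eq_singleton_iff_unique_mem.2 ⟨zero_mem_cone, fun x hx => ?_⟩
      ext v
      by_contra hxv
      have := hx.2.mem_vertices (Finsupp.mem_support_iff.2 hxv)
      rw [hv] at this
      exact this
    have h5 : cone L = {0} :=
      Set.eq_singleton_iff_unique_mem.2 ⟨zero_mem_cone, fun x _ => h0 x⟩
    have h6 := (bijOn_comp hf.bijOn_cone hF).image_eq
    rw [h4, Set.image_singleton, map_zero] at h6
    refine ⟨0, ?_⟩
    rw [h5, ← h6]
    simp

theorem IsStellarSubdivision.exists_common_subdivision [Nonempty W] (h : IsStellarSubdivision L K)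
    {J : PreAbstractSimplicialComplex ℕ} {j : ℕ} (hJ : IsNPM j J)
    {F : (ℕ →₀ ℝ) →ₗ[ℝ] (V →₀ ℝ)} (hF : Set.BijOn F (cone J) (cone K)) [Nonempty V] :
    ∃ (J' : PreAbstractSimplicialComplex ℕ) (Φ : (ℕ →₀ ℝ) →ₗ[ℝ] (ℕ →₀ ℝ))
      (E : (ℕ →₀ ℝ) →ₗ[ℝ] (W →₀ ℝ)), IsNPM j J' ∧ Set.BijOn Φ (cone J') (cone J) ∧
      Set.BijOn E (cone J') (cone L) := by
  obtain ⟨L₀, L₁, h1, h2, h3⟩ := h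
  obtain ⟨f, hf⟩ := exists_isoVia_of_isIsomorphic h1
  obtain ⟨g, hg⟩ := exists_isoVia_of_isIsomorphic h3
  obtain ⟨J', Φ, E, h4, h5, h6⟩ := exists_common_subdivision_of_reflTransGen hJ
    (bijOn_comp hf.symm.bijOn_cone hF) h2
  exact ⟨J', Φ, _, h4, h5, bijOn_comp hg.bijOn_cone h6⟩

end

end CellPM

namespace CellPM

noncomputable section

open Classical Finset

variable {X : Type*} [Lattice X]

section Rank

variable [Finite X] {ρ : X → ℕ} (hcov : ∀ a b, a ⋖ b → ρ b = ρ a + 1)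
include hcov

theorem rank_strictMono : StrictMono ρ := by
  intro a b hab
  induction a using WellFoundedGT.induction with
  | _ a ih =>
    obtain ⟨c, hac, hcb⟩ := exists_covBy_le_of_lt hab
    have h1 := hcov a c hac
    rcases hcb.lt_or_eq with h | rfl
    · have := ih c hac.lt h
      omega
    · omega

theorem exists_rank_eq {a b : X} (hab : a ≤ b) {r : ℕ} (har : ρ a ≤ r) (hrb : r ≤ ρ b) :
    ∃ y, a ≤ y ∧ y ≤ b ∧ ρ y = r := by
  induction r, har using Nat.le_induction with
  | base => exact ⟨a, le_rfl, hab, rfl⟩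
  | succ r hr ih =>
    obtain ⟨y, h1, h2, h3⟩ := ih (by omega)
    have hlt : y < b := h2.lt_of_ne (by rintro rfl; omega)
    obtain ⟨c, hyc, hcb⟩ := exists_covBy_le_of_lt hlt
    exact ⟨c, h1.trans hyc.le, hcb, by rw [hcov y c hyc, h3]⟩

theorem exists_rank_between {a b : X} (hab : a ≤ b) {r : ℕ} (har : ρ a < r) (hrb : r < ρ b) :
    ∃ y, a < y ∧ y < b ∧ ρ y = r := by
  obtain ⟨y, h1, h2, h3⟩ := exists_rank_eq hcov hab har.le hrb.le
  exact ⟨y, h1.lt_of_ne (by rintro rfl; omega), h2.lt_of_ne (by rintro rfl; omega), h3⟩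

end Rank

theorem intervalGraph_preconnected {ρ : X → ℕ} (hρ : StrictMono ρ) {x z : X}
    (h : ρ z = ρ x + 2) : (intervalGraph ρ x z).Preconnected := by
  rintro ⟨a, ha⟩ ⟨b, hb⟩
  by_cases hab : a = b
  · subst hab; exact SimpleGraph.Reachable.refl _
  · refine SimpleGraph.Adj.reachable ⟨by simpa using hab, ?_⟩
    have h1 : x ≤ a ⊓ b := le_inf ha.1 hb.1
    have h2 : ρ x ≤ ρ (a ⊓ b) := hρ.monotone h1
    have h3 : a ⊓ b < a := by
      refine inf_le_left.lt_of_ne fun e => hab ?_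
      have hle : a ≤ b := inf_eq_left.1 e
      by_contra hne
      have := hρ (hle.lt_of_ne hne)
      omega
    have h4 := hρ h3
    simp only
    omega

variable [BoundedOrder X]

/-- A cellular pseudomanifold with rank function `ρ`, the rank function being described by covering
pairs. -/
structure IsCellular (ρ : X → ℕ) (k : ℕ) : Prop where
  finite : Finite X
  bot : ρ ⊥ = 0
  covBy : ∀ a b, a ⋖ b → ρ b = ρ a + 1
  top : ρ ⊤ = k + 1
  two : ∀ x z : X, x < z → ρ z = ρ x + 2 → {y : X | x < y ∧ y < z}.ncard = 2
  preconnected : ∀ x z : X, x < z → ρ x + 2 ≤ ρ z → (intervalGraph ρ x z).Preconnected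

theorem rank_eq_of_relSeries {ρ : X → ℕ} (hbot : ρ ⊥ = 0) (hcov : ∀ a b, a ⋖ b → ρ b = ρ a + 1) :
    IsRankFunction ρ := by
  intro c hc
  have : ∀ i : ℕ, ∀ hi : i < c.length + 1, ρ (c ⟨i, hi⟩) = i := by
    intro i
    induction i with
    | zero =>
      intro hi
      exact (congrArg ρ hc).trans hbot
    | succ i ih =>
      intro hi
      exact (hcov _ _ (c.step ⟨i, by omega⟩)).trans (congrArg (· + 1) (ih (by omega)))
  exact (this c.length (by omega)).symm

theorem exists_relSeries [Finite X] (a : X) :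
    ∃ c : RelSeries {(a, b) : X × X | a ⋖ b}, c.head = ⊥ ∧ c.last = a := by
  induction a using WellFoundedLT.induction with
  | _ a ih =>
    rcases eq_or_ne a ⊥ with rfl | ha
    · exact ⟨RelSeries.singleton _ ⊥, rfl, rfl⟩
    · obtain ⟨b, -, hb⟩ := exists_le_covBy_of_lt (bot_lt_iff_ne_bot.2 ha)
      obtain ⟨c, h1, h2⟩ := ih b hb.lt
      exact ⟨c.snoc a (by rw [h2]; exact hb), by rw [RelSeries.head_snoc, h1],
        RelSeries.last_snoc _ _ _⟩

theorem isCellularPseudomanifold_iff {k : ℕ} :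
    IsCellularPseudomanifold X k ↔ ∃ ρ : X → ℕ, IsCellular ρ k := by
  constructor
  · rintro ⟨hfin, ρ, h1, h2, h3, h4⟩
    have hbot : ρ ⊥ = 0 := (h1 (RelSeries.singleton _ ⊥) rfl).symm
    have hcov : ∀ a b, a ⋖ b → ρ b = ρ a + 1 := by
      intro a b hab
      obtain ⟨c, hc1, hc2⟩ := exists_relSeries a
      have e1 := h1 c hc1
      have e2 := h1 (c.snoc b (by rw [hc2]; exact hab)) (by rw [RelSeries.head_snoc, hc1])
      rw [RelSeries.last_snoc, RelSeries.snoc_length, e1, hc2] at e2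
      exact e2.symm
    refine ⟨ρ, hfin, hbot, hcov, h2, h3, fun x z hxz hle => ?_⟩
    rcases hle.lt_or_eq with h | h
    · exact (h4 x z hxz h).preconnected
    · exact intervalGraph_preconnected (rank_strictMono hcov) h.symm
  · rintro ⟨ρ, h⟩
    have hfin := h.finite
    refine ⟨h.finite, ρ, rank_eq_of_relSeries h.bot h.covBy, h.top, h.two, fun x z hxz hlt => ?_⟩
    have hne : Nonempty {y : X // x ≤ y ∧ y ≤ z ∧ ρ y + 1 = ρ z} := by
      obtain ⟨y, h1, h2, h3⟩ := exists_rank_eq h.covBy hxz.le (r := ρ z - 1) (by omega) (by omega)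
      exact ⟨y, h1, h2, by omega⟩
    exact ⟨h.preconnected x z hxz hlt.le⟩

/-- The proper elements of a bounded lattice, i.e. the vertices of the barycentric subdivision. -/
abbrev Proper (X : Type*) [Lattice X] [BoundedOrder X] := {x : X // x ≠ ⊥ ∧ x ≠ ⊤}

/-- Equality of proper elements is decided classically. -/
@[reducible]
def Proper.decidableEq : DecidableEq (Proper X) := fun a b => Classical.propDecidable (a = b)

attribute [local instance 2000] Proper.decidableEq

theorem face_barycentric {s : Finset (Proper X)} :
    Face (barycentric X) s ↔ IsChain (· ≤ ·) (s : Set (Proper X)) := by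
  constructor
  · rintro (rfl | h)
    · simp
    · exact h.2
  · intro h
    rcases s.eq_empty_or_nonempty with rfl | hs
    · exact face_empty
    · exact Or.inr ⟨hs, h⟩

theorem isChain_insert {α : Type*} [PartialOrder α] {s : Finset α} {a : α}
    (hs : IsChain (· ≤ ·) (s : Set α)) (ha : ∀ b ∈ s, a ≤ b ∨ b ≤ a) :
    IsChain (· ≤ ·) ((insert a s : Finset α) : Set α) := by
  rw [coe_insert]
  exact hs.insert fun b hb _ => ha b hb

theorem isChain_mono {α : Type*} [PartialOrder α] {s t : Finset α}
    (hs : IsChain (· ≤ ·) (s : Set α)) (hts : t ⊆ s) : IsChain (· ≤ ·) (t : Set α) :=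
  hs.mono (by exact_mod_cast hts)

theorem exists_rank_notMem (ρ : X → ℕ) {k : ℕ} {s : Finset (Proper X)} (hk : s.card < k) :
    ∃ r, 1 ≤ r ∧ r ≤ k ∧ ∀ x ∈ s, ρ x ≠ r := by
  have hlt : (s.image (fun x : Proper X => ρ x)).card < (Icc 1 k).card := by
    have := card_image_le (s := s) (f := fun x : Proper X => ρ x)
    simp only [Nat.card_Icc]
    omega
  obtain ⟨r, hr, hrs⟩ := exists_mem_notMem_of_card_lt_card hlt
  rw [mem_Icc] at hr
  exact ⟨r, hr.1, hr.2, fun x hx e => hrs (mem_image.2 ⟨x, hx, e⟩)⟩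

theorem isChain_insert_of_gap {s : Finset (Proper X)} (hs : IsChain (· ≤ ·) (s : Set (Proper X)))
    {a b : X} (hgap : ∀ x ∈ s, (x : X) ≤ a ∨ b ≤ x) {y : Proper X} (hay : a ≤ y) (hyb : (y : X) ≤ b) :
    IsChain (· ≤ ·) ((insert y s : Finset (Proper X)) : Set (Proper X)) :=
  isChain_insert hs fun x hx => (hgap x hx).symm.imp (fun h => hyb.trans h) fun h => h.trans hay

namespace IsCellular

variable {ρ : X → ℕ} {k : ℕ} (h : IsCellular ρ k)
include h

theorem strictMono : StrictMono ρ := by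
  have := h.finite
  exact rank_strictMono h.covBy

theorem rank_pos (x : Proper X) : 0 < ρ x := by
  rw [← h.bot]
  exact h.strictMono (bot_lt_iff_ne_bot.2 x.2.1)

theorem rank_le (x : Proper X) : ρ x ≤ k := by
  have := h.strictMono (lt_top_iff_ne_top.2 x.2.2)
  rw [h.top] at this
  omega

theorem le_iff_of_chain {a b : X} (hab : a ≤ b ∨ b ≤ a) : a ≤ b ↔ ρ a ≤ ρ b := by
  refine ⟨fun h' => h.strictMono.monotone h', fun h' => hab.elim id fun hba => ?_⟩
  by_contra hne
  have := h.strictMono (hba.lt_of_ne fun e => hne e.ge)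
  omega

theorem rank_injOn {s : Finset (Proper X)} (hs : IsChain (· ≤ ·) (s : Set (Proper X))) :
    Set.InjOn (fun x : Proper X => ρ x) s := by
  intro a ha b hb hab
  have hcomp : (a : X) ≤ b ∨ (b : X) ≤ a := hs.total ha hb
  have h1 := (h.le_iff_of_chain hcomp).2 (le_of_eq hab)
  have h2 := (h.le_iff_of_chain hcomp.symm).2 (ge_of_eq hab)
  exact Subtype.ext (h1.antisymm h2)

theorem image_rank_subset (s : Finset (Proper X)) :
    s.image (fun x : Proper X => ρ x) ⊆ Icc 1 k := by
  intro r hr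
  obtain ⟨x, -, rfl⟩ := mem_image.1 hr
  exact mem_Icc.2 ⟨h.rank_pos x, h.rank_le x⟩

theorem card_chain_le {s : Finset (Proper X)} (hs : IsChain (· ≤ ·) (s : Set (Proper X))) :
    s.card ≤ k := by
  rw [← card_image_of_injOn (h.rank_injOn hs)]
  simpa using card_le_card (h.image_rank_subset s)

theorem exists_rank_mem {s : Finset (Proper X)} (hs : IsChain (· ≤ ·) (s : Set (Proper X)))
    (hk : s.card = k) {r : ℕ} (h1 : 1 ≤ r) (hr : r ≤ k) : ∃ x ∈ s, ρ x = r := by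
  have := eq_of_subset_of_card_le (h.image_rank_subset s)
    (by rw [card_image_of_injOn (h.rank_injOn hs)]; simp [hk])
  have hmem : r ∈ s.image (fun x : Proper X => ρ x) := by rw [this]; exact mem_Icc.2 ⟨h1, hr⟩
  exact mem_image.1 hmem

/-- The two elements of a chain (or bounds) enclosing a rank that is missing in the chain. -/
theorem exists_gap {s : Finset (Proper X)} (hs : IsChain (· ≤ ·) (s : Set (Proper X))) {r : ℕ}
    (h1 : 1 ≤ r) (hr : r ≤ k) (hrs : ∀ x ∈ s, ρ x ≠ r) :
    ∃ a b : X, a < b ∧ ρ a < r ∧ r < ρ b ∧ (∀ x ∈ s, (x : X) ≤ a ∨ b ≤ x) ∧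
      (a = ⊥ ∨ ∃ x ∈ s, (x : X) = a) ∧ (b = ⊤ ∨ ∃ x ∈ s, (x : X) = b) := by
  set s' : Finset X := insert ⊥ (insert ⊤ (s.image Subtype.val)) with hs'
  have hmem : ∀ x, x ∈ s' ↔ x = ⊥ ∨ x = ⊤ ∨ ∃ y ∈ s, (y : X) = x := by
    intro x
    simp [hs']
  have hcomp : ∀ x ∈ s', ∀ y ∈ s', x ≤ y ∨ y ≤ x := by
    intro x hx y hy
    rw [hmem] at hx hy
    rcases hx with rfl | rfl | ⟨x, hx, rfl⟩
    · exact Or.inl bot_le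
    · exact Or.inr le_top
    · rcases hy with rfl | rfl | ⟨y, hy, rfl⟩
      · exact Or.inr bot_le
      · exact Or.inl le_top
      · exact hs.total hx hy
  obtain ⟨a, ha, hamax⟩ := exists_max_image (s'.filter fun x => ρ x < r) ρ
    ⟨⊥, mem_filter.2 ⟨(hmem _).2 (Or.inl rfl), by rw [h.bot]; omega⟩⟩
  obtain ⟨b, hb, hbmin⟩ := exists_min_image (s'.filter fun x => r < ρ x) ρ
    ⟨⊤, mem_filter.2 ⟨(hmem _).2 (Or.inr (Or.inl rfl)), by rw [h.top]; omega⟩⟩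
  rw [mem_filter] at ha hb
  have hab : a < b := by
    refine lt_of_le_of_ne ((h.le_iff_of_chain (hcomp a ha.1 b hb.1)).2 (by omega)) ?_
    rintro rfl
    omega
  refine ⟨a, b, hab, ha.2, hb.2, fun x hx => ?_, ?_, ?_⟩
  · have hxs : (x : X) ∈ s' := (hmem _).2 (Or.inr (Or.inr ⟨x, hx, rfl⟩))
    rcases lt_trichotomy (ρ x) r with h2 | h2 | h2
    · exact Or.inl ((h.le_iff_of_chain (hcomp _ hxs a ha.1)).2
        (hamax _ (mem_filter.2 ⟨hxs, h2⟩)))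
    · exact absurd h2 (hrs x hx)
    · exact Or.inr ((h.le_iff_of_chain (hcomp b hb.1 _ hxs)).2
        (hbmin _ (mem_filter.2 ⟨hxs, h2⟩)))
  · rcases (hmem a).1 ha.1 with e | e | e
    · exact Or.inl e
    · subst e
      have := ha.2
      rw [h.top] at this
      omega
    · exact Or.inr e
  · rcases (hmem b).1 hb.1 with e | e | e
    · subst e
      have := hb.2
      rw [h.bot] at this
      omega
    · exact Or.inl e
    · exact Or.inr e

theorem exists_chain_extension {s : Finset (Proper X)}
    (hs : IsChain (· ≤ ·) (s : Set (Proper X))) : (flags (barycentric X) k s).Nonempty := by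
  have hfin := h.finite
  induction hn : k - s.card generalizing s with
  | zero =>
    exact ⟨s, face_barycentric.2 hs, subset_rfl, le_antisymm (h.card_chain_le hs) (by omega)⟩
  | succ n ih =>
    obtain ⟨r, h1, h2, h3⟩ := exists_rank_notMem ρ (s := s) (k := k) (by omega)
    obtain ⟨a, b, hab, har, hrb, hgap, -, -⟩ := h.exists_gap hs h1 h2 h3
    obtain ⟨y, hay, hyb, hyr⟩ := exists_rank_between h.covBy hab.le har hrb
    let y' : Proper X := ⟨y, (bot_le.trans_lt hay).ne', (hyb.trans_le le_top).ne⟩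
    have hys : y' ∉ s := fun hy => h3 y' hy hyr
    obtain ⟨t, ht1, ht2, ht3⟩ := ih (isChain_insert_of_gap hs hgap (y := y') hay.le hyb.le)
      (by rw [card_insert_of_notMem hys]; omega)
    exact ⟨t, ht1, (subset_insert _ _).trans ht2, ht3⟩

theorem ridge_flags {s : Finset (Proper X)} (hs : IsChain (· ≤ ·) (s : Set (Proper X)))
    (hk : s.card + 1 = k) : (flags (barycentric X) k s).ncard = 2 := by
  obtain ⟨r, h1, h2, h3⟩ := exists_rank_notMem ρ (s := s) (k := k) (by omega)
  obtain ⟨a, b, hab, har, hrb, hgap, ha, hb⟩ := h.exists_gap hs h1 h2 h3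
  have hranks : insert r (s.image (fun x : Proper X => ρ x)) = Icc 1 k := by
    refine eq_of_subset_of_card_le (insert_subset (mem_Icc.2 ⟨h1, h2⟩) (h.image_rank_subset s)) ?_
    rw [card_insert_of_notMem (fun hr => by
        obtain ⟨x, hx, hxr⟩ := mem_image.1 hr
        exact h3 x hx hxr), card_image_of_injOn (h.rank_injOn hs), hk]
    simp
  have hexists : ∀ q, 1 ≤ q → q ≤ k → q ≠ r → ∃ x ∈ s, ρ x = q := by
    intro q hq1 hq2 hq
    have : q ∈ insert r (s.image (fun x : Proper X => ρ x)) := by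
      rw [hranks]; exact mem_Icc.2 ⟨hq1, hq2⟩
    exact mem_image.1 ((mem_insert.1 this).resolve_left hq)
  have hra : ρ a + 1 = r := by
    by_contra hne
    obtain ⟨x, hx, hxr⟩ := hexists (r - 1) (by omega) (by omega) (by omega)
    rcases hgap x hx with h4 | h4
    · have := h.strictMono.monotone h4
      omega
    · have := h.strictMono.monotone h4
      omega
  have hrb' : ρ b = r + 1 := by
    by_contra hne
    have hbtop := h.strictMono.monotone (le_top (a := b))
    rw [h.top] at hbtop
    obtain ⟨x, hx, hxr⟩ := hexists (r + 1) (by omega) (by omega) (by omega)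
    rcases hgap x hx with h4 | h4
    · have := h.strictMono.monotone h4
      omega
    · have := h.strictMono.monotone h4
      omega
  rw [← h.two a b hab (by omega)]
  have hnot : ∀ y : Proper X, a < y → (y : X) < b → y ∉ s := by
    intro y hay hyb hys
    rcases hgap y hys with h4 | h4
    · exact (hay.trans_le h4).false
    · exact (hyb.trans_le h4).false
  refine (Set.ncard_congr (fun y hy => insert (⟨y, (bot_le.trans_lt hy.1).ne',
    (hy.2.trans_le le_top).ne⟩ : Proper X) s) ?_ ?_ ?_).symm
  · rintro y ⟨hay, hyb⟩
    refine ⟨face_barycentric.2 (isChain_insert_of_gap hs hgap hay.le hyb.le),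
      subset_insert _ _, ?_⟩
    rw [card_insert_of_notMem (hnot _ hay hyb), hk]
  · intro y z hy hz hyz
    have : (⟨y, (bot_le.trans_lt hy.1).ne', (hy.2.trans_le le_top).ne⟩ : Proper X) ∈
        insert (⟨z, (bot_le.trans_lt hz.1).ne', (hz.2.trans_le le_top).ne⟩ : Proper X) s := by
      rw [← hyz]; exact mem_insert_self _ _
    rcases mem_insert.1 this with e | e
    · exact congrArg Subtype.val e
    · exact absurd e (hnot _ hy.1 hy.2)
  · rintro t ⟨ht1, ht2, ht3⟩
    rw [face_barycentric] at ht1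
    obtain ⟨y, hyt, hyr⟩ := h.exists_rank_mem ht1 ht3 h1 h2
    have hys : y ∉ s := fun hy => h3 y hy hyr
    have hay : a < y := by
      rcases ha with rfl | ⟨x, hx, rfl⟩
      · exact bot_lt_iff_ne_bot.2 y.2.1
      · have hxy : (x : X) ≤ y := (h.le_iff_of_chain (ht1.total (ht2 hx) hyt)).2 (by omega)
        exact hxy.lt_of_ne fun e => hys ((Subtype.ext e : x = y) ▸ hx)
    have hyb : (y : X) < b := by
      rcases hb with rfl | ⟨x, hx, rfl⟩
      · exact lt_top_iff_ne_top.2 y.2.2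
      · have hxy : (y : X) ≤ x := (h.le_iff_of_chain (ht1.total hyt (ht2 hx))).2 (by omega)
        exact hxy.lt_of_ne fun e => hys ((Subtype.ext e : y = x) ▸ hx)
    refine ⟨y, ⟨hay, hyb⟩, ?_⟩
    refine eq_of_subset_of_card_le (insert_subset hyt ht2) ?_
    rw [card_insert_of_notMem hys, hk, ht3]

theorem exists_adjacent_flags {s : Finset (Proper X)} {a b : X}
    (hs : IsChain (· ≤ ·) (s : Set (Proper X)))
    (hgap : ∀ x ∈ s, (x : X) ≤ a ∨ b ≤ x)
    (hb : b = ⊤ ∨ ∃ x ∈ s, (x : X) = b) {c c' : Proper X} (hac : a ≤ c) (hcb : (c : X) < b)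
    (hac' : a ≤ c') (hcb' : (c' : X) < b) (hcs : c ∉ s)
    (hc : ρ c + 1 = ρ b) (hc' : ρ c' + 1 = ρ b) (hcc : c ≠ c')
    (hadj : ρ ((c : X) ⊓ c') + 2 = ρ b) :
    ∃ E ∈ flags (barycentric X) k s, ∃ E' ∈ flags (barycentric X) k s, c ∈ E ∧ c' ∈ E' ∧
      k ≤ (E ∩ E').card + 1 := by
  set d : X := (c : X) ⊓ c' with hd
  have hdc : d ≤ c := inf_le_left
  have hdc' : d ≤ c' := inf_le_right
  have had : a ≤ d := le_inf hac hac'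
  have hsc := isChain_insert_of_gap hs hgap hac hcb.le
  obtain ⟨E, hE, hsE, hcE, hdE⟩ : ∃ E ∈ flags (barycentric X) k s, s ⊆ E ∧ c ∈ E ∧
      (d = ⊥ ∨ ∃ x ∈ E, (x : X) = d) := by
    by_cases hd0 : d = ⊥
    · obtain ⟨E, h1, h2, h3⟩ := h.exists_chain_extension hsc
      exact ⟨E, ⟨h1, (subset_insert _ _).trans h2, h3⟩, (subset_insert _ _).trans h2,
        h2 (mem_insert_self _ _), Or.inl hd0⟩
    · let d' : Proper X := ⟨d, hd0, ((hdc.trans_lt hcb).trans_le le_top).ne⟩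
      have hchain : IsChain (· ≤ ·) ((insert d' (insert c s) : Finset (Proper X)) :
          Set (Proper X)) := by
        refine isChain_insert hsc fun x hx => ?_
        rcases mem_insert.1 hx with rfl | hx
        · exact Or.inl hdc
        · rcases hgap x hx with h1 | h1
          · exact Or.inr (h1.trans had)
          · exact Or.inl ((hdc.trans hcb.le).trans h1)
      obtain ⟨E, h1, h2, h3⟩ := h.exists_chain_extension hchain
      have hsub : s ⊆ E := ((subset_insert _ _).trans (subset_insert _ _)).trans h2
      exact ⟨E, ⟨h1, hsub, h3⟩, hsub, h2 (mem_insert_of_mem (mem_insert_self _ _)),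
        Or.inr ⟨d', h2 (mem_insert_self _ _), rfl⟩⟩
  have hEc := face_barycentric.1 hE.1
  have hc'E : c' ∉ E := by
    intro hmem
    have := h.rank_injOn hEc hcE hmem (show ρ c = ρ c' by omega)
    exact hcc this
  have hchain' : IsChain (· ≤ ·) ((insert c' (E.erase c) : Finset (Proper X)) :
      Set (Proper X)) := by
    refine isChain_insert (isChain_mono hEc (erase_subset _ _)) fun e he => ?_
    rw [mem_erase] at he
    have hne : ρ e ≠ ρ c := fun e' => he.1 (h.rank_injOn hEc he.2 hcE e')
    rcases lt_or_gt_of_ne hne with h1 | h1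
    · right
      rcases hdE with h2 | ⟨x, hx, hxd⟩
      · rw [h2, h.bot] at hadj
        have := h.rank_pos e
        omega
      · have : (e : X) ≤ x := (h.le_iff_of_chain (hEc.total he.2 hx)).2 (by rw [hxd]; omega)
        exact this.trans (hxd.trans_le hdc')
    · left
      rcases hb with rfl | ⟨x, hx, rfl⟩
      · rw [h.top] at hc
        have := h.rank_le e
        omega
      · have : (x : X) ≤ e := (h.le_iff_of_chain (hEc.total (hsE hx) he.2)).2 (by omega)
        exact hcb'.le.trans this
  refine ⟨E, hE, insert c' (E.erase c), ⟨face_barycentric.2 hchain', fun x hx => ?_, ?_⟩, hcE,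
    mem_insert_self _ _, ?_⟩
  · exact mem_insert_of_mem (mem_erase.2 ⟨fun e => hcs (e ▸ hx), hsE hx⟩)
  · rw [card_insert_of_notMem (fun h => hc'E (erase_subset _ _ h)), card_erase_add_one hcE, hE.2.2]
  · have h1 : E.erase c ⊆ E ∩ insert c' (E.erase c) :=
      subset_inter (erase_subset _ _) (subset_insert _ _)
    have h2 := card_le_card h1
    have h3 := card_erase_add_one hcE
    rw [hE.2.2] at h3
    omega

theorem flagConnected {s : Finset (Proper X)} (hs : IsChain (· ≤ ·) (s : Set (Proper X))) :
    FlagConnected (barycentric X) k s := by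
  induction hn : k - s.card using Nat.strong_induction_on generalizing s with
  | _ n ih =>
    intro t ht u hu
    rcases (h.card_chain_le hs).eq_or_lt with hk | hk
    · rw [flags_self (face_barycentric.2 hs) hk] at ht hu
      rw [ht, hu]
    obtain ⟨r, h1, h2, h3⟩ := exists_rank_notMem ρ hk
    obtain ⟨a, b, hab, har, hrb, hgap, ha, hb⟩ := h.exists_gap hs h1 h2 h3
    have hbk : ρ b ≤ k + 1 := by
      rw [← h.top]; exact h.strictMono.monotone le_top
    have hbetween : ∀ w ∈ flags (barycentric X) k s, ∀ c ∈ w, ρ c + 1 = ρ b →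
        a < c ∧ (c : X) < b := by
      intro w hw c hc hcb
      have hwc := face_barycentric.1 hw.1
      constructor
      · rcases ha with rfl | ⟨x, hx, rfl⟩
        · exact bot_lt_iff_ne_bot.2 c.2.1
        · refine lt_of_le_of_ne ((h.le_iff_of_chain (hwc.total (hw.2.1 hx) hc)).2 (by omega)) ?_
          intro e
          rw [← e] at hcb
          omega
      · rcases hb with rfl | ⟨x, hx, rfl⟩
        · exact lt_top_iff_ne_top.2 c.2.2
        · refine lt_of_le_of_ne ((h.le_iff_of_chain (hwc.total hc (hw.2.1 hx))).2 (by omega)) ?_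
          intro e
          rw [e] at hcb
          omega
    have hnot : ∀ c : Proper X, a < c → (c : X) < b → c ∉ s := by
      intro y hay hyb hys
      rcases hgap y hys with h4 | h4
      · exact (hay.trans_le h4).false
      · exact (hyb.trans_le h4).false
    have hsame : ∀ c : Proper X, a < c → (c : X) < b → ∀ w ∈ flags (barycentric X) k s,
        ∀ w' ∈ flags (barycentric X) k s, c ∈ w → c ∈ w' →
        Relation.ReflTransGen (fun a b => b ∈ flags (barycentric X) k s ∧
          k ≤ (a ∩ b).card + 1) w w' := by
      intro c hac hcb w hw w' hw' hcw hcw'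
      have hcs := hnot c hac hcb
      have := ih (k - (insert c s).card) (by rw [card_insert_of_notMem hcs]; omega)
        (isChain_insert_of_gap hs hgap hac.le hcb.le) rfl w
        ⟨hw.1, insert_subset hcw hw.2.1, hw.2.2⟩ w' ⟨hw'.1, insert_subset hcw' hw'.2.1, hw'.2.2⟩
      clear hw' hcw'
      induction this with
      | refl => exact .refl
      | tail _ hxy ih =>
        exact ih.tail ⟨⟨hxy.1.1, (subset_insert _ _).trans hxy.1.2.1, hxy.1.2.2⟩, hxy.2⟩
    obtain ⟨ct, hct, hctr⟩ := h.exists_rank_mem (face_barycentric.1 ht.1) ht.2.2 (r := ρ b - 1)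
      (by omega) (by omega)
    obtain ⟨cu, hcu, hcur⟩ := h.exists_rank_mem (face_barycentric.1 hu.1) hu.2.2 (r := ρ b - 1)
      (by omega) (by omega)
    have hbt := hbetween t ht ct hct (by omega)
    have hbu := hbetween u hu cu hcu (by omega)
    have hreach := h.preconnected a b hab (by omega) ⟨ct, hbt.1.le, hbt.2.le, by omega⟩
      ⟨cu, hbu.1.le, hbu.2.le, by omega⟩
    rw [SimpleGraph.reachable_iff_reflTransGen] at hreach
    have hlt : ∀ c : X, a ≤ c → c ≤ b → ρ c + 1 = ρ b → a < c ∧ c < b := by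
      intro c h4 h5 h6
      exact ⟨h4.lt_of_ne (by rintro rfl; omega), h5.lt_of_ne (by rintro rfl; omega)⟩
    have key : ∀ c, Relation.ReflTransGen (intervalGraph ρ a b).Adj
        ⟨ct, hbt.1.le, hbt.2.le, by omega⟩ c → ∀ c' : Proper X, (c' : X) = c →
        ∀ H ∈ flags (barycentric X) k s, c' ∈ H →
        Relation.ReflTransGen (fun a b => b ∈ flags (barycentric X) k s ∧
          k ≤ (a ∩ b).card + 1) t H := by
      intro c hc
      induction hc with
      | refl =>
        intro c' hc' H hH hcH
        have : c' = ct := Subtype.ext hc'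
        subst this
        exact hsame c' hbt.1 hbt.2 t ht H hH hct hcH
      | @tail y z _ hyz ih' =>
        intro z' hz' H hH hzH
        obtain ⟨y, hy1, hy2, hy3⟩ := y
        obtain ⟨z, hz1, hz2, hz3⟩ := z
        dsimp only at hz'
        subst hz'
        have hly := hlt y hy1 hy2 hy3
        have hlz := hlt z' hz1 hz2 hz3
        let y' : Proper X := ⟨y, (bot_le.trans_lt hly.1).ne', (hly.2.trans_le le_top).ne⟩
        obtain ⟨E, hE, E', hE', h4, h5, h6⟩ := h.exists_adjacent_flags hs hgap hb
          (c := y') (c' := z') hy1 hly.2 hz1 hlz.2 (hnot y' hly.1 hly.2) hy3 hz3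
          (fun e => hyz.1 (Subtype.ext (show y = z' from congrArg Subtype.val e))) hyz.2
        exact ((ih' y' rfl E hE h4).tail ⟨hE', h6⟩).trans
          (hsame z' hlz.1 hlz.2 E' hE' H hH h5 hzH)
    exact key _ hreach cu rfl u hu hcu

theorem isNPM : IsNPM k (barycentric X) where
  finite := by
    have := h.finite
    exact Set.toFinite _
  card_le s hs := h.card_chain_le (face_barycentric.1 hs)
  exists_flag s hs := h.exists_chain_extension (face_barycentric.1 hs)
  ridge s hs hk := h.ridge_flags (face_barycentric.1 hs) hk
  connected s hs := h.flagConnected (face_barycentric.1 hs)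

end IsCellular

end

end CellPM

namespace CellPM

noncomputable section

open Classical Finset

variable {X Y : Type*} [Lattice X] [BoundedOrder X] [Lattice Y] [BoundedOrder Y]

namespace Join

/-- The element of the join with the given components. -/
def mk (x : X) (y : Y) (hx : x ≠ ⊤) (hy : y ≠ ⊤) : Join X Y := ⟨(x, y), Or.inl ⟨hx, hy⟩⟩

/-- The first component. -/
def fst (p : Join X Y) : X := p.1.1

/-- The second component. -/
def snd (p : Join X Y) : Y := p.1.2

@[simp] theorem fst_mk (x : X) (y : Y) (hx : x ≠ ⊤) (hy : y ≠ ⊤) : (mk x y hx hy).fst = x := rfl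

@[simp] theorem snd_mk (x : X) (y : Y) (hx : x ≠ ⊤) (hy : y ≠ ⊤) : (mk x y hx hy).snd = y := rfl

theorem le_iff {p q : Join X Y} : p ≤ q ↔ p.fst ≤ q.fst ∧ p.snd ≤ q.snd := Iff.rfl

theorem ext_iff {p q : Join X Y} : p = q ↔ p.fst = q.fst ∧ p.snd = q.snd := by
  constructor
  · rintro rfl; exact ⟨rfl, rfl⟩
  · rintro ⟨h1, h2⟩
    exact Subtype.ext (Prod.ext h1 h2)

@[simp] theorem fst_inf (p q : Join X Y) : (p ⊓ q).fst = p.fst ⊓ q.fst := rfl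

@[simp] theorem snd_inf (p q : Join X Y) : (p ⊓ q).snd = p.snd ⊓ q.snd := rfl

theorem lt_iff {p q : Join X Y} : p < q ↔ p.fst ≤ q.fst ∧ p.snd ≤ q.snd ∧ p ≠ q := by
  rw [lt_iff_le_and_ne, le_iff, and_assoc]

variable [Nontrivial X] [Nontrivial Y]

@[simp] theorem fst_top : (⊤ : Join X Y).fst = ⊤ := rfl

@[simp] theorem snd_top : (⊤ : Join X Y).snd = ⊤ := rfl

@[simp] theorem fst_bot : (⊥ : Join X Y).fst = ⊥ := rfl

@[simp] theorem snd_bot : (⊥ : Join X Y).snd = ⊥ := rfl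

theorem ne_top {p : Join X Y} (h : p ≠ ⊤) : p.fst ≠ ⊤ ∧ p.snd ≠ ⊤ :=
  p.2.resolve_right fun e => h (Subtype.ext e)

theorem mk_ne_top (x : X) (y : Y) (hx : x ≠ ⊤) (hy : y ≠ ⊤) : mk x y hx hy ≠ ⊤ := fun h =>
  hx (ext_iff.1 h).1

/-- The rank function of a join. -/
def rank (ρ : X → ℕ) (τ : Y → ℕ) (p : Join X Y) : ℕ :=
  if p = ⊤ then ρ ⊤ + τ ⊤ - 1 else ρ p.fst + τ p.snd

theorem rank_of_ne_top (ρ : X → ℕ) (τ : Y → ℕ) {p : Join X Y} (h : p ≠ ⊤) :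
    rank ρ τ p = ρ p.fst + τ p.snd := if_neg h

theorem rank_top (ρ : X → ℕ) (τ : Y → ℕ) : rank ρ τ (⊤ : Join X Y) = ρ ⊤ + τ ⊤ - 1 := if_pos rfl

variable {ρ : X → ℕ} {τ : Y → ℕ} {k l : ℕ}

theorem rank_covBy (hX : IsCellular ρ k) (hY : IsCellular τ l) (p q : Join X Y) (h : p ⋖ q) :
    rank ρ τ q = rank ρ τ p + 1 := by
  have hp : p ≠ ⊤ := (h.lt.trans_le le_top).ne
  obtain ⟨hp1, hp2⟩ := ne_top hp
  obtain ⟨hle1, hle2, hne⟩ := lt_iff.1 h.lt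
  have hno : ∀ r : Join X Y, p ≤ r → r ≤ q → r = p ∨ r = q := fun r h1 h2 => h.eq_or_eq h1 h2
  by_cases hq : q = ⊤
  · subst hq
    have h1 : p.fst ⋖ ⊤ := by
      refine ⟨lt_top_iff_ne_top.2 hp1, fun c hpc hc => ?_⟩
      rcases hno (mk c p.snd hc.ne hp2) (le_iff.2 ⟨hpc.le, le_rfl⟩) le_top with e | e
      · exact hpc.ne' (ext_iff.1 e).1
      · exact mk_ne_top _ _ _ _ e
    have h2 : p.snd ⋖ ⊤ := by
      refine ⟨lt_top_iff_ne_top.2 hp2, fun c hpc hc => ?_⟩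
      rcases hno (mk p.fst c hp1 hc.ne) (le_iff.2 ⟨le_rfl, hpc.le⟩) le_top with e | e
      · exact hpc.ne' (ext_iff.1 e).2
      · exact mk_ne_top _ _ _ _ e
    have h3 := hX.covBy _ _ h1
    have h4 := hY.covBy _ _ h2
    rw [rank_top, rank_of_ne_top ρ τ hp]
    omega
  · obtain ⟨hq1, hq2⟩ := ne_top hq
    rw [rank_of_ne_top ρ τ hp, rank_of_ne_top ρ τ hq]
    rcases hno (mk q.fst p.snd hq1 hp2) (le_iff.2 ⟨hle1, le_rfl⟩) (le_iff.2 ⟨le_rfl, hle2⟩) with e | e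
    · have e1 : q.fst = p.fst := (ext_iff.1 e).1
      have hlt : p.snd < q.snd := hle2.lt_of_ne fun e' => hne (ext_iff.2 ⟨e1.symm, e'⟩)
      have : p.snd ⋖ q.snd := by
        refine ⟨hlt, fun c hpc hcq => ?_⟩
        rcases hno (mk p.fst c hp1 (hcq.trans_le le_top).ne) (le_iff.2 ⟨le_rfl, hpc.le⟩)
          (le_iff.2 ⟨hle1, hcq.le⟩) with e | e
        · exact hpc.ne' (ext_iff.1 e).2
        · exact hcq.ne (ext_iff.1 e).2
      rw [hY.covBy _ _ this, e1]
      omega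
    · have e1 : p.snd = q.snd := (ext_iff.1 e).2
      have hlt : p.fst < q.fst := hle1.lt_of_ne fun e' => hne (ext_iff.2 ⟨e', e1⟩)
      have : p.fst ⋖ q.fst := by
        refine ⟨hlt, fun c hpc hcq => ?_⟩
        rcases hno (mk c p.snd (hcq.trans_le le_top).ne hp2) (le_iff.2 ⟨hpc.le, le_rfl⟩)
          (le_iff.2 ⟨hcq.le, hle2⟩) with e | e
        · exact hpc.ne' (ext_iff.1 e).1
        · exact hcq.ne (ext_iff.1 e).1
      rw [hX.covBy _ _ this, e1]
      omega

theorem rank_lt_of_ne_top (hX : IsCellular ρ k) (hY : IsCellular τ l) {p : Join X Y} (hp : p ≠ ⊤) :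
    ρ p.fst ≤ k ∧ τ p.snd ≤ l := by
  have h1 := hX.strictMono (lt_top_iff_ne_top.2 (ne_top hp).1)
  have h2 := hY.strictMono (lt_top_iff_ne_top.2 (ne_top hp).2)
  rw [hX.top] at h1
  rw [hY.top] at h2
  omega

theorem eq_of_le_of_rank {Z : Type*} [Lattice Z] [BoundedOrder Z] {ρ : Z → ℕ} {k : ℕ}
    (hZ : IsCellular ρ k) {a b : Z} (hab : a ≤ b) (h : ρ b ≤ ρ a) : a = b := by
  by_contra hne
  have := hZ.strictMono (hab.lt_of_ne hne)
  omega

/-- An interval of rank two whose ends differ only in the first component has two inner elements. -/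
theorem ncard_of_snd_eq {p z : Join X Y} (hp : p ≠ ⊤)
    (hiff : ∀ w : Join X Y, p < w ∧ w < z ↔ w.snd = p.snd ∧ p.fst < w.fst ∧ w.fst < z.fst)
    (hcard : {y : X | p.fst < y ∧ y < z.fst}.ncard = 2) :
    {w : Join X Y | p < w ∧ w < z}.ncard = 2 := by
  rw [← hcard]
  refine Set.ncard_congr (fun w _ => w.fst) ?_ ?_ ?_
  · intro w hw
    exact ((hiff w).1 hw).2
  · intro w w' hw hw' e
    exact ext_iff.2 ⟨e, ((hiff w).1 hw).1.trans ((hiff w').1 hw').1.symm⟩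
  · rintro c ⟨h1, h2⟩
    exact ⟨mk c p.snd (h2.trans_le le_top).ne (ne_top hp).2, (hiff _).2 ⟨rfl, h1, h2⟩, rfl⟩

theorem ncard_of_fst_eq {p z : Join X Y} (hp : p ≠ ⊤)
    (hiff : ∀ w : Join X Y, p < w ∧ w < z ↔ w.fst = p.fst ∧ p.snd < w.snd ∧ w.snd < z.snd)
    (hcard : {y : Y | p.snd < y ∧ y < z.snd}.ncard = 2) :
    {w : Join X Y | p < w ∧ w < z}.ncard = 2 := by
  rw [← hcard]
  refine Set.ncard_congr (fun w _ => w.snd) ?_ ?_ ?_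
  · intro w hw
    exact ((hiff w).1 hw).2
  · intro w w' hw hw' e
    exact ext_iff.2 ⟨((hiff w).1 hw).1.trans ((hiff w').1 hw').1.symm, e⟩
  · rintro c ⟨h1, h2⟩
    exact ⟨mk p.fst c (ne_top hp).1 (h2.trans_le le_top).ne, (hiff _).2 ⟨rfl, h1, h2⟩, rfl⟩

theorem two (hX : IsCellular ρ k) (hY : IsCellular τ l) (p z : Join X Y) (hpz : p < z)
    (hr : rank ρ τ z = rank ρ τ p + 2) : {w : Join X Y | p < w ∧ w < z}.ncard = 2 := by
  have hp : p ≠ ⊤ := (hpz.trans_le le_top).ne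
  obtain ⟨hp1, hp2⟩ := ne_top hp
  obtain ⟨hle1, hle2, hne⟩ := lt_iff.1 hpz
  have hpl := rank_lt_of_ne_top hX hY hp
  rw [rank_of_ne_top ρ τ hp] at hr
  have hne_of_lt : ∀ w : Join X Y, w < z → w ≠ ⊤ := fun w hw => (hw.trans_le le_top).ne
  by_cases hz : z = ⊤
  · subst hz
    rw [rank_top, hX.top, hY.top] at hr
    by_cases h : τ p.snd = l
    · refine ncard_of_snd_eq hp (fun w => ?_) (hX.two _ _ (lt_top_iff_ne_top.2 hp1) (by
        rw [fst_top, hX.top]; omega))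
      constructor
      · rintro ⟨h1, h2⟩
        have hw := hne_of_lt w h2
        have hwl := rank_lt_of_ne_top hX hY hw
        obtain ⟨h3, h4, h5⟩ := lt_iff.1 h1
        have e := eq_of_le_of_rank hY h4 (by omega)
        exact ⟨e.symm, h3.lt_of_ne fun e' => h5 (ext_iff.2 ⟨e', e⟩),
          lt_top_iff_ne_top.2 (ne_top hw).1⟩
      · rintro ⟨h1, h2, h3⟩
        refine ⟨lt_iff.2 ⟨h2.le, h1.ge, fun e => h2.ne (ext_iff.1 e).1⟩,
          lt_top_iff_ne_top.2 fun e => h3.ne (ext_iff.1 e).1⟩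
    · refine ncard_of_fst_eq hp (fun w => ?_) (hY.two _ _ (lt_top_iff_ne_top.2 hp2) (by
        rw [snd_top, hY.top]; omega))
      constructor
      · rintro ⟨h1, h2⟩
        have hw := hne_of_lt w h2
        have hwl := rank_lt_of_ne_top hX hY hw
        obtain ⟨h3, h4, h5⟩ := lt_iff.1 h1
        have e := eq_of_le_of_rank hX h3 (by omega)
        exact ⟨e.symm, h4.lt_of_ne fun e' => h5 (ext_iff.2 ⟨e, e'⟩),
          lt_top_iff_ne_top.2 (ne_top hw).2⟩
      · rintro ⟨h1, h2, h3⟩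
        refine ⟨lt_iff.2 ⟨h1.ge, h2.le, fun e => h2.ne (ext_iff.1 e).2⟩,
          lt_top_iff_ne_top.2 fun e => h3.ne (ext_iff.1 e).2⟩
  · obtain ⟨hz1, hz2⟩ := ne_top hz
    rw [rank_of_ne_top ρ τ hz] at hr
    have hm1 := hX.strictMono.monotone hle1
    have hm2 := hY.strictMono.monotone hle2
    by_cases h1 : p.snd = z.snd
    · refine ncard_of_snd_eq hp (fun w => ?_) (hX.two _ _ (hle1.lt_of_ne fun e =>
        hne (ext_iff.2 ⟨e, h1⟩)) (by rw [h1] at hr; omega))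
      constructor
      · rintro ⟨h2, h3⟩
        obtain ⟨h4, h5, h6⟩ := lt_iff.1 h2
        obtain ⟨h7, h8, h9⟩ := lt_iff.1 h3
        have e : p.snd = w.snd := h5.antisymm (h8.trans h1.ge)
        exact ⟨e.symm, h4.lt_of_ne fun e' => h6 (ext_iff.2 ⟨e', e⟩),
          h7.lt_of_ne fun e' => h9 (ext_iff.2 ⟨e', e.symm.trans h1⟩)⟩
      · rintro ⟨h2, h3, h4⟩
        exact ⟨lt_iff.2 ⟨h3.le, h2.ge, fun e => h3.ne (ext_iff.1 e).1⟩,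
          lt_iff.2 ⟨h4.le, (h2.trans h1).le, fun e => h4.ne (ext_iff.1 e).1⟩⟩
    by_cases h1' : p.fst = z.fst
    · refine ncard_of_fst_eq hp (fun w => ?_) (hY.two _ _ (hle2.lt_of_ne h1)
        (by rw [h1'] at hr; omega))
      constructor
      · rintro ⟨h2, h3⟩
        obtain ⟨h4, h5, h6⟩ := lt_iff.1 h2
        obtain ⟨h7, h8, h9⟩ := lt_iff.1 h3
        have e : p.fst = w.fst := h4.antisymm (h7.trans h1'.ge)
        exact ⟨e.symm, h5.lt_of_ne fun e' => h6 (ext_iff.2 ⟨e, e'⟩),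
          h8.lt_of_ne fun e' => h9 (ext_iff.2 ⟨e.symm.trans h1', e'⟩)⟩
      · rintro ⟨h2, h3, h4⟩
        exact ⟨lt_iff.2 ⟨h2.ge, h3.le, fun e => h3.ne (ext_iff.1 e).2⟩,
          lt_iff.2 ⟨(h2.trans h1').le, h4.le, fun e => h4.ne (ext_iff.1 e).2⟩⟩
    have hlt1 := hle1.lt_of_ne h1'
    have hlt2 := hle2.lt_of_ne h1
    have hr1 := hX.strictMono hlt1
    have hr2 := hY.strictMono hlt2
    have hset : {w : Join X Y | p < w ∧ w < z} =
        {mk p.fst z.snd hp1 hz2, mk z.fst p.snd hz1 hp2} := by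
      ext w
      simp only [Set.mem_ofPred_eq, Set.mem_insert_iff, Set.mem_singleton_iff]
      constructor
      · rintro ⟨h2, h3⟩
        obtain ⟨h4, h5, h6⟩ := lt_iff.1 h2
        obtain ⟨h7, h8, h9⟩ := lt_iff.1 h3
        have hw1 : w.fst = p.fst ∨ w.fst = z.fst := by
          by_cases e : ρ w.fst ≤ ρ p.fst
          · exact Or.inl (eq_of_le_of_rank hX h4 e).symm
          · exact Or.inr (eq_of_le_of_rank hX h7 (by omega))
        have hw2 : w.snd = p.snd ∨ w.snd = z.snd := by
          by_cases e : τ w.snd ≤ τ p.snd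
          · exact Or.inl (eq_of_le_of_rank hY h5 e).symm
          · exact Or.inr (eq_of_le_of_rank hY h8 (by omega))
        simp only [ext_iff, fst_mk, snd_mk, ne_eq] at h6 h9 ⊢
        rcases hw1 with e1 | e1 <;> rcases hw2 with e2 | e2
        · exact absurd ⟨e1.symm, e2.symm⟩ h6
        · exact Or.inl ⟨e1, e2⟩
        · exact Or.inr ⟨e1, e2⟩
        · exact absurd ⟨e1, e2⟩ h9
      · rintro (rfl | rfl)
        · exact ⟨lt_iff.2 ⟨le_rfl, hle2, fun e => h1 (ext_iff.1 e).2⟩,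
            lt_iff.2 ⟨hle1, le_rfl, fun e => h1' (ext_iff.1 e).1⟩⟩
        · exact ⟨lt_iff.2 ⟨hle1, le_rfl, fun e => h1' (ext_iff.1 e).1⟩,
            lt_iff.2 ⟨le_rfl, hle2, fun e => h1 (ext_iff.1 e).2⟩⟩
    rw [hset, Set.ncard_pair]
    intro e
    exact h1' (ext_iff.1 e).1

theorem reachable_of_map {Z Z' : Type*} [Lattice Z] [Lattice Z'] {ρ : Z → ℕ} {σ : Z' → ℕ}
    {a b : Z} {a' b' : Z'} (h : (intervalGraph ρ a b).Preconnected)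
    (f : {y : Z // a ≤ y ∧ y ≤ b ∧ ρ y + 1 = ρ b} → {y : Z' // a' ≤ y ∧ y ≤ b' ∧ σ y + 1 = σ b'})
    (hf : Function.Injective f)
    (hadj : ∀ c d : {y : Z // a ≤ y ∧ y ≤ b ∧ ρ y + 1 = ρ b}, ρ ((c : Z) ⊓ d) + 2 = ρ b → σ ((f c : Z') ⊓ f d) + 2 = σ b') (c d) :
    (intervalGraph σ a' b').Reachable (f c) (f d) :=
  let φ : intervalGraph ρ a b →g intervalGraph σ a' b' :=
    { toFun := f
      map_rel' := fun {c d} hcd => by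
        have h1 : c ≠ d ∧ ρ ((c : Z) ⊓ d) + 2 = ρ b := hcd
        exact show f c ≠ f d ∧ σ ((f c : Z') ⊓ f d) + 2 = σ b' from
          ⟨fun e => h1.1 (hf e), hadj c d h1.2⟩ }
  (h c d).map φ

theorem preconnected (hX : IsCellular ρ k) (hY : IsCellular τ l) (p z : Join X Y) (hpz : p < z)
    (hr : rank ρ τ p + 2 ≤ rank ρ τ z) : (intervalGraph (rank ρ τ) p z).Preconnected := by
  have hp : p ≠ ⊤ := (hpz.trans_le le_top).ne
  obtain ⟨hp1, hp2⟩ := ne_top hp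
  obtain ⟨hle1, hle2, hne⟩ := lt_iff.1 hpz
  have hpl := rank_lt_of_ne_top hX hY hp
  rw [rank_of_ne_top ρ τ hp] at hr
  have hfX := hX.finite
  have hfY := hY.finite
  have hlow : ∀ {v w : Join X Y}, v ≤ w → w ≠ ⊤ → v ≠ ⊤ := fun hvw hw e =>
    hw (top_le_iff.1 (e ▸ hvw))
  have hrmk : ∀ (x : X) (y : Y) hx hy, rank ρ τ (mk x y hx hy) = ρ x + τ y := fun x y hx hy =>
    rank_of_ne_top ρ τ (mk_ne_top x y hx hy)
  by_cases hz : z = ⊤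
  · subst hz
    rw [rank_top, hX.top, hY.top] at hr
    have htop : rank ρ τ (⊤ : Join X Y) = k + l + 1 := by
      rw [rank_top, hX.top, hY.top]; omega
    have hcoatom : ∀ w : Join X Y, rank ρ τ w + 1 = rank ρ τ (⊤ : Join X Y) →
        w ≠ ⊤ ∧ ρ w.fst = k ∧ τ w.snd = l := by
      intro w hw
      have hwt : w ≠ ⊤ := by rintro rfl; omega
      have := rank_lt_of_ne_top hX hY hwt
      rw [rank_of_ne_top ρ τ hwt, htop] at hw
      exact ⟨hwt, by omega, by omega⟩
    have hinfX : ∀ c d : X, ∀ y : Y, ∀ (hc : c ≠ ⊤) (hd : d ≠ ⊤) (hy : y ≠ ⊤), τ y = l →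
        ρ (c ⊓ d) + 2 = ρ ⊤ →
        rank ρ τ (mk c y hc hy ⊓ mk d y hd hy) + 2 = rank ρ τ (⊤ : Join X Y) := by
      intro c d y hc hd hy hyl h
      rw [rank_of_ne_top ρ τ (hlow inf_le_left (mk_ne_top c y hc hy)), htop, fst_inf, snd_inf,
        fst_mk, fst_mk, snd_mk, snd_mk, inf_idem]
      rw [hX.top] at h
      omega
    have hinfY : ∀ c d : Y, ∀ x : X, ∀ (hc : c ≠ ⊤) (hd : d ≠ ⊤) (hx : x ≠ ⊤), ρ x = k →
        τ (c ⊓ d) + 2 = τ ⊤ →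
        rank ρ τ (mk x c hx hc ⊓ mk x d hx hd) + 2 = rank ρ τ (⊤ : Join X Y) := by
      intro c d x hc hd hx hxl h
      rw [rank_of_ne_top ρ τ (hlow inf_le_left (mk_ne_top x c hx hc)), htop, fst_inf, snd_inf,
        fst_mk, fst_mk, snd_mk, snd_mk, inf_idem]
      rw [hY.top] at h
      omega
    rintro ⟨v, hv1, hv2, hv3⟩ ⟨w, hw1, hw2, hw3⟩
    obtain ⟨hvt, hvx, hvy⟩ := hcoatom v hv3
    obtain ⟨hwt, hwx, hwy⟩ := hcoatom w hw3
    let u : Join X Y := mk w.fst v.snd (ne_top hwt).1 (ne_top hvt).2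
    have hu : p ≤ u ∧ u ≤ ⊤ ∧ rank ρ τ u + 1 = rank ρ τ (⊤ : Join X Y) :=
      ⟨le_iff.2 ⟨(le_iff.1 hw1).1, (le_iff.1 hv1).2⟩, le_top, by rw [hrmk, htop]; omega⟩
    have hXt : ∀ c : X, ρ c + 1 = ρ ⊤ → c ≠ ⊤ := by rintro c hc rfl; omega
    have hYt : ∀ c : Y, τ c + 1 = τ ⊤ → c ≠ ⊤ := by rintro c hc rfl; omega
    refine SimpleGraph.Reachable.trans (v := ⟨u, hu⟩) ?_ ?_
    · by_cases hpk : ρ p.fst = k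
      · have e1 := eq_of_le_of_rank hX (le_iff.1 hv1).1 (by omega)
        have e2 := eq_of_le_of_rank hX (le_iff.1 hw1).1 (by omega)
        have : (⟨v, hv1, hv2, hv3⟩ : {y // p ≤ y ∧ y ≤ ⊤ ∧
            rank ρ τ y + 1 = rank ρ τ (⊤ : Join X Y)}) = ⟨u, hu⟩ :=
          Subtype.ext (ext_iff.2 ⟨e1.symm.trans e2, rfl⟩)
        rw [this]
      · have hpre := hX.preconnected p.fst ⊤ (lt_top_iff_ne_top.2 hp1) (by rw [hX.top]; omega)
        have := reachable_of_map hpre (a' := p) (b' := ⊤) (σ := rank ρ τ)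
          (fun c => ⟨mk c v.snd (hXt c c.2.2.2) (ne_top hvt).2,
            le_iff.2 ⟨c.2.1, (le_iff.1 hv1).2⟩, le_top, by
              have := c.2.2.2
              have h0 := hX.top
              rw [hrmk, htop]; omega⟩)
          (fun c d e => Subtype.ext (ext_iff.1 (congrArg Subtype.val e)).1)
          (fun c d h => hinfX c d v.snd (hXt c c.2.2.2) (hXt d d.2.2.2) (ne_top hvt).2 hvy h)
          ⟨v.fst, (le_iff.1 hv1).1, le_top, by rw [hX.top]; omega⟩
          ⟨w.fst, (le_iff.1 hw1).1, le_top, by rw [hX.top]; omega⟩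
        exact this
    · by_cases hpk : τ p.snd = l
      · have e1 := eq_of_le_of_rank hY (le_iff.1 hv1).2 (by omega)
        have e2 := eq_of_le_of_rank hY (le_iff.1 hw1).2 (by omega)
        have : (⟨u, hu⟩ : {y // p ≤ y ∧ y ≤ ⊤ ∧
            rank ρ τ y + 1 = rank ρ τ (⊤ : Join X Y)}) = ⟨w, hw1, hw2, hw3⟩ :=
          Subtype.ext (ext_iff.2 ⟨rfl, e1.symm.trans e2⟩)
        rw [this]
      · have hpre := hY.preconnected p.snd ⊤ (lt_top_iff_ne_top.2 hp2) (by rw [hY.top]; omega)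
        have := reachable_of_map hpre (a' := p) (b' := ⊤) (σ := rank ρ τ)
          (fun c => ⟨mk w.fst c (ne_top hwt).1 (hYt c c.2.2.2),
            le_iff.2 ⟨(le_iff.1 hw1).1, c.2.1⟩, le_top, by
              have := c.2.2.2
              have h0 := hY.top
              rw [hrmk, htop]; omega⟩)
          (fun c d e => Subtype.ext (ext_iff.1 (congrArg Subtype.val e)).2)
          (fun c d h => hinfY c d w.fst (hYt c c.2.2.2) (hYt d d.2.2.2) (ne_top hwt).1 hwx h)
          ⟨v.snd, (le_iff.1 hv1).2, le_top, by rw [hY.top]; omega⟩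
          ⟨w.snd, (le_iff.1 hw1).2, le_top, by rw [hY.top]; omega⟩
        exact this
  · obtain ⟨hz1, hz2⟩ := ne_top hz
    rw [rank_of_ne_top ρ τ hz] at hr
    have hzr := rank_of_ne_top ρ τ hz
    have hm1 := hX.strictMono.monotone hle1
    have hm2 := hY.strictMono.monotone hle2
    have hXt : ∀ c : X, c ≤ z.fst → c ≠ ⊤ := by
      rintro c hc rfl
      exact hz1 (top_le_iff.1 hc)
    have hYt : ∀ c : Y, c ≤ z.snd → c ≠ ⊤ := by
      rintro c hc rfl
      exact hz2 (top_le_iff.1 hc)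
    by_cases h1 : p.snd = z.snd
    · have hlt : p.fst < z.fst := hle1.lt_of_ne fun e => hne (ext_iff.2 ⟨e, h1⟩)
      have hpre := hX.preconnected _ _ hlt (by rw [h1] at hr; omega)
      have hnode : ∀ w : Join X Y, p ≤ w → w ≤ z → rank ρ τ w + 1 = rank ρ τ z →
          w.snd = z.snd ∧ ρ w.fst + 1 = ρ z.fst := by
        intro w h2 h3 h4
        have e : w.snd = z.snd := (le_iff.1 h3).2.antisymm (h1 ▸ (le_iff.1 h2).2)
        rw [hzr, rank_of_ne_top ρ τ (hlow h3 hz), e] at h4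
        exact ⟨e, by omega⟩
      rintro ⟨v, hv1, hv2, hv3⟩ ⟨w, hw1, hw2, hw3⟩
      have hvn := hnode v hv1 hv2 hv3
      have hwn := hnode w hw1 hw2 hw3
      have := reachable_of_map hpre (a' := p) (b' := z) (σ := rank ρ τ)
          (fun c => ⟨mk c z.snd (hXt c c.2.2.1) hz2,
            le_iff.2 ⟨c.2.1, hle2⟩, le_iff.2 ⟨c.2.2.1, le_rfl⟩, by
              have := c.2.2.2
              rw [hrmk, hzr]; omega⟩)
          (fun c d e => Subtype.ext (ext_iff.1 (congrArg Subtype.val e)).1)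
          (fun c d h => by
            have hc := hXt c c.2.2.1
            have hd := hXt d d.2.2.1
            have e := rank_of_ne_top ρ τ
              (hlow inf_le_left (mk_ne_top c.1 z.snd hc hz2) : mk c.1 z.snd hc hz2 ⊓ mk d.1 z.snd hd hz2 ≠ ⊤)
            rw [fst_inf, snd_inf, fst_mk, fst_mk, snd_mk, snd_mk, inf_idem] at e
            show rank ρ τ (mk c.1 z.snd hc hz2 ⊓ mk d.1 z.snd hd hz2) + 2 = rank ρ τ z
            omega)
          ⟨v.fst, (le_iff.1 hv1).1, (le_iff.1 hv2).1, hvn.2⟩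
          ⟨w.fst, (le_iff.1 hw1).1, (le_iff.1 hw2).1, hwn.2⟩
      convert this using 1
      · exact Subtype.ext (ext_iff.2 ⟨rfl, hvn.1⟩)
      · exact Subtype.ext (ext_iff.2 ⟨rfl, hwn.1⟩)
    by_cases h1' : p.fst = z.fst
    · have hpre := hY.preconnected _ _ (hle2.lt_of_ne h1) (by rw [h1'] at hr; omega)
      have hnode : ∀ w : Join X Y, p ≤ w → w ≤ z → rank ρ τ w + 1 = rank ρ τ z →
          w.fst = z.fst ∧ τ w.snd + 1 = τ z.snd := by
        intro w h2 h3 h4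
        have e : w.fst = z.fst := (le_iff.1 h3).1.antisymm (h1' ▸ (le_iff.1 h2).1)
        rw [hzr, rank_of_ne_top ρ τ (hlow h3 hz), e] at h4
        exact ⟨e, by omega⟩
      rintro ⟨v, hv1, hv2, hv3⟩ ⟨w, hw1, hw2, hw3⟩
      have hvn := hnode v hv1 hv2 hv3
      have hwn := hnode w hw1 hw2 hw3
      have := reachable_of_map hpre (a' := p) (b' := z) (σ := rank ρ τ)
          (fun c => ⟨mk z.fst c hz1 (hYt c c.2.2.1),
            le_iff.2 ⟨hle1, c.2.1⟩, le_iff.2 ⟨le_rfl, c.2.2.1⟩, by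
              have := c.2.2.2
              rw [hrmk, hzr]; omega⟩)
          (fun c d e => Subtype.ext (ext_iff.1 (congrArg Subtype.val e)).2)
          (fun c d h => by
            have hc := hYt c c.2.2.1
            have hd := hYt d d.2.2.1
            have e := rank_of_ne_top ρ τ
              (hlow inf_le_left (mk_ne_top z.fst c.1 hz1 hc) : mk z.fst c.1 hz1 hc ⊓ mk z.fst d.1 hz1 hd ≠ ⊤)
            rw [fst_inf, snd_inf, fst_mk, fst_mk, snd_mk, snd_mk, inf_idem] at e
            show rank ρ τ (mk z.fst c.1 hz1 hc ⊓ mk z.fst d.1 hz1 hd) + 2 = rank ρ τ z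
            omega)
          ⟨v.snd, (le_iff.1 hv1).2, (le_iff.1 hv2).2, hvn.2⟩
          ⟨w.snd, (le_iff.1 hw1).2, (le_iff.1 hw2).2, hwn.2⟩
      convert this using 1
      · exact Subtype.ext (ext_iff.2 ⟨hvn.1, rfl⟩)
      · exact Subtype.ext (ext_iff.2 ⟨hwn.1, rfl⟩)
    have hlt1 := hX.strictMono (hle1.lt_of_ne h1')
    have hlt2 := hY.strictMono (hle2.lt_of_ne h1)
    obtain ⟨c₀, hc1, hc2, hc3⟩ := exists_rank_eq hX.covBy hle1 (r := ρ z.fst - 1) (by omega)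
      (by omega)
    obtain ⟨d₀, hd1, hd2, hd3⟩ := exists_rank_eq hY.covBy hle2 (r := τ z.snd - 1) (by omega)
      (by omega)
    have hnode : ∀ w : Join X Y, p ≤ w → w ≤ z → rank ρ τ w + 1 = rank ρ τ z →
        (w.fst = z.fst ∧ τ w.snd + 1 = τ z.snd) ∨ (w.snd = z.snd ∧ ρ w.fst + 1 = ρ z.fst) := by
      intro w h2 h3 h4
      rw [hzr, rank_of_ne_top ρ τ (hlow h3 hz)] at h4
      have h5 := hX.strictMono.monotone (le_iff.1 h3).1
      have h6 := hY.strictMono.monotone (le_iff.1 h3).2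
      by_cases h7 : ρ w.fst = ρ z.fst
      · exact Or.inl ⟨eq_of_le_of_rank hX (le_iff.1 h3).1 (by omega), by omega⟩
      · exact Or.inr ⟨eq_of_le_of_rank hY (le_iff.1 h3).2 (by omega), by omega⟩
    have hadj : ∀ v w : {y : Join X Y // p ≤ y ∧ y ≤ z ∧ rank ρ τ y + 1 = rank ρ τ z},
        v.1.fst = z.fst → τ v.1.snd + 1 = τ z.snd → w.1.snd = z.snd → ρ w.1.fst + 1 = ρ z.fst →
        (intervalGraph (rank ρ τ) p z).Adj v w := by
      intro v w e1 e2 e3 e4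
      refine ⟨?_, ?_⟩
      · rintro rfl
        rw [e1] at e4
        omega
      · have e := rank_of_ne_top ρ τ
          (hlow (inf_le_left.trans v.2.2.1) hz : v.1 ⊓ w.1 ≠ ⊤)
        rw [fst_inf, snd_inf, e1, e3, inf_eq_right.2 (le_iff.1 w.2.2.1).1,
          inf_eq_left.2 (le_iff.1 v.2.2.1).2] at e
        omega
    let c : {y : Join X Y // p ≤ y ∧ y ≤ z ∧ rank ρ τ y + 1 = rank ρ τ z} :=
      ⟨mk c₀ z.snd (hXt _ hc2) hz2, le_iff.2 ⟨hc1, hle2⟩, le_iff.2 ⟨hc2, le_rfl⟩, by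
        rw [hrmk, hzr]; omega⟩
    let d : {y : Join X Y // p ≤ y ∧ y ≤ z ∧ rank ρ τ y + 1 = rank ρ τ z} :=
      ⟨mk z.fst d₀ hz1 (hYt _ hd2), le_iff.2 ⟨hle1, hd1⟩, le_iff.2 ⟨le_rfl, hd2⟩, by
        rw [hrmk, hzr]; omega⟩
    have hdc : (intervalGraph (rank ρ τ) p z).Reachable d c :=
      (hadj d c rfl (show τ d₀ + 1 = _ by omega) rfl (show ρ c₀ + 1 = _ by omega)).reachable
    have hall : ∀ v, (intervalGraph (rank ρ τ) p z).Reachable v c := by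
      intro v
      rcases hnode v.1 v.2.1 v.2.2.1 v.2.2.2 with h | h
      · exact (hadj v c h.1 h.2 rfl (show ρ c₀ + 1 = _ by omega)).reachable
      · exact (hadj d v rfl (show τ d₀ + 1 = _ by omega) h.1 h.2).reachable.symm.trans hdc
    exact fun v w => (hall v).trans (hall w).symm

theorem isCellular (hX : IsCellular ρ k) (hY : IsCellular τ l) :
    IsCellular (rank ρ τ : Join X Y → ℕ) (k + l) where
  finite := by
    have := hX.finite
    have := hY.finite
    exact Subtype.finite
  bot := by
    rw [rank_of_ne_top ρ τ (p := ⊥) fun e => bot_ne_top (α := X) (ext_iff.1 e).1, fst_bot, snd_bot, hX.bot, hY.bot]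
  covBy := rank_covBy hX hY
  top := by rw [rank_top, hX.top, hY.top]; omega
  two := two hX hY
  preconnected := preconnected hX hY

end Join

end

end CellPM

namespace CellPM

noncomputable section

open Classical Finset

attribute [local instance 2000] Proper.decidableEq

section Clique

variable {V W : Type*}

/-- The complex of all finite nonempty sets on which a relation holds throughout. -/
def cliqueComplex (C : V → V → Prop) : PreAbstractSimplicialComplex V where
  faces := {s | s.Nonempty ∧ ∀ p ∈ s, ∀ q ∈ s, C p q}
  isRelLowerSet_faces := by
    rintro s ⟨hs, hc⟩
    exact ⟨hs, fun t hts ht => ⟨ht, fun p hp q hq => hc p (hts hp) q (hts hq)⟩⟩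

theorem face_cliqueComplex {C : V → V → Prop} {s : Finset V} :
    Face (cliqueComplex C) s ↔ ∀ p ∈ s, ∀ q ∈ s, C p q := by
  constructor
  · rintro (rfl | h)
    · simp
    · exact h.2
  · intro h
    rcases s.eq_empty_or_nonempty with rfl | hs
    · exact Or.inl rfl
    · exact Or.inr ⟨hs, h⟩

theorem starringAt_cliqueComplex {C C' : V → V → Prop}
    (hsymm : ∀ p q, C p q → C q p) {a b u : V} (hu : ¬ C u u) (haa : C a a) (hbb : C b b)
    (hab : C a b) (huu : C' u u)
    (hold : ∀ p q, p ≠ u → q ≠ u → (C' p q ↔ C p q ∧ ¬ (p = a ∧ q = b) ∧ ¬ (p = b ∧ q = a)))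
    (hnew : ∀ p, p ≠ u → (C' u p ↔ C p p ∧ C a p ∧ C b p))
    (hnew' : ∀ p, p ≠ u → (C' p u ↔ C p p ∧ C a p ∧ C b p)) :
    StarringAt (cliqueComplex C) (cliqueComplex C') {a, b} u := by
  have hau : a ≠ u := by rintro rfl; exact hu haa
  have hbu : b ≠ u := by rintro rfl; exact hu hbb
  have hba := hsymm _ _ hab
  refine StarringAt.of_face_iff ?_ ?_ fun s => ?_
  · refine (face_cliqueComplex.2 ?_).mem ⟨a, by simp⟩
    intro p hp q hq
    simp only [mem_insert, mem_singleton] at hp hq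
    rcases hp with rfl | rfl <;> rcases hq with rfl | rfl <;> assumption
  · intro h
    exact hu (face_cliqueComplex.1 (face_singleton.2 h) u (by simp) u (by simp))
  · rw [face_cliqueComplex, face_cliqueComplex]
    constructor
    · intro h
      have hnot : ¬ (a ∈ s ∧ b ∈ s) := fun ⟨h1, h2⟩ =>
        ((hold a b hau hbu).1 (h a h1 b h2)).2.1 ⟨rfl, rfl⟩
      refine ⟨fun h' => hnot ⟨h' (by simp), h' (by simp)⟩, ?_⟩
      have hss : ∀ p ∈ s, p ≠ u → ∀ q ∈ s, q ≠ u → C p q := fun p hp hpu q hq hqu =>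
        ((hold p q hpu hqu).1 (h p hp q hq)).1
      rw [unstar]
      split_ifs with hus
      · have h1 : ∀ p ∈ s, p ≠ u → C a p ∧ C b p := fun p hp hpu =>
          ((hnew p hpu).1 (h u hus p hp)).2
        intro p hp q hq
        simp only [mem_union, mem_erase, mem_insert, mem_singleton] at hp hq
        rcases hp with hp | rfl | rfl <;> rcases hq with hq | rfl | rfl
        · exact hss p hp.2 hp.1 q hq.2 hq.1
        · exact hsymm _ _ (h1 p hp.2 hp.1).1
        · exact hsymm _ _ (h1 p hp.2 hp.1).2
        · exact (h1 q hq.2 hq.1).1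
        · exact haa
        · exact hab
        · exact (h1 q hq.2 hq.1).2
        · exact hba
        · exact hbb
      · intro p hp q hq
        exact hss p hp (fun e => hus (e ▸ hp)) q hq (fun e => hus (e ▸ hq))
    · rintro ⟨hnot, h⟩
      have hnot' : ¬ (a ∈ s ∧ b ∈ s) := by
        rintro ⟨h1, h2⟩
        refine hnot fun x hx => ?_
        simp only [mem_insert, mem_singleton] at hx
        rcases hx with rfl | rfl <;> assumption
      have hmem : ∀ p ∈ s, p ≠ u → p ∈ unstar {a, b} u s := fun p hp hpu =>
        StarringAt.erase_subset_unstar (mem_erase.2 ⟨hpu, hp⟩)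
      have hc : ∀ p, p ≠ u → p ∈ s → u ∈ s → C p p ∧ C a p ∧ C b p := by
        intro p hpu hp hus
        have hsub := StarringAt.center_subset_unstar (σ := {a, b}) hus
        have hp' := hmem p hp hpu
        exact ⟨h p hp' p hp', h a (hsub (by simp)) p hp', h b (hsub (by simp)) p hp'⟩
      intro p hp q hq
      by_cases hpu : p = u
      · subst hpu
        by_cases hqu : q = p
        · subst hqu; exact huu
        · exact (hnew q hqu).2 (hc q hqu hq hp)
      · by_cases hqu : q = u
        · subst hqu
          exact (hnew' p hpu).2 (hc p hpu hp hq)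
        · refine (hold p q hpu hqu).2 ⟨h p (hmem p hp hpu) q (hmem q hq hqu), ?_, ?_⟩
          · rintro ⟨rfl, rfl⟩; exact hnot' ⟨hp, hq⟩
          · rintro ⟨rfl, rfl⟩; exact hnot' ⟨hq, hp⟩

theorem unstar_image {g : V → W} (hg : Function.Injective g) (σ : Finset V) (v : V)
    (s : Finset V) :
    unstar (σ.image g) (g v) (s.image g) = (unstar σ v s).image g := by
  simp only [unstar, hg.mem_finset_image]
  split_ifs
  · rw [image_union, image_erase hg]
  · rfl

/-- The image of a complex under a map of the vertices. -/
def imageComplex (g : V → W) (K : PreAbstractSimplicialComplex V) : PreAbstractSimplicialComplex W :=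
  K.map g

theorem isoVia_imageComplex {g : V → W} (hg : Function.Injective g)
    (K : PreAbstractSimplicialComplex V) : IsoVia g K (imageComplex g K) := isoVia_map hg.injOn

theorem StarringAt.map {K K' : PreAbstractSimplicialComplex V} {σ : Finset V} {v : V}
    (h : StarringAt K K' σ v) {g : V → W} (hg : Function.Injective g) :
    StarringAt (imageComplex g K) (imageComplex g K') (σ.image g) (g v) := by
  have h1 : IsoVia g K (imageComplex g K) := isoVia_imageComplex hg K
  have h2 : IsoVia g K' (imageComplex g K') := isoVia_imageComplex hg K'
  refine StarringAt.of_face_iff ?_ ?_ fun t => ?_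
  · exact (h1.face_image (Or.inr h.mem)).mem ((nonempty_of_mem h.mem).image g)
  · intro hv
    obtain ⟨w, hw, e⟩ := h1.mem_vertices_iff.1 hv
    exact h.notMem (hg e ▸ hw)
  · have key : ∀ s : Finset V, Face K' s ↔ ¬ σ.image g ⊆ s.image g ∧
        Face (imageComplex g K) (unstar (σ.image g) (g v) (s.image g)) := by
      intro s
      rw [unstar_image hg, h.face_iff, image_subset_image_iff hg]
      refine and_congr_right fun _ => ⟨fun h' => h1.face_image h', fun h' => ?_⟩
      obtain ⟨s', hs', e⟩ := (h1.face_iff _).1 h'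
      rwa [← image_injective hg e]
    constructor
    · intro ht
      obtain ⟨s, hs, rfl⟩ := (h2.face_iff _).1 ht
      exact (key s).1 hs
    · rintro ⟨h3, h4⟩
      obtain ⟨s, rfl⟩ : ∃ s : Finset V, s.image g = t := by
        have : ∀ w ∈ t, ∃ v, g v = w := by
          intro w hw
          by_cases hwv : w = g v
          · exact ⟨v, hwv.symm⟩
          · obtain ⟨s', -, e⟩ := (h1.face_iff _).1 h4
            have hw' : w ∈ s'.image g := by
              rw [e]; exact erase_subset_unstar (mem_erase.2 ⟨hwv, hw⟩)
            obtain ⟨x, -, e'⟩ := mem_image.1 hw'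
            exact ⟨x, e'⟩
        have hsub : (t : Set W) ⊆ g '' Set.univ := fun w hw => by
          obtain ⟨x, rfl⟩ := this w hw
          exact ⟨x, trivial, rfl⟩
        obtain ⟨s, -, hs⟩ := subset_set_image_iff.1 hsub
        exact ⟨s, hs⟩
      exact h2.face_image ((key s).2 ⟨h3, h4⟩)

theorem IsoVia.comp {U : Type*} {K : PreAbstractSimplicialComplex V}
    {L : PreAbstractSimplicialComplex W} {M : PreAbstractSimplicialComplex U} {f : V → W}
    {g : W → U} (hg : IsoVia g L M) (hf : IsoVia f K L) : IsoVia (g ∘ f) K M := by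
  refine ⟨hg.injOn.comp hf.injOn hf.bijOn.mapsTo, fun t => ?_⟩
  rw [hg.face_iff]
  constructor
  · rintro ⟨s, hs, rfl⟩
    obtain ⟨r, hr, rfl⟩ := (hf.face_iff _).1 hs
    exact ⟨r, hr, by rw [image_image]⟩
  · rintro ⟨r, hr, rfl⟩
    exact ⟨_, hf.face_image hr, by rw [image_image]⟩

end Clique

section JoinStarring

variable {X Y : Type*} [Lattice X] [BoundedOrder X] [Lattice Y] [BoundedOrder Y]
  [Nontrivial X] [Nontrivial Y]

namespace Join

theorem eq_bot_iff {p : Join X Y} : p = ⊥ ↔ p.fst = ⊥ ∧ p.snd = ⊥ := ext_iff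

theorem proper_ext {p q : Proper (Join X Y)} (h1 : p.1.fst = q.1.fst) (h2 : p.1.snd = q.1.snd) :
    p = q := Subtype.ext (ext_iff.2 ⟨h1, h2⟩)

theorem proper_le_iff {p q : Proper (Join X Y)} :
    p ≤ q ↔ p.1.fst ≤ q.1.fst ∧ p.1.snd ≤ q.1.snd := Iff.rfl

theorem proper_not_bot (p : Proper (Join X Y)) : ¬ (p.1.fst = ⊥ ∧ p.1.snd = ⊥) := fun h =>
  p.2.1 (eq_bot_iff.2 h)

theorem exists_proper (x : X) (y : Y) (hx : x ≠ ⊤) (hy : y ≠ ⊤) (h : ¬ (x = ⊥ ∧ y = ⊥)) :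
    ∃ p : Proper (Join X Y), p.1.fst = x ∧ p.1.snd = y :=
  ⟨⟨mk x y hx hy, fun e => h (eq_bot_iff.1 e), mk_ne_top x y hx hy⟩, rfl, rfl⟩

/-- The proper elements both of whose components are different from `⊥`. -/
def IsMixed (p : Proper (Join X Y)) : Prop := p.1.fst ≠ ⊥ ∧ p.1.snd ≠ ⊥

/-- An element is a vertex of the complex in which the mixed elements of `U` have been starred. -/
def Alive (U : Finset (Proper (Join X Y))) (p : Proper (Join X Y)) : Prop :=
  p ∈ U ∨ p.1.fst = ⊥ ∨ p.1.snd = ⊥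

/-- The element `p` of the second factor and the element `q` of the first one span an edge which
has not been starred. -/
def Opposite (U : Finset (Proper (Join X Y))) (p q : Proper (Join X Y)) : Prop :=
  p.1.fst = ⊥ ∧ q.1.snd = ⊥ ∧ ∀ u ∈ U, ¬ (u.1.fst = q.1.fst ∧ u.1.snd = p.1.snd)

/-- The edges of the complex in which the mixed elements of `U` have been starred. -/
def Compat (U : Finset (Proper (Join X Y))) (p q : Proper (Join X Y)) : Prop :=
  Alive U p ∧ Alive U q ∧ (p ≤ q ∨ q ≤ p ∨ Opposite U p q ∨ Opposite U q p)

variable {U : Finset (Proper (Join X Y))} {u p q : Proper (Join X Y)}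

theorem Compat.symm (h : Compat U p q) : Compat U q p := by
  obtain ⟨h1, h2, h3⟩ := h
  exact ⟨h2, h1, by tauto⟩

theorem alive_insert (hp : p ≠ u) : Alive (insert u U) p ↔ Alive U p := by
  simp [Alive, hp]

theorem le_insert_iff (hup : ∀ p ∈ U, ∀ w, p < w → w ∈ U) (hu : u ∉ U) (hm : IsMixed u)
    (habove : ∀ w, u < w → w ∈ U) {a b : Proper (Join X Y)} (ha1 : a.1.fst = u.1.fst)
    (ha2 : a.1.snd = ⊥) (hb1 : b.1.fst = ⊥) (hb2 : b.1.snd = u.1.snd) (hp : Alive U p) :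
    (u ≤ p ∨ p ≤ u) ↔ (a ≤ p ∨ p ≤ a ∨ Opposite U a p ∨ Opposite U p a) ∧
      (b ≤ p ∨ p ≤ b ∨ Opposite U b p ∨ Opposite U p b) := by
  obtain ⟨hm1, hm2⟩ := hm
  have hut := ne_top u.2.2
  have hpt := ne_top p.2.2
  have hau : a ≤ u := proper_le_iff.2 ⟨ha1.le, ha2 ▸ bot_le⟩
  have hbu : b ≤ u := proper_le_iff.2 ⟨hb1 ▸ bot_le, hb2.le⟩
  constructor
  · rintro (h | h)
    · exact ⟨Or.inl (hau.trans h), Or.inl (hbu.trans h)⟩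
    · have hpU : p ∈ U → u = p := fun h' => by
        by_contra hne
        exact hu (hup p h' u (h.lt_of_ne (Ne.symm hne)))
      have hnone : ∀ w ∈ U, ¬ w ≤ u := fun w hw hwu => by
        rcases hwu.eq_or_lt with rfl | hlt
        · exact hu hw
        · exact hu (hup w hw u hlt)
      obtain ⟨hp1, hp2⟩ := proper_le_iff.1 h
      rcases hp with h' | h' | h'
      · exact absurd h (hnone p h')
      · refine ⟨Or.inr (Or.inr (Or.inr ⟨h', ha2, fun w hw e => hnone w hw ?_⟩)),
          Or.inr (Or.inl (proper_le_iff.2 ⟨h' ▸ bot_le, hb2 ▸ hp2⟩))⟩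
        exact proper_le_iff.2 ⟨(e.1.trans ha1).le, e.2 ▸ hp2⟩
      · refine ⟨Or.inr (Or.inl (proper_le_iff.2 ⟨ha1 ▸ hp1, h' ▸ bot_le⟩)),
          Or.inr (Or.inr (Or.inl ⟨hb1, h', fun w hw e => hnone w hw ?_⟩))⟩
        exact proper_le_iff.2 ⟨e.1 ▸ hp1, (e.2.trans hb2).le⟩
  · rintro ⟨h | h | h | h, h'⟩
    · obtain ⟨h1, h2⟩ := proper_le_iff.1 h
      rcases h' with h' | h' | h' | h'
      · exact Or.inl (proper_le_iff.2 ⟨ha1 ▸ h1, hb2 ▸ (proper_le_iff.1 h').2⟩)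
      · refine absurd (le_bot_iff.1 ?_) hm1
        exact ha1 ▸ (h1.trans (proper_le_iff.1 h').1).trans hb1.le
      · obtain ⟨-, h3, h4⟩ := h'
        by_cases e : p.1.fst = u.1.fst
        · exact Or.inr (proper_le_iff.2 ⟨e.le, h3 ▸ bot_le⟩)
        · obtain ⟨w, hw1, hw2⟩ := exists_proper p.1.fst u.1.snd hpt.1 hut.2 fun h => hm2 h.2
          refine absurd ⟨hw1, hw2.trans hb2.symm⟩ (h4 w (habove w (lt_of_le_of_ne ?_ ?_)))
          · exact proper_le_iff.2 ⟨hw1 ▸ ha1 ▸ h1, hw2.ge⟩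
          · rintro rfl; exact e hw1.symm
      · exact absurd (hb2.symm.trans h'.2.1) hm2
    · exact Or.inr (h.trans hau)
    · exact absurd (ha1.symm.trans h.1) hm1
    · obtain ⟨h1, -, h2⟩ := h
      rcases h' with h' | h' | h' | h'
      · by_cases e : p.1.snd = u.1.snd
        · exact Or.inr (proper_le_iff.2 ⟨h1 ▸ bot_le, e.le⟩)
        · obtain ⟨w, hw1, hw2⟩ := exists_proper u.1.fst p.1.snd hut.1 hpt.2 fun h => hm1 h.1
          refine absurd ⟨hw1.trans ha1.symm, hw2⟩ (h2 w (habove w (lt_of_le_of_ne ?_ ?_)))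
          · exact proper_le_iff.2 ⟨hw1.ge, hw2 ▸ hb2 ▸ (proper_le_iff.1 h').2⟩
          · rintro rfl; exact e hw2.symm
      · exact Or.inr (h'.trans hbu)
      · exact absurd ⟨h1, h'.2.1⟩ (proper_not_bot p)
      · exact absurd (hb2.symm.trans h'.2.1) hm2

theorem exists_starringAt_insert (hup : ∀ p ∈ U, ∀ w, p < w → w ∈ U) (hu : u ∉ U) (hm : IsMixed u)
    (habove : ∀ w, u < w → w ∈ U) :
    ∃ σ v, StarringAt (cliqueComplex (Compat U)) (cliqueComplex (Compat (insert u U))) σ v := by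
  have hut := ne_top u.2.2
  obtain ⟨a, ha1, ha2⟩ := exists_proper u.1.fst (⊥ : Y) hut.1 bot_ne_top fun h => hm.1 h.1
  obtain ⟨b, hb1, hb2⟩ := exists_proper (⊥ : X) u.1.snd bot_ne_top hut.2 fun h => hm.2 h.2
  have haA : Alive U a := Or.inr (Or.inr ha2)
  have hbA : Alive U b := Or.inr (Or.inl hb1)
  have hopp : Opposite U b a := ⟨hb1, ha2, fun w hw e =>
    hu (proper_ext (e.1.trans ha1) (e.2.trans hb2) ▸ hw)⟩
  have hnopp : ∀ p q, Opposite (insert u U) p q ↔ Opposite U p q ∧ ¬ (p = b ∧ q = a) := by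
    intro p q
    constructor
    · rintro ⟨h1, h2, h3⟩
      refine ⟨⟨h1, h2, fun w hw => h3 w (mem_insert_of_mem hw)⟩, ?_⟩
      rintro ⟨rfl, rfl⟩
      exact h3 u (mem_insert_self _ _) ⟨ha1.symm, hb2.symm⟩
    · rintro ⟨⟨h1, h2, h3⟩, h4⟩
      refine ⟨h1, h2, fun w hw e => ?_⟩
      rcases mem_insert.1 hw with rfl | hw
      · exact h4 ⟨proper_ext (h1.trans hb1.symm) (e.2.symm.trans hb2.symm),
          proper_ext (e.1.symm.trans ha1.symm) (h2.trans ha2.symm)⟩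
      · exact h3 w hw e
  have hab : ¬ a ≤ b := fun h => hm.1 (le_bot_iff.1 (ha1 ▸ hb1 ▸ (proper_le_iff.1 h).1))
  have hba : ¬ b ≤ a := fun h => hm.2 (le_bot_iff.1 (hb2 ▸ ha2 ▸ (proper_le_iff.1 h).2))
  have hnob : ∀ p, ¬ Opposite (insert u U) u p := fun p h => hm.1 h.1
  have hnob' : ∀ p, ¬ Opposite (insert u U) p u := fun p h => hm.2 h.2.1
  have hself : Alive (insert u U) u := Or.inl (mem_insert_self _ _)
  have hnab : ¬ Opposite U a b := fun h => hm.1 (ha1.symm.trans h.1)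
  have hnew : ∀ p, p ≠ u → (Compat (insert u U) u p ↔ Compat U p p ∧ Compat U a p ∧
      Compat U b p) := by
    intro p hp
    have hiff := fun h => le_insert_iff hup hu hm habove ha1 ha2 hb1 hb2 (p := p) h
    have h1 := hnob p
    have h2 := hnob' p
    have h3 : p ≤ p := le_rfl
    rw [Compat, alive_insert hp]
    constructor
    · rintro ⟨-, h4, h5⟩
      obtain ⟨h6, h7⟩ := (hiff h4).1 (by tauto)
      exact ⟨⟨h4, h4, Or.inl h3⟩, ⟨haA, h4, h6⟩, hbA, h4, h7⟩
    · rintro ⟨-, ⟨-, h4, h6⟩, -, -, h7⟩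
      have := (hiff h4).2 ⟨h6, h7⟩
      exact ⟨hself, h4, this.imp_right Or.inl⟩
  refine ⟨_, u, starringAt_cliqueComplex (fun _ _ => Compat.symm) ?_ ⟨haA, haA, Or.inl le_rfl⟩
    ⟨hbA, hbA, Or.inl le_rfl⟩ ⟨haA, hbA, Or.inr (Or.inr (Or.inr hopp))⟩
    ⟨hself, hself, Or.inl le_rfl⟩ ?_ hnew fun p hp => ?_⟩
  · rintro ⟨h | h | h, -⟩
    · exact hu h
    · exact hm.1 h
    · exact hm.2 h
  · intro p q hp hq
    rw [Compat, Compat, alive_insert hp, alive_insert hq, hnopp, hnopp]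
    constructor
    · rintro ⟨h1, h2, h3⟩
      refine ⟨⟨h1, h2, h3.imp_right (Or.imp_right (Or.imp And.left And.left))⟩, ?_, ?_⟩
      · rintro ⟨rfl, rfl⟩
        rcases h3 with h | h | h | h
        exacts [hab h, hba h, hnab h.1, h.2 ⟨rfl, rfl⟩]
      · rintro ⟨rfl, rfl⟩
        rcases h3 with h | h | h | h
        exacts [hba h, hab h, h.2 ⟨rfl, rfl⟩, hnab h.1]
    · rintro ⟨⟨h1, h2, h3⟩, h4, h5⟩
      refine ⟨h1, h2, h3.imp_right (Or.imp_right (Or.imp (fun h => ⟨h, h5⟩) fun h => ⟨h, ?_⟩))⟩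
      rintro ⟨rfl, rfl⟩
      exact h4 ⟨rfl, rfl⟩
  · rw [← hnew p hp]
    exact ⟨Compat.symm, Compat.symm⟩

theorem reflTransGen_starring (U : Finset (Proper (Join X Y)))
    (hup : ∀ p ∈ U, ∀ w, p < w → w ∈ U) (hm : ∀ p ∈ U, IsMixed p) :
    Relation.ReflTransGen (fun K K' => ∃ σ v, StarringAt K K' σ v)
      (cliqueComplex (Compat (X := X) (Y := Y) ∅)) (cliqueComplex (Compat U)) := by
  induction hn : U.card generalizing U with
  | zero =>
    rw [card_eq_zero.1 hn]
  | succ n ih =>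
    obtain ⟨u, hu⟩ := U.exists_minimal (card_pos.1 (by omega))
    have h1 : ∀ w, u < w → w ∈ U.erase u := fun w hw =>
      mem_erase.2 ⟨hw.ne', hup u hu.1 w hw⟩
    have hup' : ∀ p ∈ U.erase u, ∀ w, p < w → w ∈ U.erase u := fun p hp w hw => by
      refine mem_erase.2 ⟨?_, hup p (mem_of_mem_erase hp) w hw⟩
      rintro rfl
      exact hu.not_lt (mem_of_mem_erase hp) hw
    refine (ih (U.erase u) hup' (fun p hp => hm p (mem_of_mem_erase hp))
      (by rw [card_erase_of_mem hu.1]; omega)).tail ?_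
    have := exists_starringAt_insert hup' (notMem_erase u U) (hm u hu.1) h1
    rwa [insert_erase hu.1] at this

theorem exists_cliqueComplex_eq_barycentric [Finite X] [Finite Y] :
    ∃ U : Finset (Proper (Join X Y)), (∀ p ∈ U, ∀ w, p < w → w ∈ U) ∧ (∀ p ∈ U, IsMixed p) ∧
      cliqueComplex (Compat U) = barycentric (Join X Y) := by
  have : Finite (Join X Y) := Subtype.finite
  have : Fintype (Proper (Join X Y)) := Fintype.ofFinite _
  refine ⟨univ.filter IsMixed, ?_, by simp, ?_⟩
  · intro p hp w hw
    simp only [mem_filter, mem_univ, true_and, IsMixed] at hp ⊢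
    obtain ⟨h1, h2⟩ := proper_le_iff.1 hw.le
    exact ⟨ne_bot_of_le_ne_bot hp.1 h1, ne_bot_of_le_ne_bot hp.2 h2⟩
  · refine eq_of_face_iff fun s => ?_
    rw [face_cliqueComplex, face_barycentric]
    have halive : ∀ p : Proper (Join X Y), Alive (univ.filter IsMixed) p := by
      intro p
      simp only [Alive, mem_filter, mem_univ, true_and, IsMixed]
      tauto
    have hopp : ∀ p q : Proper (Join X Y), ¬ Opposite (univ.filter IsMixed) p q := by
      rintro p q ⟨h1, h2, h3⟩
      have hp : p.1.snd ≠ ⊥ := fun h => proper_not_bot p ⟨h1, h⟩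
      have hq : q.1.fst ≠ ⊥ := fun h => proper_not_bot q ⟨h, h2⟩
      obtain ⟨w, hw1, hw2⟩ := exists_proper q.1.fst p.1.snd (ne_top q.2.2).1 (ne_top p.2.2).2
        fun h => hq h.1
      refine h3 w ?_ ⟨hw1, hw2⟩
      simp only [mem_filter, mem_univ, true_and, IsMixed]
      exact ⟨hw1 ▸ hq, hw2 ▸ hp⟩
    constructor
    · intro h p hp q hq _
      have h1 := hopp p q
      have h2 := hopp q p
      have := (h p hp q hq).2.2
      tauto
    · intro h p hp q hq
      have := h.total hp hq
      exact ⟨halive p, halive q, by tauto⟩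

/-- The vertices of the join of the barycentric subdivisions, as elements of the join. -/
def ofSum : Proper X ⊕ Proper Y → Proper (Join X Y)
  | .inl x => ⟨mk x ⊥ x.2.2 bot_ne_top, fun e => x.2.1 (eq_bot_iff.1 e).1, mk_ne_top _ _ _ _⟩
  | .inr y => ⟨mk ⊥ y bot_ne_top y.2.2, fun e => y.2.1 (eq_bot_iff.1 e).2, mk_ne_top _ _ _ _⟩

theorem ofSum_injective : Function.Injective (ofSum (X := X) (Y := Y)) := by
  rintro (a | a) (b | b) h
  · have := (ext_iff.1 (congrArg Subtype.val h)).1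
    exact congrArg _ (Subtype.ext this)
  · have := (ext_iff.1 (congrArg Subtype.val h)).1
    exact absurd this a.2.1
  · have := (ext_iff.1 (congrArg Subtype.val h)).2
    exact absurd this a.2.1
  · have := (ext_iff.1 (congrArg Subtype.val h)).2
    exact congrArg _ (Subtype.ext this)

theorem exists_ofSum_eq {p : Proper (Join X Y)} (h : p.1.fst = ⊥ ∨ p.1.snd = ⊥) :
    ∃ v, ofSum v = p := by
  have hpt := ne_top p.2.2
  rcases h with h | h
  · exact ⟨.inr ⟨p.1.snd, fun h' => proper_not_bot p ⟨h, h'⟩, hpt.2⟩, proper_ext h.symm rfl⟩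
  · exact ⟨.inl ⟨p.1.fst, fun h' => proper_not_bot p ⟨h', h⟩, hpt.1⟩, proper_ext rfl h.symm⟩

theorem compat_ofSum (v w : Proper X ⊕ Proper Y) :
    Compat ∅ (ofSum v) (ofSum w) ↔
      (∀ a b, v = .inl a → w = .inl b → a ≤ b ∨ b ≤ a) ∧
      (∀ a b, v = .inr a → w = .inr b → a ≤ b ∨ b ≤ a) := by
  have halive : ∀ v : Proper X ⊕ Proper Y, Alive ∅ (ofSum v) := by
    rintro (a | a)
    · exact Or.inr (Or.inr rfl)
    · exact Or.inr (Or.inl rfl)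
  have hll : ∀ a b : Proper X, ofSum (Y := Y) (.inl a) ≤ ofSum (.inl b) ↔ a ≤ b := fun a b =>
    ⟨fun h => (proper_le_iff.1 h).1, fun h => proper_le_iff.2 ⟨h, le_rfl⟩⟩
  have hrr : ∀ a b : Proper Y, ofSum (X := X) (.inr a) ≤ ofSum (.inr b) ↔ a ≤ b := fun a b =>
    ⟨fun h => (proper_le_iff.1 h).2, fun h => proper_le_iff.2 ⟨le_rfl, h⟩⟩
  have hopp : ∀ (a : Proper X) (b : Proper Y), Opposite ∅ (ofSum (.inr b)) (ofSum (.inl a)) :=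
    fun a b => ⟨rfl, rfl, by simp⟩
  have hnl : ∀ (a : Proper X) q, ¬ Opposite ∅ (ofSum (Y := Y) (.inl a)) q := fun a q h => a.2.1 h.1
  have hnr : ∀ (a : Proper Y) q, ¬ Opposite ∅ q (ofSum (X := X) (.inr a)) := fun a q h =>
    a.2.1 h.2.1
  rcases v with a | a <;> rcases w with b | b
  · simp [Compat, halive, hll, hnl]
  · simp [Compat, halive, hopp]
  · simp [Compat, halive, hopp]
  · simp [Compat, halive, hrr, hnr]

theorem isoVia_ofSum : IsoVia (ofSum (X := X) (Y := Y))
    (joinComplex (barycentric X) (barycentric Y)) (cliqueComplex (Compat ∅)) := by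
  have hface : ∀ s : Finset (Proper X ⊕ Proper Y),
      Face (joinComplex (barycentric X) (barycentric Y)) s ↔
        ∀ v ∈ s, ∀ w ∈ s, Compat ∅ (ofSum v) (ofSum w) := by
    intro s
    simp only [face_joinComplex, face_barycentric, compat_ofSum]
    constructor
    · rintro ⟨h1, h2⟩ v hv w hw
      refine ⟨?_, ?_⟩
      · rintro a b rfl rfl
        exact h1.total (by simpa using hv) (by simpa using hw)
      · rintro a b rfl rfl
        exact h2.total (by simpa using hv) (by simpa using hw)
    · intro h
      refine ⟨fun a ha b hb _ => ?_, fun a ha b hb _ => ?_⟩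
      · exact (h (.inl a) (by simpa using ha) (.inl b) (by simpa using hb)).1 a b rfl rfl
      · exact (h (.inr a) (by simpa using ha) (.inr b) (by simpa using hb)).2 a b rfl rfl
  refine ⟨ofSum_injective.injOn, fun t => ?_⟩
  rw [face_cliqueComplex]
  constructor
  · intro h
    have hsub : (t : Set (Proper (Join X Y))) ⊆ ofSum '' Set.univ := fun p hp => by
      obtain ⟨v, rfl⟩ := exists_ofSum_eq (p := p) (by simpa [Alive] using (h p hp p hp).1)
      exact ⟨v, trivial, rfl⟩
    obtain ⟨s, -, rfl⟩ := subset_set_image_iff.1 hsub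
    exact ⟨s, (hface s).2 fun v hv w hw => h _ (mem_image_of_mem _ hv) _ (mem_image_of_mem _ hw), rfl⟩
  · rintro ⟨s, hs, rfl⟩ p hp q hq
    obtain ⟨v, hv, rfl⟩ := mem_image.1 hp
    obtain ⟨w, hw, rfl⟩ := mem_image.1 hq
    exact (hface s).1 hs v hv w hw

theorem isStellarSubdivision [Finite X] [Finite Y] (hne : Nonempty (Proper X)) :
    IsStellarSubdivision (barycentric (Join X Y))
      (joinComplex (barycentric X) (barycentric Y)) := by
  have : Finite (Join X Y) := Subtype.finite
  have : Nonempty (Proper X ⊕ Proper Y) := hne.map Sum.inl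
  have : Nonempty (Proper (Join X Y)) := hne.map fun x => ofSum (.inl x)
  obtain ⟨g, hg⟩ := exists_injective_nat (Proper (Join X Y))
  obtain ⟨U, hup, hm, hU⟩ := exists_cliqueComplex_eq_barycentric (X := X) (Y := Y)
  have hseq := reflTransGen_starring U hup hm
  rw [hU] at hseq
  refine ⟨imageComplex g (cliqueComplex (Compat ∅)), imageComplex g (barycentric (Join X Y)), ?_, ?_, ?_⟩
  · exact ((isoVia_imageComplex hg _).comp isoVia_ofSum).symm.isIsomorphic
  · refine hseq.lift (imageComplex g) ?_
    rintro K K' ⟨σ, v, h⟩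
    exact (h.map hg).isStarring
  · exact (isoVia_imageComplex hg _).symm.isIsomorphic

end Join

end JoinStarring

end

end CellPM

namespace CellPM

noncomputable section

open Classical Finset

attribute [local instance 2000] Proper.decidableEq

section Above

variable {Z : Type*} [Lattice Z] [BoundedOrder Z]

/-- The complex of all chains of proper elements above a given element. -/
def aboveComplex (a : Z) : PreAbstractSimplicialComplex (Proper Z) where
  faces := {s | s.Nonempty ∧ IsChain (· ≤ ·) (s : Set (Proper Z)) ∧ ∀ x ∈ s, a < x}
  isRelLowerSet_faces := by
    rintro s ⟨hs, hc, ha⟩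
    exact ⟨hs, fun t hts ht => ⟨ht, isChain_mono hc hts, fun x hx => ha x (hts hx)⟩⟩

theorem face_aboveComplex {a : Z} {s : Finset (Proper Z)} :
    Face (aboveComplex a) s ↔ IsChain (· ≤ ·) (s : Set (Proper Z)) ∧ ∀ x ∈ s, a < x := by
  constructor
  · rintro (rfl | h)
    · simp
    · exact h.2
  · intro h
    rcases s.eq_empty_or_nonempty with rfl | hs
    · exact Or.inl rfl
    · exact Or.inr ⟨hs, h⟩

theorem aboveComplex_bot : aboveComplex (⊥ : Z) = barycentric Z := by
  refine eq_of_face_iff fun s => ?_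
  rw [face_aboveComplex, face_barycentric]
  exact and_iff_left fun x _ => bot_lt_iff_ne_bot.2 x.2.1

theorem mem_vertices_aboveComplex {a : Z} {p : Proper Z} (h : a < p) :
    p ∈ vertices (aboveComplex a) :=
  face_singleton.1 (face_aboveComplex.2 ⟨by simp, by simpa using h⟩)

theorem link_aboveComplex {a : Z} {p : Proper Z} (h : a ⋖ p) :
    link (aboveComplex a) p = aboveComplex (p : Z) := by
  refine eq_of_face_iff fun s => ?_
  rw [face_link (mem_vertices_aboveComplex h.lt), face_aboveComplex, face_aboveComplex]
  constructor
  · rintro ⟨hps, hc, ha⟩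
    refine ⟨isChain_mono hc (subset_insert _ _), fun x hx => ?_⟩
    have hne : x ≠ p := fun e => hps (e ▸ hx)
    rcases hc.total (mem_coe.2 (mem_insert_self p s)) (mem_coe.2 (mem_insert_of_mem hx)) with h' | h'
    · exact lt_of_le_of_ne h' fun e => hne (Subtype.ext e.symm)
    · exact absurd (lt_of_le_of_ne (show x ≤ p from h') hne) (h.2 (ha x (mem_insert_of_mem hx)))
  · rintro ⟨hc, ha⟩
    refine ⟨fun hp => lt_irrefl _ (ha p hp), isChain_insert hc fun x hx => Or.inl (ha x hx).le, ?_⟩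
    intro x hx
    rcases mem_insert.1 hx with rfl | hx
    · exact h.lt
    · exact h.lt.trans (ha x hx)

theorem isCombinatorialSphere_aboveComplex {ρ : Z → ℕ} {k : ℕ} (hZ : IsCellular ρ k)
    (h : IsCombinatorialManifold k (barycentric Z)) (p : Proper Z) :
    IsCombinatorialSphere (k - ρ p) (aboveComplex (p : Z)) := by
  have hfin := hZ.finite
  obtain ⟨r, hr⟩ : ∃ r, ρ p = r + 1 := ⟨ρ p - 1, by have := hZ.rank_pos p; omega⟩
  induction r generalizing p with
  | zero =>
    have hcov : ⊥ ⋖ (p : Z) := by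
      refine ⟨bot_lt_iff_ne_bot.2 p.2.1, fun c h1 h2 => ?_⟩
      have h3 := hZ.strictMono h1
      have h4 := hZ.strictMono h2
      omega
    rw [← link_aboveComplex hcov, aboveComplex_bot, hr]
    refine h.2 p ?_
    rw [← aboveComplex_bot]
    exact mem_vertices_aboveComplex hcov.lt
  | succ r ih =>
    obtain ⟨q, hq1, hq2, hq3⟩ := exists_rank_between hZ.covBy (a := ⊥) (b := (p : Z)) bot_le
      (r := r + 1) (by rw [hZ.bot]; omega) (by omega)
    have hcov : q ⋖ (p : Z) := by
      refine ⟨hq2, fun c h1 h2 => ?_⟩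
      have h3 := hZ.strictMono h1
      have h4 := hZ.strictMono h2
      omega
    have hle := hZ.rank_le p
    have := ih ⟨q, hq1.ne', (hq2.trans_le le_top).ne⟩ hq3
    have e : k - ρ q = (k - ρ p) + 1 := by omega
    simp only [e] at this
    rw [← link_aboveComplex hcov]
    exact this.link (mem_vertices_aboveComplex hcov.lt)

theorem IsCellular.exists_coatom {ρ : Z → ℕ} {k : ℕ} (hZ : IsCellular ρ (k + 1)) :
    ∃ x : Proper Z, ρ x = k + 1 := by
  have hfin := hZ.finite
  obtain ⟨x, h1, h2, h3⟩ := exists_rank_between hZ.covBy (a := ⊥) (b := (⊤ : Z)) bot_le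
    (r := k + 1) (by rw [hZ.bot]; omega) (by rw [hZ.top]; omega)
  exact ⟨⟨x, h1.ne', h2.ne⟩, h3⟩

end Above

namespace Join

variable {X Y : Type*} [Lattice X] [BoundedOrder X] [Lattice Y] [BoundedOrder Y]
  [Nontrivial X] [Nontrivial Y] {ρ : X → ℕ} {τ : Y → ℕ} {k l : ℕ}

theorem isoVia_of_chain {Z Z' : Type*} [Lattice Z] [BoundedOrder Z] [Lattice Z'] [BoundedOrder Z']
    {a : Z'} (f : Proper Z → Proper Z') (hf : ∀ x y, f x ≤ f y ↔ x ≤ y)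
    (hrange : ∀ q : Proper Z', a < q ↔ ∃ x, f x = q) :
    IsoVia f (barycentric Z) (aboveComplex a) := by
  have hinj : Function.Injective f := fun x y h =>
    ((hf x y).1 h.le).antisymm ((hf y x).1 h.ge)
  refine ⟨hinj.injOn, fun t => ?_⟩
  rw [face_aboveComplex]
  constructor
  · rintro ⟨hc, ha⟩
    have hsub : (t : Set (Proper Z')) ⊆ f '' Set.univ := fun p hp => by
      obtain ⟨v, rfl⟩ := (hrange p).1 (ha p hp)
      exact ⟨v, trivial, rfl⟩
    obtain ⟨s, -, rfl⟩ := subset_set_image_iff.1 hsub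
    refine ⟨s, face_barycentric.2 fun x hx y hy _ => ?_, rfl⟩
    have := hc.total (mem_coe.2 (mem_image_of_mem f hx)) (mem_coe.2 (mem_image_of_mem f hy))
    rwa [hf, hf] at this
  · rintro ⟨s, hs, rfl⟩
    rw [face_barycentric] at hs
    refine ⟨fun p hp q hq _ => ?_, fun p hp => ?_⟩
    · obtain ⟨x, hx, rfl⟩ := mem_image.1 hp
      obtain ⟨y, hy, rfl⟩ := mem_image.1 hq
      exact (hs.total hx hy).imp (hf x y).2 (hf y x).2
    · obtain ⟨x, -, rfl⟩ := mem_image.1 hp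
      exact (hrange _).2 ⟨x, rfl⟩

theorem isCombinatorialSphere_right (hX : IsCellular ρ (k + 1)) (hY : IsCellular τ (l + 1))
    (h : IsCombinatorialManifold (k + 1 + (l + 1)) (barycentric (Join X Y))) :
    IsCombinatorialSphere (l + 1) (barycentric Y) := by
  obtain ⟨x, hx⟩ := hX.exists_coatom
  obtain ⟨y₀, -⟩ := hY.exists_coatom
  have : Nonempty (Proper Y) := ⟨y₀⟩
  let f : Proper Y → Proper (Join X Y) := fun y =>
    ⟨mk x y x.2.2 y.2.2, fun e => x.2.1 (eq_bot_iff.1 e).1, mk_ne_top _ _ _ _⟩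
  let p : Proper (Join X Y) :=
    ⟨mk x ⊥ x.2.2 bot_ne_top, fun e => x.2.1 (eq_bot_iff.1 e).1, mk_ne_top _ _ _ _⟩
  have hp : rank ρ τ p.1 = k + 1 := by
    rw [rank_of_ne_top ρ τ p.2.2]
    show ρ x + τ ⊥ = k + 1
    rw [hx, hY.bot]
  have h1 := isCombinatorialSphere_aboveComplex (isCellular hX hY) h p
  rw [hp, Nat.add_sub_cancel_left] at h1
  have hiso : IsoVia f (barycentric Y) (aboveComplex p.1) := by
    refine isoVia_of_chain f (fun a b => ?_) fun q => ?_
    · exact ⟨fun h => (proper_le_iff.1 h).2, fun h => proper_le_iff.2 ⟨le_rfl, h⟩⟩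
    · constructor
      · intro hq
        obtain ⟨h2, -, h3⟩ := lt_iff.1 hq
        have e : (x : X) = q.1.fst := eq_of_le_of_rank hX h2 (by
          have := (rank_lt_of_ne_top hX hY q.2.2).1
          omega)
        have hq0 : q.1.snd ≠ ⊥ := fun h' => h3 (ext_iff.2 ⟨e, h'.symm⟩)
        exact ⟨⟨q.1.snd, hq0, (ne_top q.2.2).2⟩, proper_ext e rfl⟩
      · rintro ⟨y, rfl⟩
        exact lt_iff.2 ⟨le_rfl, bot_le, fun e => y.2.1 (ext_iff.1 e).2.symm⟩
  exact hiso.symm.isCombinatorialSphere h1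

theorem isCombinatorialSphere_left (hX : IsCellular ρ (k + 1)) (hY : IsCellular τ (l + 1))
    (h : IsCombinatorialManifold (k + 1 + (l + 1)) (barycentric (Join X Y))) :
    IsCombinatorialSphere (k + 1) (barycentric X) := by
  obtain ⟨y, hy⟩ := hY.exists_coatom
  obtain ⟨x₀, -⟩ := hX.exists_coatom
  have : Nonempty (Proper X) := ⟨x₀⟩
  let f : Proper X → Proper (Join X Y) := fun x =>
    ⟨mk x y x.2.2 y.2.2, fun e => y.2.1 (eq_bot_iff.1 e).2, mk_ne_top _ _ _ _⟩
  let p : Proper (Join X Y) :=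
    ⟨mk ⊥ y bot_ne_top y.2.2, fun e => y.2.1 (eq_bot_iff.1 e).2, mk_ne_top _ _ _ _⟩
  have hp : rank ρ τ p.1 = l + 1 := by
    rw [rank_of_ne_top ρ τ p.2.2]
    show ρ ⊥ + τ y = l + 1
    rw [hy, hX.bot, zero_add]
  have h1 := isCombinatorialSphere_aboveComplex (isCellular hX hY) h p
  rw [hp, Nat.add_sub_cancel] at h1
  have hiso : IsoVia f (barycentric X) (aboveComplex p.1) := by
    refine isoVia_of_chain f (fun a b => ?_) fun q => ?_
    · exact ⟨fun h => (proper_le_iff.1 h).1, fun h => proper_le_iff.2 ⟨h, le_rfl⟩⟩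
    · constructor
      · intro hq
        obtain ⟨-, h2, h3⟩ := lt_iff.1 hq
        have e : (y : Y) = q.1.snd := eq_of_le_of_rank hY h2 (by
          have := (rank_lt_of_ne_top hX hY q.2.2).2
          omega)
        have hq0 : q.1.fst ≠ ⊥ := fun h' => h3 (ext_iff.2 ⟨h'.symm, e⟩)
        exact ⟨⟨q.1.fst, hq0, (ne_top q.2.2).1⟩, proper_ext rfl e⟩
      · rintro ⟨x, rfl⟩
        exact lt_iff.2 ⟨bot_le, le_rfl, fun e => x.2.1 (ext_iff.1 e).1.symm⟩
  exact hiso.symm.isCombinatorialSphere h1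

theorem isCellularPseudomanifold {m n : ℕ} (hX : IsCellularPseudomanifold X (m + 1))
    (hY : IsCellularPseudomanifold Y (n + 1)) :
    IsCellularPseudomanifold (Join X Y) (m + n + 2) := by
  obtain ⟨ρ, hρ⟩ := isCellularPseudomanifold_iff.1 hX
  obtain ⟨τ, hτ⟩ := isCellularPseudomanifold_iff.1 hY
  have e : m + n + 2 = m + 1 + (n + 1) := by omega
  rw [e]
  exact isCellularPseudomanifold_iff.2 ⟨_, isCellular hρ hτ⟩

theorem isStellarSubdivision_of_isCellularPseudomanifold {m n : ℕ}
    (hX : IsCellularPseudomanifold X (m + 1)) (hY : IsCellularPseudomanifold Y (n + 1)) :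
    IsStellarSubdivision (barycentric (Join X Y))
      (joinComplex (barycentric X) (barycentric Y)) := by
  obtain ⟨ρ, hρ⟩ := isCellularPseudomanifold_iff.1 hX
  have := hX.1
  have := hY.1
  obtain ⟨x, -⟩ := hρ.exists_coatom
  exact isStellarSubdivision ⟨x⟩

omit [Nontrivial X] [Nontrivial Y] in
theorem isNPM_joinComplex {m n : ℕ} (hX : IsCellularPseudomanifold X (m + 1))
    (hY : IsCellularPseudomanifold Y (n + 1)) :
    IsNPM (m + n + 2) (joinComplex (barycentric X) (barycentric Y)) := by
  obtain ⟨ρ, hρ⟩ := isCellularPseudomanifold_iff.1 hX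
  obtain ⟨τ, hτ⟩ := isCellularPseudomanifold_iff.1 hY
  have e : m + n + 2 = m + 1 + (n + 1) := by omega
  rw [e]
  exact hρ.isNPM.join hτ.isNPM

theorem isNPM_barycentric {m n : ℕ} (hX : IsCellularPseudomanifold X (m + 1))
    (hY : IsCellularPseudomanifold Y (n + 1)) :
    IsNPM (m + n + 2) (barycentric (Join X Y)) := by
  obtain ⟨σ, hσ⟩ := isCellularPseudomanifold_iff.1 (isCellularPseudomanifold hX hY)
  exact hσ.isNPM

theorem isSubdivision {m n : ℕ} (hX : IsCellularPseudomanifold X (m + 1))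
    (hY : IsCellularPseudomanifold Y (n + 1)) :
    IsSubdivision (barycentric (Join X Y)) (joinComplex (barycentric X) (barycentric Y)) := by
  obtain ⟨ρ, hρ⟩ := isCellularPseudomanifold_iff.1 hX
  obtain ⟨x, -⟩ := hρ.exists_coatom
  have : Nonempty (Proper X ⊕ Proper Y) := ⟨.inl x⟩
  obtain ⟨F, hF⟩ := (isStellarSubdivision_of_isCellularPseudomanifold hX hY).exists_bijOn
  exact isSubdivision_of_bijOn (isNPM_barycentric hX hY) hF

theorem isCombinatorialSphere {m n : ℕ} (hX : IsCellularPseudomanifold X (m + 1))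
    (hY : IsCellularPseudomanifold Y (n + 1))
    (hX' : IsCombinatorialSphere (m + 1) (barycentric X))
    (hY' : IsCombinatorialSphere (n + 1) (barycentric Y)) :
    IsCombinatorialSphere (m + n + 2) (barycentric (Join X Y)) := by
  obtain ⟨ρ, hρ⟩ := isCellularPseudomanifold_iff.1 hX
  obtain ⟨x, -⟩ := hρ.exists_coatom
  have : Nonempty (Proper X ⊕ Proper Y) := ⟨.inl x⟩
  have : Nonempty (Proper (Join X Y)) := ⟨ofSum (.inl x)⟩
  obtain ⟨J, j, F, G, hJ, hF, hG⟩ := exists_subdivision_join hX' hY'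
  obtain ⟨J', Φ, E, hJ', hΦ, hE⟩ :=
    (isStellarSubdivision_of_isCellularPseudomanifold hX hY).exists_common_subdivision hJ hF
  exact isCombinatorialSphere_iff.2 ⟨isNPM_barycentric hX hY, J', j, E, _, hJ', hE,
    bijOn_comp hG hΦ⟩

theorem isCombinatorialSphere_of_isCombinatorialManifold {m n : ℕ}
    (hX : IsCellularPseudomanifold X (m + 1)) (hY : IsCellularPseudomanifold Y (n + 1))
    (h : IsCombinatorialManifold (m + n + 2) (barycentric (Join X Y))) :
    IsCombinatorialSphere (m + 1) (barycentric X) ∧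
      IsCombinatorialSphere (n + 1) (barycentric Y) := by
  obtain ⟨ρ, hρ⟩ := isCellularPseudomanifold_iff.1 hX
  obtain ⟨τ, hτ⟩ := isCellularPseudomanifold_iff.1 hY
  have e : m + n + 2 = m + 1 + (n + 1) := by omega
  rw [e] at h
  exact ⟨isCombinatorialSphere_left hρ hτ h, isCombinatorialSphere_right hρ hτ h⟩

end Join

end

end CellPM

namespace CellPM

section Exposed

variable {E E' : Type*} [NormedAddCommGroup E] [NormedSpace ℝ E] [NormedAddCommGroup E']
  [NormedSpace ℝ E']

theorem isExposed_image (f : E ≃ E')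
    (hf : ∀ l : StrongDual ℝ E, ∃ (l' : StrongDual ℝ E') (c : ℝ), ∀ x, l' (f x) = l x + c)
    {A F : Set E} (h : IsExposed ℝ A F) : IsExposed ℝ (f '' A) (f '' F) := by
  intro hne
  obtain ⟨l, hl⟩ := h (Set.image_nonempty.1 hne)
  obtain ⟨l', c, hl'⟩ := hf l
  refine ⟨l', Set.ext fun y => ?_⟩
  constructor
  · rintro ⟨x, hx, rfl⟩
    rw [hl] at hx
    refine ⟨⟨x, hx.1, rfl⟩, ?_⟩
    rintro _ ⟨z, hz, rfl⟩
    rw [hl', hl']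
    linarith [hx.2 z hz]
  · rintro ⟨⟨x, hx, rfl⟩, h2⟩
    refine ⟨x, ?_, rfl⟩
    rw [hl]
    refine ⟨hx, fun z hz => ?_⟩
    have := h2 (f z) ⟨z, hz, rfl⟩
    rw [hl', hl'] at this
    linarith

/-- An affine isomorphism identifies the posets of exposed faces. -/
def exposedOrderIso (f : E ≃ E')
    (hf : ∀ l : StrongDual ℝ E, ∃ (l' : StrongDual ℝ E') (c : ℝ), ∀ x, l' (f x) = l x + c)
    (hf' : ∀ l : StrongDual ℝ E', ∃ (l' : StrongDual ℝ E) (c : ℝ), ∀ x, l' (f.symm x) = l x + c)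
    (A : Set E) :
    {F : Set E // IsExposed ℝ A F} ≃o {F : Set E' // IsExposed ℝ (f '' A) F} where
  toFun F := ⟨f '' F, isExposed_image f hf F.2⟩
  invFun G := ⟨f.symm '' G, by
    have := isExposed_image f.symm hf' G.2
    rwa [f.symm_image_image] at this⟩
  left_inv F := Subtype.ext (f.symm_image_image F)
  right_inv G := Subtype.ext (f.image_symm_image G)
  map_rel_iff' := Set.image_subset_image_iff f.injective

theorem eq_zero_of_nonpos_of_mem_interior {A : Set E} (h0 : (0 : E) ∈ interior A)
    {l : StrongDual ℝ E} (hl : ∀ x ∈ A, l x ≤ 0) : l = 0 := by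
  ext v
  have hc : Filter.Tendsto (fun r : ℝ => r • v) (nhds 0) (nhds 0) := by
    have : Continuous fun r : ℝ => r • v := by fun_prop
    simpa using this.tendsto 0
  have hev := hc.eventually (mem_interior_iff_mem_nhds.1 h0)
  obtain ⟨ε, hε, hball⟩ := Metric.eventually_nhds_iff.1 hev
  have h1 := hl _ (hball (y := ε / 2) (by rw [dist_zero_right, Real.norm_eq_abs, abs_of_pos] <;> linarith))
  have h2 := hl _ (hball (y := -(ε / 2)) (by
    rw [dist_zero_right, Real.norm_eq_abs, abs_neg, abs_of_pos] <;> linarith))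
  rw [map_smul, smul_eq_mul] at h1 h2
  show l v = 0
  nlinarith

/-- If the origin is an interior point, then the proper exposed faces are cut out by the elements
of the polar. -/
theorem isExposed_and_ne_iff {A : Set E} (h0 : (0 : E) ∈ interior A) {F : Set E} :
    IsExposed ℝ A F ∧ F ≠ A ↔
      ∃ l : StrongDual ℝ E, (∀ x ∈ A, l x ≤ 1) ∧ F = {x ∈ A | l x = 1} := by
  have h0A : (0 : E) ∈ A := interior_subset h0
  constructor
  · rintro ⟨hF, hne⟩
    rcases F.eq_empty_or_nonempty with rfl | hF0
    · exact ⟨0, fun x _ => by simp, by simp⟩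
    · obtain ⟨l, hl⟩ := hF hF0
      obtain ⟨x₀, hx₀⟩ := hF0
      rw [hl] at hx₀
      have hpos : 0 < l x₀ := by
        refine lt_of_le_of_ne (by simpa using hx₀.2 0 h0A) fun e => hne ?_
        have : l = 0 := eq_zero_of_nonpos_of_mem_interior h0 fun x hx => e ▸ hx₀.2 x hx
        rw [hl, this]
        simp
      have hle : ∀ x ∈ A, (l x₀)⁻¹ * l x ≤ 1 := fun x hx => by
        rw [inv_mul_le_iff₀ hpos, mul_one]
        exact hx₀.2 x hx
      refine ⟨(l x₀)⁻¹ • l, hle, ?_⟩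
      rw [hl]
      ext x
      refine and_congr_right fun hx => ?_
      show _ ↔ (l x₀)⁻¹ * l x = 1
      rw [inv_mul_eq_one₀ hpos.ne']
      constructor
      · intro h
        exact le_antisymm (h x₀ hx₀.1) (hx₀.2 x hx)
      · intro h y hy
        exact h ▸ hx₀.2 y hy
  · rintro ⟨l, hl, rfl⟩
    refine ⟨fun ⟨x₀, hx₀⟩ => ⟨l, Set.ext fun x => and_congr_right fun hx => ?_⟩, fun e => ?_⟩
    · constructor
      · intro h y hy
        rw [h]
        exact hl y hy
      · intro h
        refine le_antisymm (hl x hx) ?_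
        rw [← hx₀.2]
        exact h x₀ hx₀.1
    · rw [← e] at h0A
      simpa using h0A.2

end Exposed

section FreeJoin

variable {E E' : Type*} [NormedAddCommGroup E] [NormedSpace ℝ E] [NormedAddCommGroup E']
  [NormedSpace ℝ E'] {P : Set E} {Q : Set E'}

/-- The convex hull of two sets placed in complementary subspaces. -/
def freeSum (P : Set E) (Q : Set E') : Set (E × E') :=
  convexHull ℝ (LinearMap.inl ℝ E E' '' P ∪ LinearMap.inr ℝ E E' '' Q)

theorem mem_freeSum (hP : Convex ℝ P) (hQ : Convex ℝ Q) (hP0 : P.Nonempty) (hQ0 : Q.Nonempty)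
    {z : E × E'} : z ∈ freeSum P Q ↔ ∃ x ∈ P, ∃ y ∈ Q, ∃ s t : ℝ, 0 ≤ s ∧ 0 ≤ t ∧ s + t = 1 ∧
      z = (s • x, t • y) := by
  rw [freeSum, Convex.convexHull_union (hP.linear_image _) (hQ.linear_image _) (hP0.image _)
    (hQ0.image _), mem_convexJoin]
  constructor
  · rintro ⟨_, ⟨x, hx, rfl⟩, _, ⟨y, hy, rfl⟩, s, t, hs, ht, hst, rfl⟩
    exact ⟨x, hx, y, hy, s, t, hs, ht, hst, by simp⟩
  · rintro ⟨x, hx, y, hy, s, t, hs, ht, hst, rfl⟩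
    exact ⟨_, ⟨x, hx, rfl⟩, _, ⟨y, hy, rfl⟩, s, t, hs, ht, hst, by simp⟩

variable (hP : Convex ℝ P) (hQ : Convex ℝ Q) (hP0 : (0 : E) ∈ interior P)
  (hQ0 : (0 : E') ∈ interior Q)
include hP hQ hP0 hQ0

theorem mem_freeSum_left {x : E} : (x, (0 : E')) ∈ freeSum P Q ↔ x ∈ P := by
  have h0P := interior_subset hP0
  have h0Q := interior_subset hQ0
  rw [mem_freeSum hP hQ ⟨0, h0P⟩ ⟨0, h0Q⟩]
  constructor
  · rintro ⟨x', hx', y, -, s, t, hs, ht, hst, e⟩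
    rw [show x = s • x' from (Prod.ext_iff.1 e).1]
    exact hP.smul_mem_of_zero_mem h0P hx' ⟨hs, by linarith⟩
  · intro hx
    exact ⟨x, hx, 0, h0Q, 1, 0, by simp, le_rfl, by simp, by simp⟩

theorem mem_freeSum_right {y : E'} : ((0 : E), y) ∈ freeSum P Q ↔ y ∈ Q := by
  have h0P := interior_subset hP0
  have h0Q := interior_subset hQ0
  rw [mem_freeSum hP hQ ⟨0, h0P⟩ ⟨0, h0Q⟩]
  constructor
  · rintro ⟨x, -, y', hy', s, t, hs, ht, hst, e⟩
    rw [show y = t • y' from (Prod.ext_iff.1 e).2]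
    exact hQ.smul_mem_of_zero_mem h0Q hy' ⟨ht, by linarith⟩
  · intro hy
    exact ⟨0, h0P, y, hy, 0, 1, le_rfl, by simp, by simp, by simp⟩

theorem zero_mem_interior_freeSum : (0 : E × E') ∈ interior (freeSum P Q) := by
  have h0P := interior_subset hP0
  have h0Q := interior_subset hQ0
  rw [mem_interior_iff_mem_nhds] at hP0 hQ0 ⊢
  have hc : Filter.Tendsto (fun z : E × E' => (2 : ℝ) • z) (nhds 0) (nhds 0) := by
    have : Continuous fun z : E × E' => (2 : ℝ) • z := by fun_prop
    simpa using this.tendsto 0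
  filter_upwards [hc (prod_mem_nhds hP0 hQ0)] with z hz
  refine (mem_freeSum hP hQ ⟨0, h0P⟩ ⟨0, h0Q⟩).2 ⟨_, hz.1, _, hz.2, 1 / 2, 1 / 2, by norm_num,
    by norm_num, by norm_num, ?_⟩
  ext <;> simp

theorem le_one_on_freeSum_iff {l : StrongDual ℝ (E × E')} :
    (∀ z ∈ freeSum P Q, l z ≤ 1) ↔ (∀ x ∈ P, l (x, 0) ≤ 1) ∧ ∀ y ∈ Q, l (0, y) ≤ 1 := by
  have h0P := interior_subset hP0
  have h0Q := interior_subset hQ0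
  constructor
  · intro h
    exact ⟨fun x hx => h _ ((mem_freeSum_left hP hQ hP0 hQ0).2 hx),
      fun y hy => h _ ((mem_freeSum_right hP hQ hP0 hQ0).2 hy)⟩
  · rintro ⟨h1, h2⟩ z hz
    obtain ⟨x, hx, y, hy, s, t, hs, ht, hst, rfl⟩ :=
      (mem_freeSum hP hQ ⟨0, h0P⟩ ⟨0, h0Q⟩).1 hz
    have e : (s • x, t • y) = s • (x, (0 : E')) + t • ((0 : E), y) := by simp
    rw [e, map_add, map_smul, map_smul, smul_eq_mul, smul_eq_mul]
    nlinarith [h1 x hx, h2 y hy]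

theorem isExposed_slice {G : Set (E × E')} (hG : IsExposed ℝ (freeSum P Q) G) :
    (IsExposed ℝ P {x | (x, (0 : E')) ∈ G} ∧ IsExposed ℝ Q {y | ((0 : E), y) ∈ G}) ∧
      (({x | (x, (0 : E')) ∈ G} ≠ P ∧ {y | ((0 : E), y) ∈ G} ≠ Q) ∨
        G = freeSum P Q ∧ {x | (x, (0 : E')) ∈ G} = P ∧ {y | ((0 : E), y) ∈ G} = Q) := by
  have hl := fun x => mem_freeSum_left hP hQ hP0 hQ0 (x := x)
  have hr := fun y => mem_freeSum_right hP hQ hP0 hQ0 (y := y)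
  by_cases h : G = freeSum P Q
  · subst h
    have e1 : {x | (x, (0 : E')) ∈ freeSum P Q} = P := Set.ext hl
    have e2 : {y | ((0 : E), y) ∈ freeSum P Q} = Q := Set.ext hr
    rw [e1, e2]
    exact ⟨⟨IsExposed.refl _, IsExposed.refl _⟩, Or.inr ⟨rfl, rfl, rfl⟩⟩
  · obtain ⟨l, hl1, rfl⟩ :=
      (isExposed_and_ne_iff (zero_mem_interior_freeSum hP hQ hP0 hQ0)).1 ⟨hG, h⟩
    obtain ⟨h1, h2⟩ := (le_one_on_freeSum_iff hP hQ hP0 hQ0).1 hl1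
    have e1 := (isExposed_and_ne_iff hP0).2
      ⟨l.comp (ContinuousLinearMap.inl ℝ E E'), by simpa using h1, rfl⟩
    have e2 := (isExposed_and_ne_iff hQ0).2
      ⟨l.comp (ContinuousLinearMap.inr ℝ E E'), by simpa using h2, rfl⟩
    have s1 : {x | (x, (0 : E')) ∈ {z ∈ freeSum P Q | l z = 1}} =
        {x ∈ P | (l.comp (ContinuousLinearMap.inl ℝ E E')) x = 1} := by
      ext x
      simp [hl]
    have s2 : {y | ((0 : E), y) ∈ {z ∈ freeSum P Q | l z = 1}} =
        {y ∈ Q | (l.comp (ContinuousLinearMap.inr ℝ E E')) y = 1} := by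
      ext x
      simp [hr]
    rw [s1, s2]
    exact ⟨⟨e1.1, e2.1⟩, Or.inl ⟨e1.2, e2.2⟩⟩

theorem subset_of_slice_subset {G G' : Set (E × E')} (hG : IsExposed ℝ (freeSum P Q) G)
    (hG' : IsExposed ℝ (freeSum P Q) G') (h1 : {x | (x, (0 : E')) ∈ G} ⊆ {x | (x, (0 : E')) ∈ G'})
    (h2 : {y | ((0 : E), y) ∈ G} ⊆ {y | ((0 : E), y) ∈ G'}) : G ⊆ G' := by
  have h0 := zero_mem_interior_freeSum hP hQ hP0 hQ0
  have hl := fun x => mem_freeSum_left hP hQ hP0 hQ0 (x := x)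
  have hr := fun y => mem_freeSum_right hP hQ hP0 hQ0 (y := y)
  have h0P := interior_subset hP0
  have h0Q := interior_subset hQ0
  by_cases e' : G' = freeSum P Q
  · exact e' ▸ hG.subset
  obtain ⟨l', hl1', rfl⟩ := (isExposed_and_ne_iff h0).1 ⟨hG', e'⟩
  by_cases e : G = freeSum P Q
  · subst e
    have := h1 (show (0, 0) ∈ freeSum P Q from (hl 0).2 h0P)
    have h3 : l' (0 : E × E') = 1 := this.2
    simp at h3
  obtain ⟨l, hl1, rfl⟩ := (isExposed_and_ne_iff h0).1 ⟨hG, e⟩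
  rintro z ⟨hz, hlz⟩
  refine ⟨hz, ?_⟩
  obtain ⟨x, hx, y, hy, s, t, hs, ht, hst, rfl⟩ :=
    (mem_freeSum hP hQ ⟨0, h0P⟩ ⟨0, h0Q⟩).1 hz
  have e : (s • x, t • y) = s • (x, (0 : E')) + t • ((0 : E), y) := by simp
  rw [e, map_add, map_smul, map_smul, smul_eq_mul, smul_eq_mul] at hlz ⊢
  have hx1 := hl1 _ ((hl x).2 hx)
  have hy1 := hl1 _ ((hr y).2 hy)
  have hsx : s * l' (x, 0) = s := by
    rcases hs.eq_or_lt with rfl | hs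
    · simp
    · have : l (x, 0) = 1 := by
        refine le_antisymm hx1 ?_
        by_contra hlt
        nlinarith
      have h3 : l' (x, 0) = 1 := (h1 (show (x, (0 : E')) ∈ {z ∈ freeSum P Q | l z = 1} from ⟨(hl x).2 hx, this⟩)).2
      rw [h3, mul_one]
  have hty : t * l' (0, y) = t := by
    rcases ht.eq_or_lt with rfl | ht
    · simp
    · have : l (0, y) = 1 := by
        refine le_antisymm hy1 ?_
        by_contra hlt
        nlinarith
      have h3 : l' (0, y) = 1 := (h2 (show ((0 : E), y) ∈ {z ∈ freeSum P Q | l z = 1} from ⟨(hr y).2 hy, this⟩)).2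
      rw [h3, mul_one]
  rw [hsx, hty, hst]

theorem exists_slice_eq {F : Set E} {F' : Set E'} (hF : IsExposed ℝ P F) (hF' : IsExposed ℝ Q F')
    (hne : F ≠ P) (hne' : F' ≠ Q) :
    ∃ G, IsExposed ℝ (freeSum P Q) G ∧ {x | (x, (0 : E')) ∈ G} = F ∧
      {y | ((0 : E), y) ∈ G} = F' := by
  obtain ⟨l₁, h1, rfl⟩ := (isExposed_and_ne_iff hP0).1 ⟨hF, hne⟩
  obtain ⟨l₂, h2, rfl⟩ := (isExposed_and_ne_iff hQ0).1 ⟨hF', hne'⟩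
  let l : StrongDual ℝ (E × E') := l₁.coprod l₂
  have hl := fun x => mem_freeSum_left hP hQ hP0 hQ0 (x := x)
  have hr := fun y => mem_freeSum_right hP hQ hP0 hQ0 (y := y)
  have h3 := (isExposed_and_ne_iff (zero_mem_interior_freeSum hP hQ hP0 hQ0)).2
    ⟨l, (le_one_on_freeSum_iff hP hQ hP0 hQ0).2 ⟨by simpa [l] using h1, by simpa [l] using h2⟩, rfl⟩
  refine ⟨_, h3.1, ?_, ?_⟩
  · ext x
    simp [hl, l]
  · ext y
    simp [hr, l]

end FreeJoin

section Polytopal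

variable {X Y : Type*} [Lattice X] [BoundedOrder X] [Lattice Y] [BoundedOrder Y]

theorem eq_top_iff_of_orderIso {E : Type*} [NormedAddCommGroup E] [NormedSpace ℝ E] {P : Set E}
    (e : X ≃o {F : Set E // IsExposed ℝ P F}) {F : Set E} (hF : IsExposed ℝ P F) :
    e.symm ⟨F, hF⟩ = ⊤ ↔ F = P := by
  have htop : e ⊤ = ⟨P, IsExposed.refl _⟩ := by
    refine le_antisymm (e ⊤).2.subset ?_
    have := e.monotone (le_top (a := e.symm ⟨P, IsExposed.refl _⟩))
    rwa [e.apply_symm_apply] at this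
  rw [e.symm_apply_eq, htop, Subtype.mk.injEq]

theorem nonempty_join_orderIso [Nontrivial X] [Nontrivial Y] {E E' : Type*} [NormedAddCommGroup E]
    [NormedSpace ℝ E] [NormedAddCommGroup E'] [NormedSpace ℝ E'] {P : Set E} {Q : Set E'}
    (hP : Convex ℝ P) (hQ : Convex ℝ Q) (hP0 : (0 : E) ∈ interior P) (hQ0 : (0 : E') ∈ interior Q)
    (e : X ≃o {F : Set E // IsExposed ℝ P F}) (e' : Y ≃o {F : Set E' // IsExposed ℝ Q F}) :
    Nonempty (Join X Y ≃o {G : Set (E × E') // IsExposed ℝ (freeSum P Q) G}) := by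
  let f : {G : Set (E × E') // IsExposed ℝ (freeSum P Q) G} → Join X Y := fun G =>
    ⟨(e.symm ⟨_, (isExposed_slice hP hQ hP0 hQ0 G.2).1.1⟩,
      e'.symm ⟨_, (isExposed_slice hP hQ hP0 hQ0 G.2).1.2⟩), by
      rcases (isExposed_slice hP hQ hP0 hQ0 G.2).2 with h | h
      · exact Or.inl ⟨fun h' => h.1 ((eq_top_iff_of_orderIso e _).1 h'),
          fun h' => h.2 ((eq_top_iff_of_orderIso e' _).1 h')⟩
      · exact Or.inr (Prod.ext ((eq_top_iff_of_orderIso e _).2 h.2.1)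
          ((eq_top_iff_of_orderIso e' _).2 h.2.2))⟩
  have hf : ∀ G G', f G ≤ f G' ↔ G ≤ G' := by
    intro G G'
    rw [Join.le_iff]
    show e.symm _ ≤ e.symm _ ∧ e'.symm _ ≤ e'.symm _ ↔ _
    rw [e.symm.le_iff_le, e'.symm.le_iff_le]
    constructor
    · rintro ⟨h1, h2⟩
      exact subset_of_slice_subset hP hQ hP0 hQ0 G.2 G'.2 h1 h2
    · intro h
      exact ⟨fun x hx => h hx, fun y hy => h hy⟩
  have hsurj : Function.Surjective f := by
    intro p
    by_cases hp : p = ⊤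
    · refine ⟨⟨freeSum P Q, IsExposed.refl _⟩, ?_⟩
      subst hp
      exact Join.ext_iff.2 ⟨(eq_top_iff_of_orderIso e _).2 (Set.ext fun x =>
        mem_freeSum_left hP hQ hP0 hQ0), (eq_top_iff_of_orderIso e' _).2 (Set.ext fun x =>
        mem_freeSum_right hP hQ hP0 hQ0)⟩
    · obtain ⟨h1, h2⟩ := Join.ne_top hp
      obtain ⟨G, hG, hG1, hG2⟩ := exists_slice_eq hP hQ hP0 hQ0 (e p.fst).2 (e' p.snd).2
        (fun h => h1 (by
          rw [← e.symm_apply_apply p.fst]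
          exact (eq_top_iff_of_orderIso e (e p.fst).2).2 h))
        (fun h => h2 (by
          rw [← e'.symm_apply_apply p.snd]
          exact (eq_top_iff_of_orderIso e' (e' p.snd).2).2 h))
      refine ⟨⟨G, hG⟩, Join.ext_iff.2 ⟨?_, ?_⟩⟩
      · exact (e.symm_apply_eq).2 (Subtype.ext hG1)
      · exact (e'.symm_apply_eq).2 (Subtype.ext hG2)
  let g := OrderEmbedding.ofMapLEIff f hf
  exact ⟨(RelIso.ofSurjective g hsurj).symm⟩

theorem exists_polytope_zero_mem_interior {d : ℕ} {P : Set (Fin d → ℝ)} (hP : IsPolytope P) :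
    ∃ P' : Set (Fin d → ℝ), IsPolytope P' ∧ (0 : Fin d → ℝ) ∈ interior P' ∧
      Nonempty ({F : Set (Fin d → ℝ) // IsExposed ℝ P F} ≃o {F // IsExposed ℝ P' F}) := by
  classical
  obtain ⟨⟨S, hS⟩, c, hc⟩ := hP
  have h0 : (0 : Fin d → ℝ) ∈ interior (Equiv.addRight (-c) '' P) := by
    have := (Homeomorph.addRight (-c)).image_interior P
    have h1 : (0 : Fin d → ℝ) ∈ Homeomorph.addRight (-c) '' interior P := ⟨c, hc, by simp⟩
    rw [this] at h1
    exact h1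
  refine ⟨Equiv.addRight (-c) '' P, ⟨⟨S.image (fun x => x + -c), ?_⟩, 0, h0⟩, h0,
    ⟨exposedOrderIso _ (fun l => ⟨l, l (-c), fun x => by simp⟩)
      (fun l => ⟨l, l c, fun x => by simp⟩) P⟩⟩
  rw [hS, Finset.coe_image]
  have := (AffineEquiv.constVAdd ℝ (Fin d → ℝ) (-c)).toAffineMap.image_convexHull (S : Set (Fin d → ℝ))
  convert this using 2
  · ext x
    simp [add_comm]
  · ext x
    simp [add_comm]

theorem IsPolytope.convex {d : ℕ} {P : Set (Fin d → ℝ)} (hP : IsPolytope P) : Convex ℝ P := by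
  obtain ⟨⟨S, rfl⟩, -⟩ := hP
  exact convex_convexHull _ _

theorem exists_polytope_orderIso_freeSum {d d' : ℕ} {P : Set (Fin d → ℝ)} {Q : Set (Fin d' → ℝ)}
    (hP : IsPolytope P) (hQ : IsPolytope Q) (hP0 : (0 : Fin d → ℝ) ∈ interior P)
    (hQ0 : (0 : Fin d' → ℝ) ∈ interior Q) :
    ∃ R : Set (Fin (d + d') → ℝ), IsPolytope R ∧
      Nonempty ({G // IsExposed ℝ (freeSum P Q) G} ≃o {G // IsExposed ℝ R G}) := by
  classical
  have h0 := zero_mem_interior_freeSum hP.convex hQ.convex hP0 hQ0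
  have hfin : Module.finrank ℝ ((Fin d → ℝ) × (Fin d' → ℝ)) =
      Module.finrank ℝ (Fin (d + d') → ℝ) := by simp
  let φ : ((Fin d → ℝ) × (Fin d' → ℝ)) ≃L[ℝ] (Fin (d + d') → ℝ) :=
    ContinuousLinearEquiv.ofFinrankEq hfin
  refine ⟨φ.toEquiv '' freeSum P Q, ⟨?_, ?_⟩, ⟨exposedOrderIso φ.toEquiv
    (fun l => ⟨l.comp (φ.symm : _ →L[ℝ] _), 0, fun x => ?_⟩) (fun l => ⟨l.comp (φ : _ →L[ℝ] _), 0, fun x => ?_⟩) _⟩⟩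
  · obtain ⟨⟨S, hS⟩, -⟩ := hP
    obtain ⟨⟨T, hT⟩, -⟩ := hQ
    refine ⟨(S.image (LinearMap.inl ℝ _ _) ∪ T.image (LinearMap.inr ℝ _ _)).image φ, ?_⟩
    have e : freeSum P Q = convexHull ℝ (LinearMap.inl ℝ (Fin d → ℝ) (Fin d' → ℝ) '' S ∪
        LinearMap.inr ℝ (Fin d → ℝ) (Fin d' → ℝ) '' T) := by
      rw [freeSum, hS, hT, LinearMap.image_convexHull, LinearMap.image_convexHull,
        convexHull_convexHull_union_left, convexHull_convexHull_union_right]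
    rw [e, Finset.coe_image, Finset.coe_union, Finset.coe_image, Finset.coe_image]
    exact φ.toLinearEquiv.toLinearMap.image_convexHull _
  · have := φ.toHomeomorph.image_interior (freeSum P Q)
    exact ⟨φ 0, this ▸ ⟨0, h0, rfl⟩⟩
  · simp
  · simp

theorem Join.isPolytopalSphere [Nontrivial X] [Nontrivial Y] {m n : ℕ}
    (hX : IsPolytopalSphere X (m + 1)) (hY : IsPolytopalSphere Y (n + 1)) :
    IsPolytopalSphere (Join X Y) (m + n + 2) := by
  obtain ⟨hX', d, P, hP, ⟨e⟩⟩ := hX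
  obtain ⟨hY', d', Q, hQ, ⟨e'⟩⟩ := hY
  obtain ⟨P', hP', hP0, ⟨i⟩⟩ := exists_polytope_zero_mem_interior hP
  obtain ⟨Q', hQ', hQ0, ⟨i'⟩⟩ := exists_polytope_zero_mem_interior hQ
  obtain ⟨R, hR, ⟨j⟩⟩ := exists_polytope_orderIso_freeSum hP' hQ' hP0 hQ0
  obtain ⟨a⟩ := nonempty_join_orderIso hP'.convex hQ'.convex hP0 hQ0 (e.trans i) (e'.trans i')
  exact ⟨Join.isCellularPseudomanifold hX' hY', d + d', R, hR, ⟨a.trans j⟩⟩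

end Polytopal

end CellPM

theorem theorem2p2 {X Y : Type*} [Lattice X] [BoundedOrder X] [Nontrivial X]
    [Lattice Y] [BoundedOrder Y] [Nontrivial Y] (m n : ℕ)
    (hX : CellPM.IsCellularPseudomanifold X (m + 1))
    (hY : CellPM.IsCellularPseudomanifold Y (n + 1)) :
    (CellPM.IsCellularPseudomanifold (CellPM.Join X Y) (m + n + 2) ∧
      CellPM.IsNormalPseudomanifold (m + n + 2) (CellPM.barycentric (CellPM.Join X Y)) ∧
      CellPM.IsNormalPseudomanifold (m + n + 2)
        (CellPM.joinComplex (CellPM.barycentric X) (CellPM.barycentric Y)) ∧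
      CellPM.IsSubdivision (CellPM.barycentric (CellPM.Join X Y))
        (CellPM.joinComplex (CellPM.barycentric X) (CellPM.barycentric Y)) ∧
      CellPM.IsStellarSubdivision (CellPM.barycentric (CellPM.Join X Y))
        (CellPM.joinComplex (CellPM.barycentric X) (CellPM.barycentric Y))) ∧
    (CellPM.IsCellularSphere X (m + 1) → CellPM.IsCellularSphere Y (n + 1) →
      CellPM.IsCellularSphere (CellPM.Join X Y) (m + n + 2)) ∧
    (CellPM.IsPolytopalSphere X (m + 1) → CellPM.IsPolytopalSphere Y (n + 1) →
      CellPM.IsPolytopalSphere (CellPM.Join X Y) (m + n + 2)) ∧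
    (CellPM.IsCellularManifold (CellPM.Join X Y) (m + n + 2) →
      CellPM.IsCellularSphere X (m + 1) ∧ CellPM.IsCellularSphere Y (n + 1) ∧
        CellPM.IsCellularSphere (CellPM.Join X Y) (m + n + 2)) := by
  refine ⟨⟨CellPM.Join.isCellularPseudomanifold hX hY,
    CellPM.isNormalPseudomanifold_iff.2 (CellPM.Join.isNPM_barycentric hX hY),
    CellPM.isNormalPseudomanifold_iff.2 (CellPM.Join.isNPM_joinComplex hX hY),
    CellPM.Join.isSubdivision hX hY,
    CellPM.Join.isStellarSubdivision_of_isCellularPseudomanifold hX hY⟩, ?_,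
    CellPM.Join.isPolytopalSphere, ?_⟩
  · intro h1 h2
    exact ⟨CellPM.Join.isCellularPseudomanifold hX hY,
      CellPM.Join.isCombinatorialSphere hX hY h1.2 h2.2⟩
  · intro h
    obtain ⟨h1, h2⟩ := CellPM.Join.isCombinatorialSphere_of_isCombinatorialManifold hX hY h.2
    exact ⟨⟨hX, h1⟩, ⟨hY, h2⟩, CellPM.Join.isCellularPseudomanifold hX hY,
      CellPM.Join.isCombinatorialSphere hX hY h1 h2⟩
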